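/- Throughout, $\otimes$ between C*-algebras is the minimal (spatial) tensor product. A compact quantum group $G$ is a unital C*-algebra $C(G)$ with a unital $*$-homomorphism $\Delta_G\colon C(G)\to C(G)\otimes C(G)$ such that $(\Delta_G\otimes\mathrm{id})\Delta_G=(\mathrm{id}\otimes\Delta_G)\Delta_G$ and the linear spans of $(1\otimes C(G))\Delta_G(C(G))$ and $(C(G)\otimes 1)\Delta_G(C(G))$ are dense in $C(G)\otimes C(G)$. Its Haar state is the unique state $h_G$ with $(\mathrm{id}\otimes h_G)\Delta_G(a)=h_G(a)1=(h_G\otimes\mathrm{id})\Delta_G(a)$ for all $a\in C(G)$. A quantum subgroup of $G$ is a compact quantum group $K$ with a surjective unital $*$-homomorphism $\pi\colon C(G)\to C(K)$ such that $(\pi\otimes\pi)\Delta_G=\Delta_K\pi$. A finite-dimensional representation of $G$ is an invertible matrix $u=(u_{ij})\in M_n(C(G))$ with $\Delta_G(u_{ij})=\sum_k u_{ik}\otimes u_{kj}$; $\mathrm{Mor}_G(u,v)$ is the space of scalar matrices $T$ with $(T\otimes 1)u=v(T\otimes 1)$; and $\pi(u)=(\pi(u_{ij}))$. We say that $G$ is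 generated by its quantum subgroups $(G_1,\pi_1)$ and $(G_2,\pi_2)$, written $G=\langle G_1,G_2\rangle$, if $\mathrm{Mor}_G(u,v)=\mathrm{Mor}_{G_1}(\pi_1(u),\pi_1(v))\cap\mathrm{Mor}_{G_2}(\pi_2(u),\pi_2(v))$ for all finite-dimensional representations $u,v$ of $G$. A tracial state $\tau$ on a unital C*-algebra $A$ is amenable if there is a net of unital completely positive maps $\varphi_i\colon A\to M_{k_i}(\mathbb C)$ such that $\mathrm{tr}_{k_i}(\varphi_i(a))\to\tau(a)$ and $\mathrm{tr}_{k_i}(\varphi_i(b^*a)-\varphi_i(b^*)\varphi_i(a))\to 0$ for all $a,b\in A$, where $\mathrm{tr}_k$ is the normalized trace on $M_k(\mathbb C)$. **Theorem.** Let $G$ be a compact quantum group with tracial Haar state $h_G$. Let $(G_1,\pi_1)$ and $(G_2,\pi_2)$ be quantum subgroups of $G$ with tracial Haar states $h_{G_1}$ and $h_{G_2}$. Assume that $h_{G_1}$ and $h_{G_2}$ are amenable traces. If $G=\langle G_1,G_2\rangle$, then $h_G$ is an amenable trace. -/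

import Mathlib

open scoped TensorProduct ComplexOrder CStarAlgebra
open Filter Topology

universe u

noncomputable section

/-! ### Representations on Hilbert spaces and the minimal (spatial) tensor product -/

/-- A unital `*`-representation of a unital C*-algebra on a Hilbert space. -/
structure HilbertRep (A : Type u) [CStarAlgebra A] : Type (u + 1) where
  space : Type u
  [normedAddCommGroup : NormedAddCommGroup space]
  [innerProductSpace : InnerProductSpace ℂ space]
  [completeSpace : CompleteSpace space]
  rep : A →⋆ₐ[ℂ] (space →L[ℂ] space)

attribute [instance] HilbertRep.normedAddCommGroup HilbertRep.innerProductSpace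
  HilbertRep.completeSpace

namespace HilbertRep

variable {A B C D : Type u} [CStarAlgebra A] [CStarAlgebra B] [CStarAlgebra C] [CStarAlgebra D]

/-- Restriction of a representation along a unital `*`-homomorphism. -/
def comp (π : HilbertRep C) (f : A →⋆ₐ[ℂ] C) : HilbertRep A where
  space := π.space
  rep := π.rep.comp f

/-- The zero representation, on the zero Hilbert space. -/
def zero (A : Type u) [CStarAlgebra A] : HilbertRep A where
  space := PUnit.{u + 1}
  rep :=
    { toFun := fun _ => 0
      map_one' := Subsingleton.elim _ _
      map_mul' := fun _ _ => Subsingleton.elim _ _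
      map_zero' := rfl
      map_add' := fun _ _ => Subsingleton.elim _ _
      commutes' := fun _ => Subsingleton.elim _ _
      map_star' := fun _ => Subsingleton.elim _ _ }

/-- `T ↦ T ⊗ 1` on bounded operators. -/
def ampliationLeft (H K : Type u) [NormedAddCommGroup H] [InnerProductSpace ℂ H]
    [NormedAddCommGroup K] [InnerProductSpace ℂ K] :
    (H →L[ℂ] H) →ₐ[ℂ] (H ⊗[ℂ] K →L[ℂ] H ⊗[ℂ] K) where
  toFun T := T.rTensor K
  map_one' := ContinuousLinearMap.rTensor_one K
  map_mul' S T := ContinuousLinearMap.rTensor_mul K S T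
  map_zero' := ContinuousLinearMap.rTensor_zero K
  map_add' S T := ContinuousLinearMap.rTensor_add K S T
  commutes' r := by
    rw [Algebra.algebraMap_eq_smul_one, ContinuousLinearMap.rTensor_smul,
      ContinuousLinearMap.rTensor_one, Algebra.algebraMap_eq_smul_one]

/-- `T ↦ 1 ⊗ T` on bounded operators. -/
def ampliationRight (H K : Type u) [NormedAddCommGroup H] [InnerProductSpace ℂ H]
    [NormedAddCommGroup K] [InnerProductSpace ℂ K] :
    (K →L[ℂ] K) →ₐ[ℂ] (H ⊗[ℂ] K →L[ℂ] H ⊗[ℂ] K) where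
  toFun T := T.lTensor H
  map_one' := ContinuousLinearMap.lTensor_id H
  map_mul' S T := ContinuousLinearMap.lTensor_mul H S T
  map_zero' := ContinuousLinearMap.lTensor_zero H
  map_add' S T := ContinuousLinearMap.lTensor_add H S T
  commutes' r := by
    rw [Algebra.algebraMap_eq_smul_one, ContinuousLinearMap.lTensor_smul,
      Algebra.algebraMap_eq_smul_one]
    congr 1
    exact ContinuousLinearMap.lTensor_id H

lemma ampliation_commute {H K : Type u} [NormedAddCommGroup H] [InnerProductSpace ℂ H]
    [NormedAddCommGroup K] [InnerProductSpace ℂ K] (S : H →L[ℂ] H) (T : K →L[ℂ] K) :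
    Commute (ampliationLeft H K S) (ampliationRight H K T) := by
  refine ContinuousLinearMap.ext fun x => ?_
  change S.rTensor K (T.lTensor H x) = T.lTensor H (S.rTensor K x)
  induction x using TensorProduct.induction_on with
  | zero => simp only [map_zero]
  | tmul x y =>
    rw [ContinuousLinearMap.lTensor_tmul, ContinuousLinearMap.rTensor_tmul,
      ContinuousLinearMap.rTensor_tmul, ContinuousLinearMap.lTensor_tmul]
  | add x y hx hy => simp only [map_add, hx, hy]

/-- The tensor product representation `π ⊗ σ` of the algebraic tensor product `A ⊗ B`:
`(π ⊗ σ)(a ⊗ b) = π a ⊗ σ b`. It acts by bounded operators on the algebraic tensor product of the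
two Hilbert spaces with its usual inner product, a dense subspace of the Hilbert space tensor
product, so that operator norms are the same as on the completion. -/
def tensor (π : HilbertRep A) (σ : HilbertRep B) :
    A ⊗[ℂ] B →ₐ[ℂ] (π.space ⊗[ℂ] σ.space →L[ℂ] π.space ⊗[ℂ] σ.space) :=
  Algebra.TensorProduct.lift
    ((ampliationLeft π.space σ.space).comp π.rep.toAlgHom)
    ((ampliationRight π.space σ.space).comp σ.rep.toAlgHom)
    (fun _ _ => ampliation_commute _ _)

lemma tensor_tmul_eq (π : HilbertRep A) (σ : HilbertRep B) (a : A) (b : B) :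
    π.tensor σ (a ⊗ₜ b) = (π.rep a).rTensor σ.space * (σ.rep b).lTensor π.space :=
  Algebra.TensorProduct.lift_tmul _ _ _ a b

lemma tensor_tmul (π : HilbertRep A) (σ : HilbertRep B) (a : A) (b : B)
    (x : π.space) (y : σ.space) :
    π.tensor σ (a ⊗ₜ b) (x ⊗ₜ y) = π.rep a x ⊗ₜ σ.rep b y := by
  rw [tensor_tmul_eq]
  rfl

lemma tensor_comp (π : HilbertRep C) (σ : HilbertRep D) (f : A →⋆ₐ[ℂ] C) (g : B →⋆ₐ[ℂ] D)
    (x : A ⊗[ℂ] B) :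
    (π.comp f).tensor (σ.comp g) x
      = π.tensor σ (Algebra.TensorProduct.map f.toAlgHom g.toAlgHom x) := by
  induction x using TensorProduct.induction_on with
  | zero => rw [map_zero, map_zero, map_zero]; rfl
  | tmul a b => rw [Algebra.TensorProduct.map_tmul, tensor_tmul_eq, tensor_tmul_eq]; rfl
  | add x y hx hy => rw [map_add, map_add, map_add, hx, hy]; rfl

lemma tensor_inner (π : HilbertRep A) (σ : HilbertRep B) (x : A ⊗[ℂ] B)
    (v w : π.space ⊗[ℂ] σ.space) :
    inner ℂ (π.tensor σ x v) w = inner ℂ v (π.tensor σ (star x) w) := by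
  induction x using TensorProduct.induction_on with
  | zero => simp
  | add x y hx hy =>
    simp only [map_add, star_add, add_apply, inner_add_left, inner_add_right,
      hx, hy]
  | tmul a b =>
    induction v using TensorProduct.induction_on with
    | zero => simp
    | add v v' hv hv' => simp only [map_add, inner_add_left, hv, hv']
    | tmul p q =>
      induction w using TensorProduct.induction_on with
      | zero => simp
      | add w w' hw hw' => simp only [map_add, inner_add_right, hw, hw']
      | tmul p' q' =>
        rw [TensorProduct.star_tmul, tensor_tmul, tensor_tmul, TensorProduct.inner_tmul,
          TensorProduct.inner_tmul, map_star, map_star, ContinuousLinearMap.star_eq_adjoint,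
          ContinuousLinearMap.star_eq_adjoint, ContinuousLinearMap.adjoint_inner_right,
          ContinuousLinearMap.adjoint_inner_right]

lemma norm_rep_le (π : HilbertRep A) (a : A) : ‖π.rep a‖ ≤ ‖a‖ :=
  NonUnitalStarAlgHom.norm_apply_le π.rep a

lemma norm_tensor_zero (π : HilbertRep A) (σ : HilbertRep B) :
    ‖π.tensor σ 0‖ = 0 := by
  rw [map_zero]
  exact ContinuousLinearMap.opNorm_zero

lemma norm_tensor_neg (π : HilbertRep A) (σ : HilbertRep B) (x : A ⊗[ℂ] B) :
    ‖π.tensor σ (-x)‖ = ‖π.tensor σ x‖ := by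
  rw [map_neg]
  exact ContinuousLinearMap.opNorm_neg _

lemma norm_tensor_add_le (π : HilbertRep A) (σ : HilbertRep B) (x y : A ⊗[ℂ] B) :
    ‖π.tensor σ (x + y)‖ ≤ ‖π.tensor σ x‖ + ‖π.tensor σ y‖ := by
  rw [map_add]
  exact ContinuousLinearMap.opNorm_add_le _ _

lemma norm_tensor_smul_le (π : HilbertRep A) (σ : HilbertRep B) (r : ℂ) (x : A ⊗[ℂ] B) :
    ‖π.tensor σ (r • x)‖ ≤ ‖r‖ * ‖π.tensor σ x‖ := by
  rw [map_smul]
  exact ContinuousLinearMap.opNorm_smul_le _ _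

lemma norm_tensor_tmul_le (π : HilbertRep A) (σ : HilbertRep B) (a : A) (b : B) :
    ‖π.tensor σ (a ⊗ₜ b)‖ ≤ ‖a‖ * ‖b‖ := by
  rw [tensor_tmul_eq]
  refine (ContinuousLinearMap.opNorm_comp_le _ _).trans
    (mul_le_mul ?_ ?_ (ContinuousLinearMap.opNorm_nonneg _) (norm_nonneg _))
  · exact (ContinuousLinearMap.norm_rTensor_le _ _).trans (π.norm_rep_le a)
  · exact (ContinuousLinearMap.norm_lTensor_le _ _).trans (σ.norm_rep_le b)

lemma norm_tensor_sq_le (π : HilbertRep A) (σ : HilbertRep B) (x : A ⊗[ℂ] B) :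
    ‖π.tensor σ x‖ ^ 2 ≤ ‖π.tensor σ (star x * x)‖ := by
  have h : ‖π.tensor σ x‖ ≤ Real.sqrt ‖π.tensor σ (star x * x)‖ := by
    refine ContinuousLinearMap.opNorm_le_bound _ (Real.sqrt_nonneg _) fun v => ?_
    rw [← Real.sqrt_sq (norm_nonneg v),
      ← Real.sqrt_mul (ContinuousLinearMap.opNorm_nonneg _)]
    refine Real.le_sqrt_of_sq_le ?_
    have h1 : (‖π.tensor σ x v‖ : ℝ) ^ 2 = ‖(inner ℂ v (π.tensor σ (star x * x) v) : ℂ)‖ := by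
      rw [map_mul, mul_apply_eq_comp, ← tensor_inner]
      have h2 := inner_self_eq_norm_sq_to_K (𝕜 := ℂ) (E := π.space ⊗[ℂ] σ.space) (π.tensor σ x v)
      refine Eq.trans ?_ (congrArg norm h2).symm
      simp
    rw [h1]
    refine (norm_inner_le_norm (𝕜 := ℂ) (E := π.space ⊗[ℂ] σ.space) _ _).trans ?_
    calc ‖v‖ * ‖π.tensor σ (star x * x) v‖
        ≤ ‖v‖ * (‖π.tensor σ (star x * x)‖ * ‖v‖) := by
          gcongr; exact ContinuousLinearMap.le_opNorm _ _
      _ = _ := by ring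
  calc ‖π.tensor σ x‖ ^ 2 ≤ (Real.sqrt ‖π.tensor σ (star x * x)‖) ^ 2 := by gcongr
    _ = _ := Real.sq_sqrt (ContinuousLinearMap.opNorm_nonneg _)

end HilbertRep

/-- The algebraic tensor product of two C*-algebras, to be endowed with the minimal C*-norm. -/
def AlgTensor (A B : Type u) [CStarAlgebra A] [CStarAlgebra B] : Type u := A ⊗[ℂ] B

section MinTensor

variable {A B C D : Type u} [CStarAlgebra A] [CStarAlgebra B] [CStarAlgebra C] [CStarAlgebra D]

/-- The minimal (spatial) norm on the algebraic tensor product: the supremum of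
`‖(π ⊗ σ)(x)‖` over all representations `π` of `A` and `σ` of `B` on Hilbert spaces. -/
def minNorm (x : A ⊗[ℂ] B) : ℝ :=
  ⨆ p : HilbertRep A × HilbertRep B, ‖p.1.tensor p.2 x‖

lemma minNorm_bddAbove (x : A ⊗[ℂ] B) :
    BddAbove (Set.range fun p : HilbertRep A × HilbertRep B => ‖p.1.tensor p.2 x‖) := by
  induction x using TensorProduct.induction_on with
  | zero => exact ⟨0, by rintro _ ⟨p, rfl⟩; exact (p.1.norm_tensor_zero p.2).le⟩
  | tmul a b => exact ⟨‖a‖ * ‖b‖, by rintro _ ⟨p, rfl⟩; exact p.1.norm_tensor_tmul_le p.2 a b⟩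
  | add x y hx hy =>
    obtain ⟨c, hc⟩ := hx
    obtain ⟨d, hd⟩ := hy
    refine ⟨c + d, ?_⟩
    rintro _ ⟨p, rfl⟩
    have h1 := hc ⟨p, rfl⟩
    have h2 := hd ⟨p, rfl⟩
    exact (p.1.norm_tensor_add_le p.2 x y).trans (add_le_add h1 h2)

lemma norm_tensor_le_minNorm (π : HilbertRep A) (σ : HilbertRep B) (x : A ⊗[ℂ] B) :
    ‖π.tensor σ x‖ ≤ minNorm x :=
  le_ciSup (minNorm_bddAbove x) (π, σ)

lemma minNorm_le {x : A ⊗[ℂ] B} {c : ℝ}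
    (h : ∀ (π : HilbertRep A) (σ : HilbertRep B), ‖π.tensor σ x‖ ≤ c) : minNorm x ≤ c :=
  haveI : Nonempty (HilbertRep A × HilbertRep B) := ⟨(HilbertRep.zero A, HilbertRep.zero B)⟩
  ciSup_le fun p => h p.1 p.2

lemma minNorm_nonneg (x : A ⊗[ℂ] B) : 0 ≤ minNorm x :=
  (ContinuousLinearMap.opNorm_nonneg _).trans (norm_tensor_le_minNorm (HilbertRep.zero A) (HilbertRep.zero B) x)

lemma minNorm_mul_le (x y : A ⊗[ℂ] B) : minNorm (x * y) ≤ minNorm x * minNorm y :=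
  minNorm_le fun π σ => by
    rw [map_mul]
    exact (ContinuousLinearMap.opNorm_comp_le _ _).trans (mul_le_mul (norm_tensor_le_minNorm π σ x)
      (norm_tensor_le_minNorm π σ y) (ContinuousLinearMap.opNorm_nonneg _) (minNorm_nonneg x))

lemma minNorm_sq_le (x : A ⊗[ℂ] B) : minNorm x ^ 2 ≤ minNorm (star x * x) := by
  have h : minNorm x ≤ Real.sqrt (minNorm (star x * x)) := minNorm_le fun π σ =>
    Real.le_sqrt_of_sq_le
      ((π.norm_tensor_sq_le σ x).trans (norm_tensor_le_minNorm π σ _))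
  calc minNorm x ^ 2 ≤ (Real.sqrt (minNorm (star x * x))) ^ 2 := by
        gcongr; exact minNorm_nonneg x
    _ = _ := Real.sq_sqrt (minNorm_nonneg _)

lemma minNorm_star_le (x : A ⊗[ℂ] B) : minNorm x ≤ minNorm (star x) := by
  have h := (minNorm_sq_le x).trans (minNorm_mul_le (star x) x)
  rcases (minNorm_nonneg x).eq_or_lt with h0 | h0
  · rw [← h0]; exact minNorm_nonneg _
  · rw [sq] at h
    exact le_of_mul_le_mul_right h h0

lemma minNorm_star (x : A ⊗[ℂ] B) : minNorm (star x) = minNorm x :=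
  le_antisymm (by simpa using minNorm_star_le (star x)) (minNorm_star_le x)

instance : Ring (AlgTensor A B) := inferInstanceAs (Ring (A ⊗[ℂ] B))
instance : Algebra ℂ (AlgTensor A B) := inferInstanceAs (Algebra ℂ (A ⊗[ℂ] B))
instance : StarRing (AlgTensor A B) := inferInstanceAs (StarRing (A ⊗[ℂ] B))
instance : StarModule ℂ (AlgTensor A B) := inferInstanceAs (StarModule ℂ (A ⊗[ℂ] B))

/-- The algebraic tensor product with the minimal C*-norm. -/
instance : SeminormedRing (AlgTensor A B) where
  __ := (inferInstance : Ring (AlgTensor A B))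
  __ := AddGroupSeminorm.toSeminormedAddCommGroup (E := A ⊗[ℂ] B)
    { toFun := minNorm
      map_zero' := le_antisymm (minNorm_le fun π σ => (π.norm_tensor_zero σ).le) (minNorm_nonneg _)
      add_le' := fun x y => minNorm_le fun π σ =>
        (π.norm_tensor_add_le σ x y).trans
          (add_le_add (norm_tensor_le_minNorm π σ x) (norm_tensor_le_minNorm π σ y))
      neg' := fun x => by simp only [minNorm, HilbertRep.norm_tensor_neg] }
  norm_mul_le := minNorm_mul_le

lemma AlgTensor.norm_def (x : AlgTensor A B) : ‖x‖ = minNorm (A := A) (B := B) x := rfl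

instance : NormedAlgebra ℂ (AlgTensor A B) where
  norm_smul_le := fun r x => minNorm_le (A := A) (B := B) fun π σ =>
    (π.norm_tensor_smul_le σ r x).trans
      (mul_le_mul_of_nonneg_left (norm_tensor_le_minNorm π σ x) (norm_nonneg r))

instance : NormedStarGroup (AlgTensor A B) where
  norm_star_le := fun x => (minNorm_star (A := A) (B := B) x).le

/-- The minimal C*-algebraic tensor product: the completion of the algebraic tensor product in the
minimal norm. -/
abbrev MinTensor (A B : Type u) [CStarAlgebra A] [CStarAlgebra B] : Type u :=
  UniformSpace.Completion (AlgTensor A B)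

namespace MinTensor

open UniformSpace

instance : NormedAlgebra ℂ (MinTensor A B) where
  norm_smul_le := norm_smul_le

instance : Star (MinTensor A B) := ⟨Completion.map star⟩

lemma coe_star (x : AlgTensor A B) : ((star x : AlgTensor A B) : MinTensor A B) = star (x : MinTensor A B) :=
  (Completion.map_coe (star_isometry (E := AlgTensor A B)).uniformContinuous x).symm

lemma continuous_star' : Continuous (star : MinTensor A B → MinTensor A B) :=
  Completion.continuous_map

instance : StarRing (MinTensor A B) where
  star_involutive x := by
    induction x using Completion.induction_on with
    | hp => exact isClosed_eq (continuous_star'.comp continuous_star') continuous_id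
    | ih x => rw [← coe_star, ← coe_star, star_star]
  star_mul x y := by
    induction x, y using Completion.induction_on₂ with
    | hp =>
      exact isClosed_eq (continuous_star'.comp continuous_mul)
        ((continuous_star'.comp continuous_snd).mul (continuous_star'.comp continuous_fst))
    | ih x y =>
      rw [← Completion.coe_mul, ← coe_star, ← coe_star, ← coe_star, ← Completion.coe_mul, star_mul]
  star_add x y := by
    induction x, y using Completion.induction_on₂ with
    | hp =>
      exact isClosed_eq (continuous_star'.comp continuous_add)
        ((continuous_star'.comp continuous_fst).add (continuous_star'.comp continuous_snd))
    | ih x y =>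
      rw [← Completion.coe_add, ← coe_star, ← coe_star, ← coe_star, ← Completion.coe_add, star_add]

instance : StarModule ℂ (MinTensor A B) where
  star_smul r x := by
    induction x using Completion.induction_on with
    | hp =>
      exact isClosed_eq (continuous_star'.comp (continuous_const_smul r))
        (continuous_star'.const_smul (star r))
    | ih x => rw [← Completion.coe_smul, ← coe_star, ← coe_star, ← Completion.coe_smul, star_smul]

instance : CStarRing (MinTensor A B) where
  norm_mul_self_le x := by
    induction x using Completion.induction_on with
    | hp =>
      exact isClosed_le (continuous_norm.mul continuous_norm)
        (continuous_norm.comp (continuous_star'.mul continuous_id))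
    | ih x =>
      rw [← coe_star, ← Completion.coe_mul, Completion.norm_coe, Completion.norm_coe, ← sq]
      exact minNorm_sq_le (A := A) (B := B) x

instance : CStarAlgebra (MinTensor A B) where

/-- The elementary tensor `a ⊗ b` in the minimal tensor product. -/
def tmul (a : A) (b : B) : MinTensor A B :=
  ((show AlgTensor A B from a ⊗ₜ[ℂ] b : AlgTensor A B) : MinTensor A B)

/-- The homomorphism of algebraic tensor products `f ⊗ g`, contractive for the minimal norms. -/
def algMap (f : A →⋆ₐ[ℂ] C) (g : B →⋆ₐ[ℂ] D) : AlgTensor A B →+* AlgTensor C D :=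
  (Algebra.TensorProduct.map f.toAlgHom g.toAlgHom : A ⊗[ℂ] B →ₐ[ℂ] C ⊗[ℂ] D).toRingHom

lemma norm_algMap_le (f : A →⋆ₐ[ℂ] C) (g : B →⋆ₐ[ℂ] D) (x : AlgTensor A B) :
    ‖algMap f g x‖ ≤ ‖x‖ :=
  minNorm_le fun π σ => by
    have h := norm_tensor_le_minNorm (π.comp f) (σ.comp g) (show A ⊗[ℂ] B from x)
    rw [HilbertRep.tensor_comp] at h
    exact h

lemma continuous_algMap (f : A →⋆ₐ[ℂ] C) (g : B →⋆ₐ[ℂ] D) : Continuous (algMap f g) :=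
  AddMonoidHomClass.continuous_of_bound (algMap f g) 1 fun x => by
    rw [one_mul]; exact norm_algMap_le f g x

lemma algMap_star (f : A →⋆ₐ[ℂ] C) (g : B →⋆ₐ[ℂ] D) (x : AlgTensor A B) :
    algMap f g (star x) = star (algMap f g x) := by
  change Algebra.TensorProduct.map f.toAlgHom g.toAlgHom (star (show A ⊗[ℂ] B from x))
    = star (Algebra.TensorProduct.map f.toAlgHom g.toAlgHom (show A ⊗[ℂ] B from x))
  generalize (show A ⊗[ℂ] B from x) = y
  induction y using TensorProduct.induction_on with
  | zero => simp
  | tmul a b => simp [TensorProduct.star_tmul, map_star]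
  | add x y hx hy => simp only [star_add, map_add, hx, hy]

/-- The unital `*`-homomorphism `f ⊗ g` between minimal tensor products. -/
def map (f : A →⋆ₐ[ℂ] C) (g : B →⋆ₐ[ℂ] D) : MinTensor A B →⋆ₐ[ℂ] MinTensor C D where
  __ := Completion.mapRingHom (algMap f g) (continuous_algMap f g)
  commutes' r := by
    change Completion.mapRingHom (algMap f g) (continuous_algMap f g)
      ((algebraMap ℂ (AlgTensor A B) r : AlgTensor A B) : MinTensor A B) = _
    rw [Completion.mapRingHom_coe]
    exact congrArg _ ((Algebra.TensorProduct.map f.toAlgHom g.toAlgHom).commutes r)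
  map_star' x := by
    change Completion.map (algMap f g) (star x) = star (Completion.map (algMap f g) x)
    have hu := uniformContinuous_addMonoidHom_of_continuous (continuous_algMap f g)
    induction x using Completion.induction_on with
    | hp =>
      exact isClosed_eq (Completion.continuous_map.comp continuous_star')
        (continuous_star'.comp Completion.continuous_map)
    | ih x =>
      rw [← coe_star, Completion.map_coe hu, Completion.map_coe hu, ← coe_star, algMap_star]

lemma map_tmul (f : A →⋆ₐ[ℂ] C) (g : B →⋆ₐ[ℂ] D) (a : A) (b : B) :
    map f g (tmul a b) = tmul (f a) (g b) :=
  (Completion.map_coe (uniformContinuous_addMonoidHom_of_continuous (continuous_algMap f g)) _)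

end MinTensor

end MinTensor

/-! ### Compact quantum groups -/

/-- A compact quantum group in the sense of Woronowicz with algebra `C(G) = A`: a unital
`*`-homomorphism `Δ : A → A ⊗ A` that is coassociative and such that the linear spans of
`(1 ⊗ A) Δ(A)` and `(A ⊗ 1) Δ(A)` are dense in `A ⊗ A`. -/
structure CompactQuantumGroup (A : Type u) [CStarAlgebra A] where
  /-- The coproduct `Δ`. -/
  comul : A →⋆ₐ[ℂ] MinTensor A A
  /-- `(Δ ⊗ id) Δ = (id ⊗ Δ) Δ` under the canonical identification `e` of `(A ⊗ A) ⊗ A` with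
  `A ⊗ (A ⊗ A)`. -/
  coassoc : ∃ e : MinTensor (MinTensor A A) A ≃⋆ₐ[ℂ] MinTensor A (MinTensor A A),
    (∀ a b c : A, e (MinTensor.tmul (MinTensor.tmul a b) c)
      = MinTensor.tmul a (MinTensor.tmul b c)) ∧
    ∀ a : A, e (MinTensor.map comul (StarAlgHom.id ℂ A) (comul a))
      = MinTensor.map (StarAlgHom.id ℂ A) comul (comul a)
  dense_one_tmul_mul : Dense (Submodule.span ℂ
    {x : MinTensor A A | ∃ a b : A, x = MinTensor.tmul 1 a * comul b} : Set (MinTensor A A))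
  dense_tmul_one_mul : Dense (Submodule.span ℂ
    {x : MinTensor A A | ∃ a b : A, x = MinTensor.tmul a 1 * comul b} : Set (MinTensor A A))

namespace CompactQuantumGroup

variable {A B : Type u} [CStarAlgebra A] [CStarAlgebra B]

/-- The state `h` is the Haar state of `G`: `(id ⊗ h) Δ(a) = h(a) 1 = (h ⊗ id) Δ(a)`. The slice map
`id ⊗ h` is the unique bounded linear map `A ⊗ A → A` with `a ⊗ b ↦ h(b) a`; likewise `h ⊗ id`. -/
structure IsHaarState [PartialOrder A] [StarOrderedRing A] (G : CompactQuantumGroup A)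
    (h : A →ₚ[ℂ] ℂ) : Prop where
  map_one : h 1 = 1
  right_invariant : ∃ S : MinTensor A A →L[ℂ] A,
    (∀ a b : A, S (MinTensor.tmul a b) = h b • a) ∧ ∀ a : A, S (G.comul a) = h a • (1 : A)
  left_invariant : ∃ S : MinTensor A A →L[ℂ] A,
    (∀ a b : A, S (MinTensor.tmul a b) = h a • b) ∧ ∀ a : A, S (G.comul a) = h a • (1 : A)

/-- A finite-dimensional representation of `G`, as an invertible matrix `u` over `C(G)` with
`Δ(u_ij) = ∑ k, u_ik ⊗ u_kj`. -/
structure IsRep (G : CompactQuantumGroup A) {n : ℕ} (u : Matrix (Fin n) (Fin n) A) : Prop where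
  isUnit : IsUnit u
  comul_apply : ∀ i j, G.comul (u i j) = ∑ k, MinTensor.tmul (u i k) (u k j)

/-- `K` is a quantum subgroup of `G` through `π : C(G) → C(K)`: a surjective unital
`*`-homomorphism with `(π ⊗ π) Δ_G = Δ_K π`. -/
structure IsQuantumSubgroup (G : CompactQuantumGroup A) (K : CompactQuantumGroup B)
    (π : A →⋆ₐ[ℂ] B) : Prop where
  surjective : Function.Surjective π
  map_comul : ∀ a : A, MinTensor.map π π (G.comul a) = K.comul (π a)

end CompactQuantumGroup

/-- The space `Mor(u, v)` of intertwiners: scalar matrices `T` with `(T ⊗ 1) u = v (T ⊗ 1)`. -/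
def intertwiners {A : Type u} [CStarAlgebra A] {m n : ℕ} (u : Matrix (Fin m) (Fin m) A)
    (v : Matrix (Fin n) (Fin n) A) : Submodule ℂ (Matrix (Fin n) (Fin m) ℂ) where
  carrier := {T | T.map (algebraMap ℂ A) * u = v * T.map (algebraMap ℂ A)}
  add_mem' {S T} hS hT := by
    simp only [Set.mem_ofPred_eq] at hS hT ⊢
    rw [Matrix.map_add _ (fun a b => map_add _ a b), Matrix.add_mul, Matrix.mul_add, hS, hT]
  zero_mem' := by simp
  smul_mem' c T hT := by
    simp only [Set.mem_ofPred_eq] at hT ⊢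
    have h : (c • T).map (algebraMap ℂ A) = c • T.map (algebraMap ℂ A) := by
      ext i j
      simp [Algebra.smul_def]
    rw [h, Matrix.smul_mul, Matrix.mul_smul, hT]

/-- `G` is generated by its quantum subgroups `(G₁, π₁)` and `(G₂, π₂)` in the sense of
Brannan, Collins and Vergnioux:
`Mor_G(u, v) = Mor_{G₁}(π₁(u), π₁(v)) ∩ Mor_{G₂}(π₂(u), π₂(v))` for all finite-dimensional
representations `u`, `v` of `G`. -/
def CompactQuantumGroup.IsGeneratedBy {A A₁ A₂ : Type u} [CStarAlgebra A] [CStarAlgebra A₁]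
    [CStarAlgebra A₂] (G : CompactQuantumGroup A) (π₁ : A →⋆ₐ[ℂ] A₁) (π₂ : A →⋆ₐ[ℂ] A₂) : Prop :=
  ∀ (m n : ℕ) (u : Matrix (Fin m) (Fin m) A) (v : Matrix (Fin n) (Fin n) A),
    G.IsRep u → G.IsRep v →
      intertwiners u v
        = intertwiners (u.map π₁) (v.map π₁) ⊓ intertwiners (u.map π₂) (v.map π₂)

/-! ### Amenable traces -/

/-- The normalized trace on the `k × k` complex matrices. -/
def normalizedTrace {k : ℕ} (M : CStarMatrix (Fin k) (Fin k) ℂ) : ℂ :=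
  (k : ℂ)⁻¹ * ∑ i, M i i

/-- A tracial state. -/
structure IsTracialState {A : Type u} [CStarAlgebra A] [PartialOrder A] [StarOrderedRing A]
    (τ : A →ₚ[ℂ] ℂ) : Prop where
  map_one : τ 1 = 1
  map_mul_comm : ∀ a b : A, τ (a * b) = τ (b * a)

/-- An amenable trace: a tracial state `τ` for which there is a net of unital completely positive
maps `φ i : A → M_{k i}(ℂ)` with `tr (φ i a) → τ a` and
`tr (φ i (b* a) - φ i (b*) φ i a) → 0` for all `a`, `b`. -/
structure IsAmenableTrace {A : Type u} [CStarAlgebra A] [PartialOrder A] [StarOrderedRing A]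
    (τ : A →ₚ[ℂ] ℂ) : Prop where
  isTracialState : IsTracialState τ
  exists_net : ∃ (ι : Type u) (_ : Preorder ι) (_ : IsDirectedOrder ι) (_ : Nonempty ι)
    (k : ι → ℕ) (φ : ∀ i, A →CP CStarMatrix (Fin (k i)) (Fin (k i)) ℂ),
    (∀ i, 0 < k i) ∧ (∀ i, φ i 1 = 1) ∧
    (∀ a, Tendsto (fun i => normalizedTrace (φ i a)) atTop (𝓝 (τ a))) ∧
    ∀ a b, Tendsto (fun i => normalizedTrace (φ i (star b * a) - φ i (star b) * φ i a))
      atTop (𝓝 0)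

end

noncomputable section

/-! ### Tensor products of representations on the minimal tensor product -/

namespace MinTensor

open UniformSpace

variable {A B : Type u} [CStarAlgebra A] [CStarAlgebra B]

/-! Put `μᵢ = hᵢ ∘ πᵢ`, a state on `C(G)` that is idempotent for convolution. The Haar state of `G`
is the pointwise limit of the convolution products `μ₁ * (μ₁ * μ₂ * μ₁)ⁿ`, and amenability survives
every operation used to form this limit.

Stability. By Stinespring, a unital completely positive map to matrices is the compression of a
representation to a finite orthonormal family of vectors (`MatrixModel`), and amenability says that
`τ` is a limit of normalized traces of such compressions which are asymptotically multiplicative in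
trace (`IsMatricialLimit`). This class is stable under pullback along `*`-homomorphisms, under
minimal tensor products (tensor the orthonormal families) and under pointwise limits. Since `μ * ν =
(μ ⊗ ν) ∘ Δ`, it is stable under convolution (`IsMatricialLimit.comp_conv`).

Convergence. On the GNS space `L²(G)` of `h`, convolution by `μᵢ` is a contractive idempotent, hence
an orthogonal projection `Eᵢ`. Von Neumann's alternating projections (`tendsto_alternating`) give
strong convergence of `(E₁ E₂ E₁)ⁿ` to the projection onto the common fixed vectors. Once these are
known to be the multiples of `Ω = gnsVec h 1`, convergence of matrix coefficients yields convergence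
of the functionals to `h` (`IsGeneratedBy.tendsto_convPow`).

Common fixed vectors (`IsGeneratedBy.eq_zero_of_fixed`). This is where generation enters, and it
needs enough finite-dimensional representations. For each `a`, the kernel operator `T` of `Δ(a)` is
compact, and strong invariance of `h` identifies `T* T` with a right convolution operator
(`IsHaarState.smoothing_gnsVec`), which commutes with all left convolutions. Its eigenspaces for
nonzero eigenvalues are finite-dimensional, come from elements of `C(G)` and are invariant under
left convolution, so they carry representations of `G`, unitary because `h` is a trace. An
eigenvector fixed by `E₁` and `E₂` is an intertwiner to the trivial representation for both
subgroups, hence for `G`, hence a multiple of `Ω`. The spectral theorem then makes every `T* T`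
vanish on the fixed vectors orthogonal to `Ω`, and these operators have no common kernel because
`(C(G) ⊗ 1) Δ(C(G))` has dense span. -/

lemma tmul_mul_tmul (a c : A) (b d : B) : tmul a b * tmul c d = tmul (a * c) (b * d) := by
  unfold tmul
  rw [← Completion.coe_mul]
  exact congrArg _ (Algebra.TensorProduct.tmul_mul_tmul a c b d)

lemma star_tmul (a : A) (b : B) : star (tmul a b) = tmul (star a) (star b) := by
  unfold tmul
  rw [← coe_star]
  exact congrArg _ (TensorProduct.star_tmul a b)

lemma tmul_one_one : tmul (1 : A) (1 : B) = 1 := rfl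

lemma add_tmul (a a' : A) (b : B) : tmul (a + a') b = tmul a b + tmul a' b := by
  unfold tmul
  rw [← Completion.coe_add]
  exact congrArg _ (TensorProduct.add_tmul a a' b)

lemma tmul_add (a : A) (b b' : B) : tmul a (b + b') = tmul a b + tmul a b' := by
  unfold tmul
  rw [← Completion.coe_add]
  exact congrArg _ (TensorProduct.tmul_add a b b')

lemma smul_tmul' (r : ℂ) (a : A) (b : B) : tmul (r • a) b = r • tmul a b := by
  unfold tmul
  rw [← Completion.coe_smul]
  exact congrArg _ (TensorProduct.smul_tmul' r a b).symm

lemma tmul_smul (r : ℂ) (a : A) (b : B) : tmul a (r • b) = r • tmul a b := by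
  unfold tmul
  rw [← Completion.coe_smul]
  exact congrArg _ (TensorProduct.tmul_smul r a b)

/-- `(a, b) ↦ a ⊗ b` as a bilinear map. -/
def tmulₗ : A →ₗ[ℂ] B →ₗ[ℂ] MinTensor A B :=
  LinearMap.mk₂ ℂ tmul add_tmul smul_tmul' tmul_add tmul_smul

lemma sum_tmul {ι : Type*} (s : Finset ι) (f : ι → A) (b : B) :
    tmul (∑ i ∈ s, f i) b = ∑ i ∈ s, tmul (f i) b := by
  change tmulₗ (∑ i ∈ s, f i) b = ∑ i ∈ s, tmulₗ (f i) b
  simp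

lemma coe_mem_span_tmul (x : AlgTensor A B) :
    (x : MinTensor A B) ∈ Submodule.span ℂ (Set.range fun p : A × B => tmul p.1 p.2) := by
  have h : ∀ y : A ⊗[ℂ] B, (((show AlgTensor A B from y) : AlgTensor A B) : MinTensor A B) ∈
      Submodule.span ℂ (Set.range fun p : A × B => tmul p.1 p.2) := by
    intro y
    induction y using TensorProduct.induction_on with
    | zero => exact Submodule.zero_mem _
    | tmul a b => exact Submodule.subset_span ⟨(a, b), rfl⟩
    | add y z hy hz =>
      have := Submodule.add_mem _ hy hz
      rw [← Completion.coe_add] at this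
      exact this
  exact h x

lemma dense_span_tmul :
    Dense (Submodule.span ℂ (Set.range fun p : A × B => tmul p.1 p.2) : Set (MinTensor A B)) :=
  (Completion.denseRange_coe (α := AlgTensor A B)).mono
    (by rintro _ ⟨x, rfl⟩; exact coe_mem_span_tmul x)

/-- Bounded linear maps on a minimal tensor product are determined by elementary tensors. -/
lemma clm_ext {E : Type*} [NormedAddCommGroup E] [NormedSpace ℂ E] {f g : MinTensor A B →L[ℂ] E}
    (h : ∀ a b, f (tmul a b) = g (tmul a b)) : f = g :=
  ContinuousLinearMap.ext_on dense_span_tmul (by rintro _ ⟨p, rfl⟩; exact h p.1 p.2)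

end MinTensor

namespace HilbertRep

open UniformSpace

variable {A B : Type u} [CStarAlgebra A] [CStarAlgebra B]

/-- The action of the algebraic tensor product on the Hilbert space tensor product. -/
def tensorCompletion (π : HilbertRep A) (σ : HilbertRep B) : AlgTensor A B →+*
    (Completion (π.space ⊗[ℂ] σ.space) →L[ℂ] Completion (π.space ⊗[ℂ] σ.space)) where
  toFun x := (π.tensor σ x).completion
  map_zero' := by
    have : π.tensor σ (0 : AlgTensor A B) = 0 := map_zero (π.tensor σ)
    rw [this]
    ext v
    induction v using Completion.induction_on with
    | hp => exact isClosed_eq (ContinuousLinearMap.continuous _) continuous_const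
    | ih v => rw [ContinuousLinearMap.completion_apply_coe]; rfl
  map_one' := by
    have : π.tensor σ (1 : AlgTensor A B) = 1 := map_one (π.tensor σ)
    rw [this]
    ext v
    induction v using Completion.induction_on with
    | hp => exact isClosed_eq (ContinuousLinearMap.continuous _) (ContinuousLinearMap.continuous _)
    | ih v => rw [ContinuousLinearMap.completion_apply_coe]; rfl
  map_add' x y := by
    have : π.tensor σ (x + y : AlgTensor A B) = π.tensor σ x + π.tensor σ y :=
      map_add (π.tensor σ) _ _
    rw [this]
    ext v
    induction v using Completion.induction_on with
    | hp => exact isClosed_eq (ContinuousLinearMap.continuous _) (ContinuousLinearMap.continuous _)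
    | ih v =>
      rw [ContinuousLinearMap.completion_apply_coe, add_apply,
        add_apply, ContinuousLinearMap.completion_apply_coe,
        ContinuousLinearMap.completion_apply_coe, Completion.coe_add]
  map_mul' x y := by
    have : π.tensor σ (x * y : AlgTensor A B) = π.tensor σ x * π.tensor σ y :=
      map_mul (π.tensor σ) _ _
    rw [this]
    ext v
    induction v using Completion.induction_on with
    | hp => exact isClosed_eq (ContinuousLinearMap.continuous _) (ContinuousLinearMap.continuous _)
    | ih v =>
      rw [ContinuousLinearMap.completion_apply_coe, mul_apply_eq_comp, mul_apply_eq_comp,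
        ContinuousLinearMap.completion_apply_coe, ContinuousLinearMap.completion_apply_coe]

lemma tensorCompletion_coe (π : HilbertRep A) (σ : HilbertRep B) (x : AlgTensor A B)
    (v : π.space ⊗[ℂ] σ.space) :
    π.tensorCompletion σ x (v : Completion (π.space ⊗[ℂ] σ.space))
      = ((π.tensor σ x v : π.space ⊗[ℂ] σ.space) : Completion (π.space ⊗[ℂ] σ.space)) :=
  ContinuousLinearMap.completion_apply_coe _ _

lemma norm_tensorCompletion_le (π : HilbertRep A) (σ : HilbertRep B) (x : AlgTensor A B) :
    ‖π.tensorCompletion σ x‖ ≤ ‖x‖ := by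
  refine ContinuousLinearMap.opNorm_le_bound _ (norm_nonneg _) fun v => ?_
  induction v using Completion.induction_on with
  | hp =>
    exact isClosed_le ((ContinuousLinearMap.continuous _).norm)
      (continuous_const.mul continuous_norm)
  | ih v =>
    rw [tensorCompletion_coe, Completion.norm_coe, Completion.norm_coe]
    exact (ContinuousLinearMap.le_opNorm _ _).trans
      (mul_le_mul_of_nonneg_right (norm_tensor_le_minNorm π σ x) (norm_nonneg _))

lemma continuous_tensorCompletion (π : HilbertRep A) (σ : HilbertRep B) :
    Continuous (π.tensorCompletion σ) :=
  AddMonoidHomClass.continuous_of_bound (π.tensorCompletion σ) 1 fun x => by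
    rw [one_mul]; exact π.norm_tensorCompletion_le σ x

lemma tensorCompletion_star (π : HilbertRep A) (σ : HilbertRep B) (x : AlgTensor A B) :
    π.tensorCompletion σ (star x) = star (π.tensorCompletion σ x) := by
  rw [ContinuousLinearMap.star_eq_adjoint]
  refine (ContinuousLinearMap.eq_adjoint_iff _ _).mpr fun v w => ?_
  induction v, w using Completion.induction_on₂ with
  | hp => apply isClosed_eq <;> fun_prop
  | ih v w =>
    rw [tensorCompletion_coe, tensorCompletion_coe, Completion.inner_coe, Completion.inner_coe]
    refine (tensor_inner π σ (star (show A ⊗[ℂ] B from x)) v w).trans ?_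
    rw [star_star]

/-- A `*`-representation of the algebraic tensor product, bounded for the minimal norm, extends
to the minimal tensor product. -/
def _root_.MinTensor.extendRep {E : Type*} [NormedAddCommGroup E] [InnerProductSpace ℂ E]
    [CompleteSpace E] (f : AlgTensor A B →+* (E →L[ℂ] E)) (hf : Continuous f)
    (hr : ∀ r : ℂ, f (algebraMap ℂ (AlgTensor A B) r) = algebraMap ℂ _ r)
    (hs : ∀ x, f (star x) = star (f x)) : MinTensor A B →⋆ₐ[ℂ] (E →L[ℂ] E) where
  __ := Completion.extensionHom f hf
  commutes' r := by
    change Completion.extensionHom f hf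
      ((algebraMap ℂ (AlgTensor A B) r : AlgTensor A B) : MinTensor A B) = _
    rw [Completion.extensionHom_coe, hr]
  map_star' x := by
    change Completion.extensionHom f hf _ = star (Completion.extensionHom f hf _)
    have hc : Continuous (Completion.extensionHom f hf) := Completion.continuous_extension
    induction x using Completion.induction_on with
    | hp => exact isClosed_eq (hc.comp MinTensor.continuous_star') (continuous_star.comp hc)
    | ih x =>
      rw [← MinTensor.coe_star, Completion.extensionHom_coe, Completion.extensionHom_coe, hs]

lemma _root_.MinTensor.extendRep_coe {E : Type*} [NormedAddCommGroup E] [InnerProductSpace ℂ E]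
    [CompleteSpace E] (f : AlgTensor A B →+* (E →L[ℂ] E)) (hf : Continuous f)
    (hr : ∀ r : ℂ, f (algebraMap ℂ (AlgTensor A B) r) = algebraMap ℂ _ r)
    (hs : ∀ x, f (star x) = star (f x)) (x : AlgTensor A B) :
    MinTensor.extendRep f hf hr hs (x : MinTensor A B) = f x :=
  Completion.extensionHom_coe f hf x

lemma tensorCompletion_algebraMap (π : HilbertRep A) (σ : HilbertRep B) (r : ℂ) :
    π.tensorCompletion σ (algebraMap ℂ (AlgTensor A B) r) = algebraMap ℂ _ r := by
  have h : π.tensor σ (algebraMap ℂ (AlgTensor A B) r) = algebraMap ℂ _ r :=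
    (π.tensor σ).commutes r
  ext v
  induction v using Completion.induction_on with
  | hp => exact isClosed_eq (ContinuousLinearMap.continuous _) (ContinuousLinearMap.continuous _)
  | ih v =>
    rw [tensorCompletion_coe, h, Algebra.algebraMap_eq_smul_one, Algebra.algebraMap_eq_smul_one]
    exact Completion.coe_smul r v

/-- The tensor product `π ⊗ σ` as a representation of the minimal tensor product. -/
def prod (π : HilbertRep A) (σ : HilbertRep B) : HilbertRep (MinTensor A B) where
  space := Completion (π.space ⊗[ℂ] σ.space)
  rep := MinTensor.extendRep (π.tensorCompletion σ) (π.continuous_tensorCompletion σ)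
    (π.tensorCompletion_algebraMap σ) (π.tensorCompletion_star σ)

/-- The inclusion of the algebraic tensor product of Hilbert spaces in its completion. -/
def toProd (π : HilbertRep A) (σ : HilbertRep B) : π.space ⊗[ℂ] σ.space →ₗᵢ[ℂ] (π.prod σ).space :=
  Completion.toComplₗᵢ (𝕜 := ℂ) (E := π.space ⊗[ℂ] σ.space)

lemma denseRange_toProd (π : HilbertRep A) (σ : HilbertRep B) : DenseRange (π.toProd σ) :=
  Completion.denseRange_coe (α := π.space ⊗[ℂ] σ.space)

lemma prod_rep_coe (π : HilbertRep A) (σ : HilbertRep B) (x : AlgTensor A B)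
    (v : π.space ⊗[ℂ] σ.space) :
    (π.prod σ).rep (x : MinTensor A B) (π.toProd σ v) = π.toProd σ (π.tensor σ x v) := by
  have h : (π.prod σ).rep (x : MinTensor A B) = π.tensorCompletion σ x :=
    MinTensor.extendRep_coe _ (π.continuous_tensorCompletion σ)
      (π.tensorCompletion_algebraMap σ) (π.tensorCompletion_star σ) x
  rw [h]
  exact tensorCompletion_coe π σ x v

/-- The elementary tensor `x ⊗ y` in the space of `π ⊗ σ`. -/
def vtmul {π : HilbertRep A} {σ : HilbertRep B} (x : π.space) (y : σ.space) : (π.prod σ).space :=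
  π.toProd σ (x ⊗ₜ[ℂ] y)

lemma prod_rep_tmul (π : HilbertRep A) (σ : HilbertRep B) (a : A) (b : B)
    (x : π.space) (y : σ.space) :
    (π.prod σ).rep (MinTensor.tmul a b) (vtmul x y) = vtmul (π.rep a x) (σ.rep b y) := by
  unfold MinTensor.tmul vtmul
  rw [prod_rep_coe]
  exact congrArg _ (tensor_tmul π σ a b x y)

lemma inner_vtmul {π : HilbertRep A} {σ : HilbertRep B} (x x' : π.space) (y y' : σ.space) :
    inner ℂ (vtmul x y : (π.prod σ).space) (vtmul x' y') = inner ℂ x x' * inner ℂ y y' := by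
  unfold vtmul
  rw [LinearIsometry.inner_map_map, TensorProduct.inner_tmul]

lemma norm_vtmul {π : HilbertRep A} {σ : HilbertRep B} (x : π.space) (y : σ.space) :
    ‖(vtmul x y : (π.prod σ).space)‖ = ‖x‖ * ‖y‖ := by
  unfold vtmul
  rw [LinearIsometry.norm_map, TensorProduct.norm_tmul]

/-- Matrix coefficients of tensor product representations separate the points of `A ⊗ B`. -/
lemma eq_zero_of_forall_inner_prod {z : MinTensor A B}
    (h : ∀ (π : HilbertRep A) (σ : HilbertRep B) (x x' : π.space) (y y' : σ.space),
      inner ℂ (vtmul x y : (π.prod σ).space) ((π.prod σ).rep z (vtmul x' y')) = 0) : z = 0 := by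
  have hrep : ∀ (π : HilbertRep A) (σ : HilbertRep B), (π.prod σ).rep z = 0 := by
    intro π σ
    have key : ∀ v w : π.space ⊗[ℂ] σ.space,
        inner ℂ (π.toProd σ v) ((π.prod σ).rep z (π.toProd σ w)) = 0 := by
      intro v w
      induction v using TensorProduct.induction_on with
      | zero => rw [map_zero, inner_zero_left]
      | add v v' hv hv' => rw [map_add, inner_add_left, hv, hv', add_zero]
      | tmul x y =>
        induction w using TensorProduct.induction_on with
        | zero => rw [map_zero, map_zero, inner_zero_right]
        | add w w' hw hw' => rw [map_add, map_add, inner_add_right, hw, hw', add_zero]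
        | tmul x' y' => exact h π σ x x' y y'
    refine ContinuousLinearMap.ext fun w => ?_
    refine ext_inner_left ℂ fun v => ?_
    change inner ℂ v ((π.prod σ).rep z w) = inner ℂ v 0
    rw [inner_zero_right]
    refine (π.denseRange_toProd σ).induction_on₂ (p := fun v w => inner ℂ v ((π.prod σ).rep z w) = 0)
      ?_ key v w
    refine isClosed_eq ?_ continuous_const
    exact continuous_fst.inner (((π.prod σ).rep z).continuous.comp continuous_snd)
  by_contra hz
  have hpos : 0 < ‖z‖ := norm_pos_iff.mpr hz
  obtain ⟨x, hx⟩ := (Completion.denseRange_coe (α := AlgTensor A B)).exists_dist_lt z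
    (half_pos hpos)
  rw [dist_eq_norm] at hx
  -- Every product representation kills `z`, so it sends `x` to minus the image of `z - x`. As the
  -- minimal norm is the supremum over product representations, `‖x‖ ≤ ‖z - x‖ < ‖z‖ / 2`, a
  -- contradiction.
  have hxn : ‖x‖ ≤ ‖z - x‖ := by
    refine minNorm_le (A := A) (B := B) fun π σ => ?_
    refine ContinuousLinearMap.opNorm_le_bound _ (norm_nonneg _) fun v => ?_
    have h1 : ‖(π.prod σ).rep (z - x) (π.toProd σ v)‖ ≤ ‖z - x‖ * ‖v‖ := by
      refine (ContinuousLinearMap.le_opNorm _ _).trans ?_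
      rw [LinearIsometry.norm_map]
      exact mul_le_mul_of_nonneg_right ((π.prod σ).norm_rep_le _) (norm_nonneg _)
    rw [map_sub, hrep, zero_sub, neg_apply, norm_neg, prod_rep_coe,
      LinearIsometry.norm_map] at h1
    exact h1
  have h2 : ‖z‖ ≤ ‖z - x‖ + ‖(x : MinTensor A B)‖ := by
    simpa using norm_add_le (z - x) (x : MinTensor A B)
  rw [Completion.norm_coe] at h2
  linarith

end HilbertRep

/-! ### Vector functionals, faithfulness and slice maps -/

namespace HilbertRep

open UniformSpace

/-! ### GNS vectors of a positive functional -/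

section GNS

variable {A : Type u} [CStarAlgebra A] [PartialOrder A] [StarOrderedRing A]

/-- The GNS representation of a positive functional. -/
def gns (h : A →ₚ[ℂ] ℂ) : HilbertRep A where
  space := h.GNS
  rep := h.gnsStarAlgHom

/-- The vector of the GNS space given by an element of the algebra, as a linear map. -/
def gnsVecₗ (h : A →ₚ[ℂ] ℂ) : A →ₗ[ℂ] (gns h).space :=
  (Completion.toComplₗᵢ (𝕜 := ℂ) (E := h.PreGNS)).toLinearMap ∘ₗ h.toPreGNS.toLinearMap

lemma gns_rep_gnsVecₗ (h : A →ₚ[ℂ] ℂ) (a b : A) :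
    (gns h).rep a (gnsVecₗ h b) = gnsVecₗ h (a * b) :=
  h.gnsNonUnitalStarAlgHom_apply_coe

lemma norm_gnsVecₗ_le (h : A →ₚ[ℂ] ℂ) (a : A) :
    ‖gnsVecₗ h a‖ ≤ ‖gnsVecₗ h 1‖ * ‖a‖ := by
  have := (ContinuousLinearMap.le_opNorm ((gns h).rep a) (gnsVecₗ h 1)).trans
    (mul_le_mul_of_nonneg_right ((gns h).norm_rep_le a) (norm_nonneg _))
  rwa [gns_rep_gnsVecₗ, mul_one, mul_comm] at this

/-- The vector of the GNS space given by an element of the algebra. -/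
def gnsVec (h : A →ₚ[ℂ] ℂ) : A →L[ℂ] (gns h).space :=
  (gnsVecₗ h).mkContinuous ‖gnsVecₗ h 1‖ (norm_gnsVecₗ_le h)

lemma gns_rep_gnsVec (h : A →ₚ[ℂ] ℂ) (a b : A) :
    (gns h).rep a (gnsVec h b) = gnsVec h (a * b) := gns_rep_gnsVecₗ h a b

lemma inner_gnsVec (h : A →ₚ[ℂ] ℂ) (a b : A) :
    inner ℂ (gnsVec h a) (gnsVec h b) = h (star a * b) :=
  (Completion.inner_coe (𝕜 := ℂ) (h.toPreGNS a) (h.toPreGNS b)).trans (h.preGNS_inner_def _ _)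

lemma denseRange_gnsVec (h : A →ₚ[ℂ] ℂ) : DenseRange (gnsVec h) :=
  Completion.denseRange_coe (α := h.PreGNS)

lemma norm_gnsVec_sq (h : A →ₚ[ℂ] ℂ) (a : A) : ((‖gnsVec h a‖ ^ 2 : ℝ) : ℂ) = h (star a * a) := by
  rw [← inner_gnsVec, inner_self_eq_norm_sq_to_K]
  norm_cast

end GNS

/-! ### Representations that attain the norm of a given element -/

section Faithful

variable {A : Type u} [CStarAlgebra A]

/-- A norm-one functional that is `1` at `1` is nonnegative on positive elements. -/
lemma re_nonneg_of_norm_le_one [PartialOrder A] [StarOrderedRing A] {f : A →L[ℂ] ℂ}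
    (hf : ‖f‖ ≤ 1) (h1 : f 1 = 1) {x : A} (hx : 0 ≤ x) : 0 ≤ (f x).re := by
  have hle : x ≤ algebraMap ℝ A ‖x‖ := IsSelfAdjoint.le_algebraMap_norm_self (.of_nonneg hx)
  -- Both `x` and `‖x‖ - x` have norm at most `‖x‖`; applying `f` to the second gives `‖x‖ - Re f(x)
  -- ≤ ‖x‖`.
  have hn : ‖algebraMap ℝ A ‖x‖ - x‖ ≤ ‖x‖ := by
    rw [CStarAlgebra.norm_le_iff_le_algebraMap _ (norm_nonneg _) (sub_nonneg.mpr hle)]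
    exact sub_le_self _ hx
  have h2 : ‖f (algebraMap ℝ A ‖x‖ - x)‖ ≤ ‖x‖ :=
    (f.le_opNorm _).trans ((mul_le_mul hf hn (norm_nonneg _) zero_le_one).trans (one_mul _).le)
  have h3 : f (algebraMap ℝ A ‖x‖) = ‖x‖ := by
    rw [Algebra.algebraMap_eq_smul_one, ← Complex.coe_smul, map_smul, h1, smul_eq_mul, mul_one]
  have h4 := (Complex.re_le_norm _).trans h2
  rw [map_sub, h3, Complex.sub_re, Complex.ofReal_re] at h4
  linarith

/-- The GNS representation of a state `φ` with `φ(a* a) = ‖a‖²` works: its cyclic unit vector is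
sent by `a` to a vector of norm `‖a‖`. Such a state comes from Hahn–Banach. -/
lemma exists_norm_rep_ge (a : A) : ∃ π : HilbertRep A, ‖a‖ ≤ ‖π.rep a‖ := by
  let _ : PartialOrder A := CStarAlgebra.spectralOrder A
  have : StarOrderedRing A := CStarAlgebra.spectralOrderedRing A
  rcases eq_or_ne a 0 with rfl | ha
  · exact ⟨zero A, by simp⟩
  have : Nontrivial A := ⟨a, 0, ha⟩
  set b := star a * a with hb
  have hb0 : 0 ≤ b := star_mul_self_nonneg a
  have hbn : ‖b‖ = ‖a‖ ^ 2 := by rw [hb, CStarRing.norm_star_mul_self, sq]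
  have hbpos : 0 < ‖b‖ := by rw [hbn]; positivity
  -- Adding the scalar `‖b‖` makes a norming functional at `c` extremal at `1` and at `b`
  -- simultaneously: `|f 1| ≤ 1` and `|f b| ≤ ‖b‖`, while `‖b‖ f(1) + f(b) = ‖c‖ ≥ 2‖b‖`.
  set c := algebraMap ℝ A ‖b‖ + b with hc
  have hcn : 2 * ‖b‖ ≤ ‖c‖ := by
    have h1 : ‖b‖ ∈ spectrum ℝ b := CStarAlgebra.norm_mem_spectrum_of_nonneg hb0
    have h2 : ‖b‖ + ‖b‖ ∈ spectrum ℝ c := by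
      rw [hc, spectrum.add_mem_add_iff] 
      exact h1
    have h3 := spectrum.norm_le_norm_of_mem h2
    rw [Real.norm_eq_abs] at h3
    linarith [le_abs_self (‖b‖ + ‖b‖)]
  have hc0 : c ≠ 0 := fun h => by rw [h, norm_zero] at hcn; linarith
  obtain ⟨f, hf1, hfc⟩ := exists_dual_vector ℂ c (norm_ne_zero_iff.mpr hc0)
  have hf1' : ‖f 1‖ ≤ 1 := by simpa [hf1] using f.le_opNorm 1
  have hfb : ‖f b‖ ≤ ‖b‖ := by simpa [hf1] using f.le_opNorm b
  have hfc' : (‖b‖ : ℂ) * f 1 + f b = ‖c‖ := by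
    refine Eq.trans ?_ hfc
    rw [hc, map_add, Algebra.algebraMap_eq_smul_one, ← Complex.coe_smul, map_smul,
      smul_eq_mul]
  have hre : ‖b‖ * (f 1).re + (f b).re = ‖c‖ := by
    have := congrArg Complex.re hfc'
    simpa using this
  have hr1 : (f 1).re = 1 := by
    have h1 := (Complex.re_le_norm (f 1)).trans hf1'
    have h2 := (Complex.re_le_norm (f b)).trans hfb
    nlinarith
  have hrb : (f b).re = ‖b‖ := by
    have h2 := (Complex.re_le_norm (f b)).trans hfb
    rw [hr1] at hre
    linarith
  have hf11 : f 1 = 1 := by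
    apply Complex.ext
    · simpa using hr1
    · have h1 : ‖f 1‖ ^ 2 ≤ 1 := by nlinarith [norm_nonneg (f 1)]
      rw [Complex.sq_norm, Complex.normSq_apply, hr1] at h1
      have : (f 1).im * (f 1).im ≤ 0 := by linarith
      simpa using mul_self_eq_zero.mp (le_antisymm this (mul_self_nonneg _))
  -- Only the real part of `f` is known to be nonnegative on positive elements, so `f` is replaced
  -- by its hermitian part, which agrees with `Re f` on self-adjoint elements.
  let g : A →ₗ[ℂ] ℂ :=
    { toFun := fun x => (f x + star (f (star x))) / 2
      map_add' := fun x y => by simp only [map_add, star_add]; ring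
      map_smul' := fun r x => by
        simp only [map_smul, star_smul, smul_eq_mul, star_mul', star_star, RingHom.id_apply]
        ring }
  have hg : ∀ x : A, IsSelfAdjoint x → g x = ((f x).re : ℂ) := by
    intro x hx
    change (f x + star (f (star x))) / 2 = _
    rw [hx.star_eq, Complex.star_def, Complex.add_conj]
    push_cast
    ring
  let φ : A →ₚ[ℂ] ℂ := PositiveLinearMap.mk₀ g fun x hx => by
    rw [hg x (.of_nonneg hx)]
    exact_mod_cast re_nonneg_of_norm_le_one hf1.le hf11 hx
  have hφ : ∀ x : A, IsSelfAdjoint x → φ x = ((f x).re : ℂ) := hg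
  refine ⟨gns φ, ?_⟩
  have e1 : ‖gnsVec φ 1‖ ^ 2 = 1 := by
    have := norm_gnsVec_sq φ 1
    rw [star_one, one_mul, hφ 1 (.one A), hf11] at this
    exact_mod_cast this
  have e2 : ‖gnsVec φ a‖ ^ 2 = ‖a‖ ^ 2 := by
    have := norm_gnsVec_sq φ a
    rw [hφ _ (.of_nonneg hb0), hrb, hbn] at this
    exact_mod_cast this
  have e1' : ‖gnsVec φ 1‖ = 1 := by nlinarith [norm_nonneg (gnsVec φ 1)]
  have e2' : ‖gnsVec φ a‖ = ‖a‖ := (sq_eq_sq₀ (norm_nonneg _) (norm_nonneg _)).mp e2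
  have := ContinuousLinearMap.le_opNorm ((gns φ).rep a) (gnsVec φ 1)
  rwa [gns_rep_gnsVec, mul_one, e1', e2', mul_one] at this

end Faithful

/-! ### Vector functionals and their slice maps -/

variable {A B : Type u} [CStarAlgebra A] [CStarAlgebra B]

/-- The vector functional `a ↦ ⟨x, π(a) y⟩`. -/
def coeff (π : HilbertRep A) (x y : π.space) : A →L[ℂ] ℂ :=
  LinearMap.mkContinuous
    { toFun := fun a => inner ℂ x (π.rep a y)
      map_add' := fun a b => by rw [map_add, add_apply, inner_add_right]
      map_smul' := fun r a => by rw [map_smul, smul_apply, inner_smul_right]; rfl }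
    (‖x‖ * ‖y‖) fun a => by
      refine (norm_inner_le_norm x (π.rep a y)).trans ?_
      have := (ContinuousLinearMap.le_opNorm (π.rep a) y).trans
        (mul_le_mul_of_nonneg_right (π.norm_rep_le a) (norm_nonneg y))
      calc ‖x‖ * ‖π.rep a y‖ ≤ ‖x‖ * (‖a‖ * ‖y‖) := by gcongr
        _ = ‖x‖ * ‖y‖ * ‖a‖ := by ring

lemma coeff_apply (π : HilbertRep A) (x y : π.space) (a : A) :
    π.coeff x y a = inner ℂ x (π.rep a y) := rfl

lemma coeff_one (π : HilbertRep A) (x y : π.space) : π.coeff x y 1 = inner ℂ x y := by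
  rw [coeff_apply, map_one, one_apply_eq_self]

lemma norm_coeff_le (π : HilbertRep A) (x y : π.space) : ‖π.coeff x y‖ ≤ ‖x‖ * ‖y‖ :=
  LinearMap.mkContinuous_norm_le _ (by positivity) _

lemma coeff_comp (π : HilbertRep B) (f : A →⋆ₐ[ℂ] B) (x y : π.space) (a : A) :
    (π.comp f).coeff x y a = π.coeff x y (f a) := rfl

/-- Test a representation attaining the norm of `a` on the pairs `x = π(a) y`, `y`. This reduces
norm bounds for slice maps to bounds on matrix coefficients of tensor product representations. -/
lemma norm_le_of_coeff {a : A} {C : ℝ} (hC : 0 ≤ C)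
    (h : ∀ (π : HilbertRep A) (x y : π.space), ‖π.coeff x y a‖ ≤ C * (‖x‖ * ‖y‖)) : ‖a‖ ≤ C := by
  obtain ⟨π, hπ⟩ := exists_norm_rep_ge a
  refine hπ.trans (ContinuousLinearMap.opNorm_le_bound _ hC fun y => ?_)
  have h1 := h π (π.rep a y) y
  rw [coeff_apply, inner_self_eq_norm_sq_to_K] at h1
  have h2 : ‖π.rep a y‖ ^ 2 ≤ C * (‖π.rep a y‖ * ‖y‖) := by simpa using h1
  rcases (norm_nonneg (π.rep a y)).eq_or_lt with h0 | h0
  · rw [← h0]; positivity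
  · refine le_of_mul_le_mul_left ?_ h0
    calc _ = ‖π.rep a y‖ ^ 2 := by ring
      _ ≤ _ := h2
      _ = _ := by ring

/-- Vector functionals separate the points of a C*-algebra. -/
lemma eq_of_coeff {a b : A} (h : ∀ (π : HilbertRep A) (x y : π.space),
    π.coeff x y a = π.coeff x y b) : a = b := by
  rw [← sub_eq_zero, ← norm_le_zero_iff]
  refine norm_le_of_coeff le_rfl fun π x y => ?_
  rw [map_sub, h, sub_self]
  simp

/-- `id ⊗ ω` on the algebraic tensor product. -/
def sliceRAlg (ω : B →L[ℂ] ℂ) : A ⊗[ℂ] B →ₗ[ℂ] A :=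
  TensorProduct.lift (LinearMap.mk₂ ℂ (fun a b => ω b • a)
    (fun a a' b => smul_add _ _ _) (fun r a b => smul_comm _ _ _)
    (fun a b b' => by rw [map_add, add_smul])
    (fun r a b => by rw [map_smul, smul_assoc]))

/-- `ω ⊗ id` on the algebraic tensor product. -/
def sliceLAlg (ω : A →L[ℂ] ℂ) : A ⊗[ℂ] B →ₗ[ℂ] B :=
  TensorProduct.lift (LinearMap.mk₂ ℂ (fun a b => ω a • b)
    (fun a a' b => by rw [map_add, add_smul])
    (fun r a b => by rw [map_smul, smul_assoc])
    (fun a b b' => smul_add _ _ _) (fun r a b => smul_comm _ _ _))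

lemma coeff_sliceRAlg (π : HilbertRep A) (σ : HilbertRep B) (x y : π.space) (v w : σ.space)
    (z : A ⊗[ℂ] B) : π.coeff x y (sliceRAlg (σ.coeff v w) z)
      = inner ℂ (x ⊗ₜ[ℂ] v) (π.tensor σ z (y ⊗ₜ[ℂ] w)) := by
  induction z using TensorProduct.induction_on with
  | zero => rw [map_zero, map_zero, map_zero, zero_apply, inner_zero_right]
  | add z z' hz hz' => rw [map_add, map_add, map_add, add_apply, inner_add_right, hz, hz']
  | tmul a b =>
    rw [tensor_tmul, TensorProduct.inner_tmul]
    change π.coeff x y (σ.coeff v w b • a) = _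
    rw [map_smul, smul_eq_mul, mul_comm]
    rfl

lemma coeff_sliceLAlg (π : HilbertRep A) (σ : HilbertRep B) (x y : π.space) (v w : σ.space)
    (z : A ⊗[ℂ] B) : σ.coeff v w (sliceLAlg (π.coeff x y) z)
      = inner ℂ (x ⊗ₜ[ℂ] v) (π.tensor σ z (y ⊗ₜ[ℂ] w)) := by
  induction z using TensorProduct.induction_on with
  | zero => rw [map_zero, map_zero, map_zero, zero_apply, inner_zero_right]
  | add z z' hz hz' => rw [map_add, map_add, map_add, add_apply, inner_add_right, hz, hz']
  | tmul a b =>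
    rw [tensor_tmul, TensorProduct.inner_tmul]
    change σ.coeff v w (π.coeff x y a • b) = _
    rw [map_smul, smul_eq_mul]
    rfl

lemma norm_inner_tensor_le (π : HilbertRep A) (σ : HilbertRep B) (x y : π.space) (v w : σ.space)
    (z : A ⊗[ℂ] B) : ‖inner ℂ (x ⊗ₜ[ℂ] v) (π.tensor σ z (y ⊗ₜ[ℂ] w))‖
      ≤ minNorm z * (‖x‖ * ‖v‖ * (‖y‖ * ‖w‖)) := by
  refine (norm_inner_le_norm (𝕜 := ℂ) (E := π.space ⊗[ℂ] σ.space) _ _).trans ?_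
  have h := (ContinuousLinearMap.le_opNorm (π.tensor σ z) (y ⊗ₜ[ℂ] w)).trans
    (mul_le_mul_of_nonneg_right (norm_tensor_le_minNorm π σ z) (norm_nonneg _))
  rw [TensorProduct.norm_tmul] at h ⊢
  calc _ ≤ ‖x‖ * ‖v‖ * (minNorm z * (‖y‖ * ‖w‖)) := by gcongr
    _ = _ := by ring

/-- The slice map `id ⊗ ω`, for the vector functional `ω` of `π` given by `x`, `y`. -/
def sliceR (σ : HilbertRep B) (v w : σ.space) : MinTensor A B →L[ℂ] A :=
  ContinuousLinearMap.fromCompletion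
    (LinearMap.mkContinuous (E := AlgTensor A B) (sliceRAlg (A := A) (σ.coeff v w)) (‖v‖ * ‖w‖)
      fun z => norm_le_of_coeff (by positivity) fun π x y => by
        refine (congrArg norm (coeff_sliceRAlg π σ x y v w z)).trans_le
          ((norm_inner_tensor_le π σ x y v w z).trans (le_of_eq ?_))
        change ‖z‖ * _ = _
        ring)

/-- The slice map `ω ⊗ id`, for the vector functional `ω` of `π` given by `x`, `y`. -/
def sliceL (π : HilbertRep A) (x y : π.space) : MinTensor A B →L[ℂ] B :=
  ContinuousLinearMap.fromCompletion
    (LinearMap.mkContinuous (E := AlgTensor A B) (sliceLAlg (B := B) (π.coeff x y)) (‖x‖ * ‖y‖)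
      fun z => norm_le_of_coeff (by positivity) fun σ v w => by
        refine (congrArg norm (coeff_sliceLAlg π σ x y v w z)).trans_le
          ((norm_inner_tensor_le π σ x y v w z).trans (le_of_eq ?_))
        change ‖z‖ * _ = _
        ring)

lemma sliceR_tmul (σ : HilbertRep B) (v w : σ.space) (a : A) (b : B) :
    σ.sliceR v w (MinTensor.tmul a b) = σ.coeff v w b • a :=
  ContinuousLinearMap.fromCompletion_apply_coe _ _

lemma sliceL_tmul (π : HilbertRep A) (x y : π.space) (a : A) (b : B) :
    π.sliceL x y (MinTensor.tmul a b) = π.coeff x y a • b :=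
  ContinuousLinearMap.fromCompletion_apply_coe _ _

lemma coeff_prod_tmul (π : HilbertRep A) (σ : HilbertRep B) (x y : π.space) (v w : σ.space)
    (a : A) (b : B) : (π.prod σ).coeff (vtmul x v) (vtmul y w) (MinTensor.tmul a b)
      = π.coeff x y a * σ.coeff v w b := by
  rw [coeff_apply, prod_rep_tmul, inner_vtmul]
  rfl

lemma coeff_sliceR (π : HilbertRep A) (σ : HilbertRep B) (x y : π.space) (v w : σ.space)
    (z : MinTensor A B) : π.coeff x y (σ.sliceR v w z)
      = (π.prod σ).coeff (vtmul x v) (vtmul y w) z := by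
  refine DFunLike.congr_fun (f := (π.coeff x y).comp (σ.sliceR v w)) ?_ z
  refine MinTensor.clm_ext fun a b => ?_
  rw [ContinuousLinearMap.comp_apply, sliceR_tmul, coeff_prod_tmul, map_smul, smul_eq_mul, mul_comm]

lemma coeff_sliceL (π : HilbertRep A) (σ : HilbertRep B) (x y : π.space) (v w : σ.space)
    (z : MinTensor A B) : σ.coeff v w (π.sliceL x y z)
      = (π.prod σ).coeff (vtmul x v) (vtmul y w) z := by
  refine DFunLike.congr_fun (f := (σ.coeff v w).comp (π.sliceL x y)) ?_ z
  refine MinTensor.clm_ext fun a b => ?_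
  rw [ContinuousLinearMap.comp_apply, sliceL_tmul, coeff_prod_tmul, map_smul, smul_eq_mul]

lemma norm_coeff_prod_le (π : HilbertRep A) (σ : HilbertRep B) (x y : π.space) (v w : σ.space)
    (z : MinTensor A B) : ‖(π.prod σ).coeff (vtmul x v) (vtmul y w) z‖
      ≤ ‖z‖ * (‖x‖ * ‖y‖ * (‖v‖ * ‖w‖)) := by
  refine (ContinuousLinearMap.le_of_opNorm_le _ (norm_coeff_le _ _ _) z).trans (le_of_eq ?_)
  rw [norm_vtmul, norm_vtmul]
  ring

lemma norm_sliceR_le (σ : HilbertRep B) (v w : σ.space) (z : MinTensor A B) :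
    ‖σ.sliceR v w z‖ ≤ ‖v‖ * ‖w‖ * ‖z‖ :=
  norm_le_of_coeff (by positivity) fun π x y => by
    rw [coeff_sliceR]
    refine (norm_coeff_prod_le π σ x y v w z).trans (le_of_eq ?_)
    ring

lemma norm_sliceL_le (π : HilbertRep A) (x y : π.space) (z : MinTensor A B) :
    ‖π.sliceL x y z‖ ≤ ‖x‖ * ‖y‖ * ‖z‖ :=
  norm_le_of_coeff (by positivity) fun σ v w => by
    rw [coeff_sliceL]
    refine (norm_coeff_prod_le π σ x y v w z).trans (le_of_eq ?_)
    ring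

/-- Slice maps separate the points of the minimal tensor product. -/
lemma eq_of_sliceL {z w : MinTensor A B}
    (h : ∀ (π : HilbertRep A) (x y : π.space), π.sliceL x y z = π.sliceL x y w) : z = w := by
  rw [← sub_eq_zero]
  refine eq_zero_of_forall_inner_prod fun π σ x x' y y' => ?_
  change (π.prod σ).coeff (vtmul x y) (vtmul x' y') (z - w) = 0
  rw [← coeff_sliceL, map_sub, h, sub_self, map_zero]

lemma coeff_mul_left (π : HilbertRep A) (x y : π.space) (a b : A) :
    π.coeff x y (a * b) = π.coeff (π.rep (star a) x) y b := by
  rw [coeff_apply, coeff_apply, map_mul, mul_apply_eq_comp, map_star,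
    ContinuousLinearMap.star_eq_adjoint, ContinuousLinearMap.adjoint_inner_left]

lemma coeff_star (π : HilbertRep A) (x y : π.space) (a : A) :
    π.coeff x y (star a) = star (π.coeff y x a) := by
  rw [coeff_apply, coeff_apply, map_star, ContinuousLinearMap.star_eq_adjoint,
    ContinuousLinearMap.adjoint_inner_right, ← inner_conj_symm]
  rfl

/-- `id ⊗ ω` as a linear function of the second vector defining `ω`. -/
lemma sliceR_add_right (σ : HilbertRep B) (v w w' : σ.space) (z : MinTensor A B) :
    σ.sliceR v (w + w') z = σ.sliceR v w z + σ.sliceR v w' z :=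
  eq_of_coeff fun π x y => by
    have : vtmul y (w + w') = (vtmul y w + vtmul y w' : (π.prod σ).space) := by
      unfold vtmul; rw [TensorProduct.tmul_add, map_add]
    rw [map_add, coeff_sliceR, coeff_sliceR, coeff_sliceR, coeff_apply, this, map_add,
      inner_add_right]
    rfl

lemma sliceR_smul_right (σ : HilbertRep B) (v w : σ.space) (r : ℂ) (z : MinTensor A B) :
    σ.sliceR v (r • w) z = r • σ.sliceR v w z :=
  eq_of_coeff fun π x y => by
    have : vtmul y (r • w) = (r • vtmul y w : (π.prod σ).space) := by
      unfold vtmul; rw [TensorProduct.tmul_smul, map_smul]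
    rw [map_smul, coeff_sliceR, coeff_sliceR, coeff_apply, this, map_smul, inner_smul_right]
    rfl

lemma sliceL_add_right (π : HilbertRep A) (x y y' : π.space) (z : MinTensor A B) :
    π.sliceL x (y + y') z = π.sliceL x y z + π.sliceL x y' z :=
  eq_of_coeff fun σ v w => by
    have : vtmul (y + y') w = (vtmul y w + vtmul y' w : (π.prod σ).space) := by
      unfold vtmul; rw [TensorProduct.add_tmul, map_add]
    rw [map_add, coeff_sliceL, coeff_sliceL, coeff_sliceL, coeff_apply, this, map_add,
      inner_add_right]
    rfl

lemma sliceL_smul_right (π : HilbertRep A) (x y : π.space) (r : ℂ) (z : MinTensor A B) :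
    π.sliceL x (r • y) z = r • π.sliceL x y z :=
  eq_of_coeff fun σ v w => by
    have : vtmul (r • y) w = (r • vtmul y w : (π.prod σ).space) := by
      unfold vtmul; rw [← TensorProduct.smul_tmul', map_smul]
    rw [map_smul, coeff_sliceL, coeff_sliceL, coeff_apply, this, map_smul, inner_smul_right]
    rfl

end HilbertRep

/-! ### Traces approximated by compressions of representations to finite-dimensional subspaces -/

/-- If uniformly bounded functionals converge on a set with dense span, they converge. -/
lemma tendsto_of_dense_span {M E : Type*} [NormedAddCommGroup E] [NormedSpace ℂ E] {l : Filter M}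
    {f : M → E →L[ℂ] ℂ} {g : E →L[ℂ] ℂ} {C : ℝ} (hC : ∀ m, ‖f m‖ ≤ C) {S : Set E}
    (hS : Dense (Submodule.span ℂ S : Set E)) (h : ∀ s ∈ S, Tendsto (fun m => f m s) l (𝓝 (g s)))
    (z : E) : Tendsto (fun m => f m z) l (𝓝 (g z)) := by
  have hspan : ∀ s ∈ Submodule.span ℂ S, Tendsto (fun m => f m s) l (𝓝 (g s)) := by
    intro s hs
    induction hs using Submodule.span_induction with
    | mem s hs => exact h s hs
    | zero => simpa using tendsto_const_nhds
    | add x y _ _ hx hy => simpa using hx.add hy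
    | smul r x _ hx => simpa using hx.const_mul r
  rw [Metric.tendsto_nhds]
  intro ε hε
  -- The summand `1` only serves to make `D` positive, so that `ε / (2 * D)` is meaningful.
  set D := |C| + ‖g‖ + 1 with hD
  have hDpos : 0 < D := by positivity
  obtain ⟨s, hs, hsz⟩ := hS.exists_dist_lt z (ε := ε / (2 * D)) (by positivity)
  filter_upwards [(Metric.tendsto_nhds.mp (hspan s hs)) (ε / 2) (half_pos hε)] with m hm
  rw [dist_eq_norm] at hm hsz ⊢
  have e : f m z - g z = (f m s - g s) + (f m (z - s) - g (z - s)) := by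
    rw [map_sub, map_sub]; ring
  have h1 : ‖f m (z - s)‖ ≤ |C| * ‖z - s‖ :=
    (f m).le_of_opNorm_le ((hC m).trans (le_abs_self C)) _
  have h2 : ‖g (z - s)‖ ≤ ‖g‖ * ‖z - s‖ := g.le_opNorm _
  have h3 : (|C| + ‖g‖) * ‖z - s‖ ≤ D * ‖z - s‖ :=
    mul_le_mul_of_nonneg_right (by rw [hD]; linarith) (norm_nonneg _)
  have h4 : D * ‖z - s‖ < ε / 2 := by
    calc D * ‖z - s‖ < D * (ε / (2 * D)) := by gcongr
      _ = ε / 2 := by field_simp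
  rw [e]
  calc _ ≤ ‖f m s - g s‖ + ‖f m (z - s) - g (z - s)‖ := norm_add_le _ _
    _ ≤ ‖f m s - g s‖ + (‖f m (z - s)‖ + ‖g (z - s)‖) := by gcongr; exact norm_sub_le _ _
    _ < ε := by nlinarith

/-- A finite orthonormal family in the space of a representation of `A`. The compression of the
representation to its span is a unital completely positive map to matrices. -/
structure MatrixModel (A : Type u) [CStarAlgebra A] : Type (u + 1) where
  index : Type
  [fintype : Fintype index]
  [nonempty : Nonempty index]
  rep : HilbertRep A
  vec : index → rep.space
  orthonormal : Orthonormal ℂ vec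

attribute [instance] MatrixModel.fintype MatrixModel.nonempty

namespace MatrixModel

variable {A B : Type u} [CStarAlgebra A] [CStarAlgebra B]

/-- The `i, j` entry of the compression. -/
def entry (m : MatrixModel A) (i j : m.index) : A →L[ℂ] ℂ := m.rep.coeff (m.vec i) (m.vec j)

/-- The normalized trace of the compression. -/
def trace (m : MatrixModel A) : A →L[ℂ] ℂ := (Fintype.card m.index : ℂ)⁻¹ • ∑ i, m.entry i i

/-- The normalized trace of the product of the compressions of two elements. -/
def traceMul (m : MatrixModel A) (c : A) : A →L[ℂ] ℂ :=
  (Fintype.card m.index : ℂ)⁻¹ • ∑ i, ∑ j, m.entry i j c • m.entry j i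

lemma trace_apply (m : MatrixModel A) (a : A) :
    m.trace a = (Fintype.card m.index : ℂ)⁻¹ * ∑ i, m.entry i i a := by
  simp [trace]

lemma traceMul_apply (m : MatrixModel A) (c a : A) :
    m.traceMul c a = (Fintype.card m.index : ℂ)⁻¹ * ∑ i, ∑ j, m.entry i j c * m.entry j i a := by
  simp [traceMul]

lemma traceMul_comm (m : MatrixModel A) (c a : A) : m.traceMul c a = m.traceMul a c := by
  rw [traceMul_apply, traceMul_apply, Finset.sum_comm]
  simp_rw [mul_comm]

lemma norm_average_le (m : MatrixModel A) (f : m.index → ℂ) {C : ℝ} (h : ∀ i, ‖f i‖ ≤ C) :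
    ‖(Fintype.card m.index : ℂ)⁻¹ * ∑ i, f i‖ ≤ C := by
  have hc : (0 : ℝ) < Fintype.card m.index := by exact_mod_cast Fintype.card_pos
  rw [norm_mul, norm_inv, Complex.norm_natCast, inv_mul_le_iff₀ hc]
  refine (norm_sum_le _ _).trans ?_
  refine (Finset.sum_le_card_nsmul _ _ C fun i _ => h i).trans ?_
  rw [nsmul_eq_mul]
  rfl

lemma norm_trace_le (m : MatrixModel A) : ‖m.trace‖ ≤ 1 :=
  ContinuousLinearMap.opNorm_le_bound _ zero_le_one fun a => by
    rw [trace_apply]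
    refine m.norm_average_le _ fun i => ?_
    refine (m.entry i i).le_of_opNorm_le ((m.rep.norm_coeff_le _ _).trans ?_) a
    rw [m.orthonormal.1 i, one_mul]

/-- By Bessel's inequality each row of the compression of `c` and each column of that of `a` has
`ℓ²`-norm at most `‖c‖`, respectively `‖a‖`; Cauchy–Schwarz and averaging over `i` finish. The bound
is independent of the model, which is what allows density arguments along a filter of models. -/
lemma norm_traceMul_le (m : MatrixModel A) (c : A) : ‖m.traceMul c‖ ≤ ‖c‖ :=
  ContinuousLinearMap.opNorm_le_bound _ (norm_nonneg _) fun a => by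
    rw [traceMul_apply]
    refine m.norm_average_le _ fun i => ?_
    have hbes : ∀ x : m.rep.space, ∑ j, ‖inner ℂ (m.vec j) x‖ ^ 2 ≤ ‖x‖ ^ 2 := fun x =>
      m.orthonormal.sum_inner_products_le x
    have h1 : ∀ j, ‖m.entry i j c‖ = ‖inner ℂ (m.vec j) (m.rep.rep (star c) (m.vec i))‖ := by
      intro j
      rw [entry, ← star_star c, HilbertRep.coeff_star, norm_star, star_star]
      rfl
    calc ‖∑ j, m.entry i j c * m.entry j i a‖
        ≤ ∑ j, ‖m.entry i j c‖ * ‖m.entry j i a‖ := by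
          refine (norm_sum_le _ _).trans (le_of_eq ?_)
          simp_rw [norm_mul]
      _ ≤ √(∑ j, ‖m.entry i j c‖ ^ 2) * √(∑ j, ‖m.entry j i a‖ ^ 2) :=
          Real.sum_mul_le_sqrt_mul_sqrt _ _ _
      _ ≤ √(‖c‖ ^ 2) * √(‖a‖ ^ 2) := by
          gcongr
          · simp_rw [h1]
            refine (hbes _).trans (pow_le_pow_left₀ (norm_nonneg _) ?_ 2)
            refine (ContinuousLinearMap.le_of_opNorm_le _ (m.rep.norm_rep_le _) _).trans ?_
            rw [m.orthonormal.1 i, mul_one, norm_star]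
          · refine (hbes _).trans (pow_le_pow_left₀ (norm_nonneg _) ?_ 2)
            refine (ContinuousLinearMap.le_of_opNorm_le _ (m.rep.norm_rep_le _) _).trans ?_
            rw [m.orthonormal.1 i, mul_one]
      _ = ‖c‖ * ‖a‖ := by rw [Real.sqrt_sq (norm_nonneg _), Real.sqrt_sq (norm_nonneg _)]

/-- The tensor product of two models. -/
def prod (m : MatrixModel A) (n : MatrixModel B) : MatrixModel (MinTensor A B) where
  index := m.index × n.index
  rep := m.rep.prod n.rep
  vec p := HilbertRep.vtmul (m.vec p.1) (n.vec p.2)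
  orthonormal := by
    classical
    rw [orthonormal_iff_ite]
    rintro ⟨i, j⟩ ⟨i', j'⟩
    rw [HilbertRep.inner_vtmul, orthonormal_iff_ite.mp m.orthonormal,
      orthonormal_iff_ite.mp n.orthonormal]
    simp only [Prod.mk.injEq]
    split_ifs <;> simp_all

lemma prod_entry (m : MatrixModel A) (n : MatrixModel B) (p q : m.index × n.index) (a : A) (b : B) :
    (m.prod n).entry p q (MinTensor.tmul a b) = m.entry p.1 q.1 a * n.entry p.2 q.2 b :=
  HilbertRep.coeff_prod_tmul _ _ _ _ _ _ a b

lemma prod_trace (m : MatrixModel A) (n : MatrixModel B) (a : A) (b : B) :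
    (m.prod n).trace (MinTensor.tmul a b) = m.trace a * n.trace b := by
  rw [trace_apply, trace_apply, trace_apply]
  have : ∑ p : m.index × n.index, (m.prod n).entry p p (MinTensor.tmul a b)
      = (∑ i, m.entry i i a) * ∑ j, n.entry j j b := by
    rw [Finset.sum_mul_sum, Fintype.sum_prod_type]
    simp_rw [prod_entry]
  refine (congrArg _ this).trans ?_
  have hc : (Fintype.card (m.prod n).index : ℂ)
      = Fintype.card m.index * Fintype.card n.index := by
    rw [← Nat.cast_mul, ← Fintype.card_prod]; rfl
  rw [hc, mul_inv]
  ring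

lemma prod_traceMul (m : MatrixModel A) (n : MatrixModel B) (c a : A) (d b : B) :
    (m.prod n).traceMul (MinTensor.tmul c d) (MinTensor.tmul a b)
      = m.traceMul c a * n.traceMul d b := by
  rw [traceMul_apply, traceMul_apply, traceMul_apply]
  have : ∑ p : m.index × n.index, ∑ q : m.index × n.index,
        (m.prod n).entry p q (MinTensor.tmul c d) * (m.prod n).entry q p (MinTensor.tmul a b)
      = (∑ i, ∑ j, m.entry i j c * m.entry j i a) * ∑ i, ∑ j, n.entry i j d * n.entry j i b := by
    rw [Finset.sum_mul_sum, Fintype.sum_prod_type]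
    refine Finset.sum_congr rfl fun i _ => Finset.sum_congr rfl fun i' _ => ?_
    rw [Finset.sum_mul_sum, Fintype.sum_prod_type]
    refine Finset.sum_congr rfl fun j _ => Finset.sum_congr rfl fun j' _ => ?_
    rw [prod_entry, prod_entry]
    ring
  refine (congrArg _ this).trans ?_
  have hc : (Fintype.card (m.prod n).index : ℂ)
      = Fintype.card m.index * Fintype.card n.index := by
    rw [← Nat.cast_mul, ← Fintype.card_prod]; rfl
  rw [hc, mul_inv]
  ring

/-- The pull-back of a model along a `*`-homomorphism. -/
def comp (m : MatrixModel B) (f : A →⋆ₐ[ℂ] B) : MatrixModel A where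
  index := m.index
  rep := m.rep.comp f
  vec := m.vec
  orthonormal := m.orthonormal

lemma comp_trace (m : MatrixModel B) (f : A →⋆ₐ[ℂ] B) (a : A) :
    (m.comp f).trace a = m.trace (f a) := by
  rw [trace_apply, trace_apply]; rfl

lemma comp_traceMul (m : MatrixModel B) (f : A →⋆ₐ[ℂ] B) (c a : A) :
    (m.comp f).traceMul c a = m.traceMul (f c) (f a) := by
  rw [traceMul_apply, traceMul_apply]; rfl

end MatrixModel

/-- A functional `τ` that is a limit of normalized traces of compressions which are asymptotically
multiplicative in the trace; for tracial states, this is amenability. -/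
def IsMatricialLimit {A : Type u} [CStarAlgebra A] (τ : A → ℂ) : Prop :=
  ∃ l : Filter (MatrixModel A), l.NeBot ∧ (∀ a, Tendsto (fun m => m.trace a) l (𝓝 (τ a))) ∧
    ∀ c a, Tendsto (fun m => m.traceMul c a) l (𝓝 (τ (c * a)))

namespace IsMatricialLimit

variable {A B : Type u} [CStarAlgebra A] [CStarAlgebra B]

/-- The traces of a model, as a point of a product space. -/
def point (m : MatrixModel A) : (A → ℂ) × (A × A → ℂ) :=
  (fun a => m.trace a, fun p => m.traceMul p.1 p.2)

/-- The filter can be recovered by pulling back neighbourhoods along `point`. In this form stability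
under pointwise limits is just closedness of a closure. -/
lemma iff_mem_closure {τ : A → ℂ} : IsMatricialLimit τ ↔
    (τ, fun p : A × A => τ (p.1 * p.2)) ∈ closure (Set.range (point (A := A))) := by
  constructor
  · rintro ⟨l, hl, h1, h2⟩
    refine mem_closure_of_tendsto (f := point) (b := l) ?_ (Eventually.of_forall fun m => ⟨m, rfl⟩)
    exact (tendsto_pi_nhds.mpr h1).prodMk_nhds (tendsto_pi_nhds.mpr fun p => h2 p.1 p.2)
  · intro h
    refine ⟨comap point (𝓝 (τ, fun p : A × A => τ (p.1 * p.2))), ?_, fun a => ?_, fun c a => ?_⟩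
    · rw [comap_neBot_iff]
      intro t ht
      obtain ⟨_, hy, m, rfl⟩ := mem_closure_iff_nhds.mp h t ht
      exact ⟨m, hy⟩
    · have h1 : Continuous fun p : (A → ℂ) × (A × A → ℂ) => p.1 a :=
        (continuous_apply a).comp continuous_fst
      exact (h1.tendsto _).comp tendsto_comap
    · have h2 : Continuous fun p : (A → ℂ) × (A × A → ℂ) => p.2 (c, a) :=
        (continuous_apply (c, a)).comp continuous_snd
      exact (h2.tendsto _).comp tendsto_comap

/-- Matricial limits are closed under pointwise convergence. -/
lemma of_tendsto {τ : ℕ → A → ℂ} {τ' : A → ℂ} (h : ∀ n, IsMatricialLimit (τ n))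
    (hτ : ∀ a, Tendsto (fun n => τ n a) atTop (𝓝 (τ' a))) : IsMatricialLimit τ' := by
  rw [iff_mem_closure]
  refine isClosed_closure.mem_of_tendsto (b := atTop)
    (f := fun n => (τ n, fun p : A × A => τ n (p.1 * p.2))) ?_
    (Eventually.of_forall fun n => iff_mem_closure.mp (h n))
  -- The second coordinate consists of values of `τ n` at products, so pointwise convergence
  -- controls it too.
  exact (tendsto_pi_nhds.mpr hτ).prodMk_nhds (tendsto_pi_nhds.mpr fun p => hτ _)

lemma comp {τ : B → ℂ} (h : IsMatricialLimit τ) (f : A →⋆ₐ[ℂ] B) :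
    IsMatricialLimit fun a => τ (f a) := by
  obtain ⟨l, hl, h1, h2⟩ := h
  refine ⟨l.map fun m => m.comp f, hl.map _, fun a => ?_, fun c a => ?_⟩
  · rw [tendsto_map'_iff]
    exact (h1 (f a)).congr fun m => (m.comp_trace f a).symm
  · rw [tendsto_map'_iff]
    simp only [map_mul]
    exact (h2 (f c) (f a)).congr fun m => (m.comp_traceMul f c a).symm

/-- The tensor product of two matricial limits is a matricial limit on the minimal tensor product. -/
lemma tensor {τ : A → ℂ} {τ' : B → ℂ} (h : IsMatricialLimit τ) (h' : IsMatricialLimit τ')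
    {ω : MinTensor A B →L[ℂ] ℂ} (hω : ∀ a b, ω (MinTensor.tmul a b) = τ a * τ' b) :
    IsMatricialLimit ω := by
  obtain ⟨l, hl, h1, h2⟩ := h
  obtain ⟨l', hl', h1', h2'⟩ := h'
  refine ⟨(l ×ˢ l').map fun p => p.1.prod p.2, (hl.prod hl').map _, ?_, ?_⟩
  · intro z
    rw [tendsto_map'_iff]
    refine tendsto_of_dense_span (f := fun p : MatrixModel A × MatrixModel B => (p.1.prod p.2).trace)
      (fun p => (p.1.prod p.2).norm_trace_le) MinTensor.dense_span_tmul ?_ z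
    rintro _ ⟨⟨a, b⟩, rfl⟩
    simp only [MatrixModel.prod_trace, hω]
    exact ((h1 a).comp tendsto_fst).mul ((h1' b).comp tendsto_snd)
  · intro z w
    rw [tendsto_map'_iff]
    have hmul : ∀ a b c d, Tendsto (fun p : MatrixModel A × MatrixModel B =>
        (p.1.prod p.2).traceMul (MinTensor.tmul c d) (MinTensor.tmul a b)) (l ×ˢ l')
        (𝓝 (ω (MinTensor.tmul c d * MinTensor.tmul a b))) := by
      intro a b c d
      simp only [MatrixModel.prod_traceMul, MinTensor.tmul_mul_tmul, hω]
      exact ((h2 c a).comp tendsto_fst).mul ((h2' d b).comp tendsto_snd)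
    -- The two arguments are freed from elementary tensors one at a time: first the right one, then
    -- the left one, for which symmetry of `traceMul` moves it to the position where the uniform
    -- bound applies.
    have hstep : ∀ c d w, Tendsto (fun p : MatrixModel A × MatrixModel B =>
        (p.1.prod p.2).traceMul (MinTensor.tmul c d) w) (l ×ˢ l')
        (𝓝 (ω (MinTensor.tmul c d * w))) := fun c d w =>
      tendsto_of_dense_span
        (f := fun p : MatrixModel A × MatrixModel B =>
          (p.1.prod p.2).traceMul (MinTensor.tmul c d))
        (g := ω.comp (ContinuousLinearMap.mul ℂ _ (MinTensor.tmul c d)))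
        (fun p => (p.1.prod p.2).norm_traceMul_le _) MinTensor.dense_span_tmul
        (by rintro _ ⟨⟨a, b⟩, rfl⟩; exact hmul a b c d) w
    refine (tendsto_of_dense_span
      (f := fun p : MatrixModel A × MatrixModel B => (p.1.prod p.2).traceMul w)
      (g := ω.comp ((ContinuousLinearMap.mul ℂ _).flip w))
      (fun p => (p.1.prod p.2).norm_traceMul_le _) MinTensor.dense_span_tmul
      ?_ z).congr fun p => (MatrixModel.traceMul_comm _ _ _)
    rintro _ ⟨⟨c, d⟩, rfl⟩
    exact (hstep c d w).congr fun p => (MatrixModel.traceMul_comm _ _ _)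

end IsMatricialLimit

/-! ### Matricial limits and amenable traces -/

section Amenable

variable {A : Type u} [CStarAlgebra A]

/-- The constant diagonal matrices, as a `*`-homomorphism. -/
def diagonalHom (A : Type u) [CStarAlgebra A] (k : ℕ) : A →⋆ₐ[ℂ] CStarMatrix (Fin k) (Fin k) A where
  toFun a := CStarMatrix.ofMatrix (Matrix.diagonal fun _ => a)
  map_one' := Matrix.diagonal_one
  map_mul' a b := (Matrix.diagonal_mul_diagonal (fun _ : Fin k => a) fun _ => b).symm
  map_zero' := Matrix.diagonal_zero
  map_add' a b := (Matrix.diagonal_add (fun _ : Fin k => a) fun _ => b).symm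
  commutes' _ := rfl
  map_star' a := (Matrix.diagonal_conjTranspose fun _ : Fin k => a).symm

/-- The matrix with entry `a` at `i, j` and zeros elsewhere. -/
def singleEntry {k : ℕ} (i j : Fin k) (a : A) : CStarMatrix (Fin k) (Fin k) A :=
  CStarMatrix.ofMatrix (Matrix.single i j a)

/-- For a fixed row `r`, the matrix units `E_{ri} ⊗ 1` turn the diagonal action of `a` into `E_{ij}
⊗ a`. In `CompletelyPositiveMap.exists_orthonormal` they become the Stinespring vectors. -/
lemma star_singleEntry_mul {k : ℕ} (r i j : Fin k) (a : A) :
    star (singleEntry r i (1 : A)) * (diagonalHom A k a * singleEntry r j 1) = singleEntry i j a := by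
  have h1 : (Matrix.diagonal fun _ : Fin k => a) * Matrix.single r j 1 = Matrix.single r j a := by
    ext p q
    rw [Matrix.diagonal_mul, Matrix.single_apply, Matrix.single_apply]
    split_ifs <;> simp
  have h2 : (Matrix.single r i (1 : A)).conjTranspose * Matrix.single r j a
      = Matrix.single i j a := by
    rw [Matrix.conjTranspose_single, star_one, Matrix.single_mul_single_same, one_mul]
  have h3 : diagonalHom A k a * singleEntry r j 1 = singleEntry r j a := h1
  rw [h3]
  exact h2

/-- Evaluation of an entry. -/
def CStarMatrix.entryHom {m n R : Type*} [AddCommMonoid R] (i : m) (j : n) :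
    CStarMatrix m n R →+ R where
  toFun M := M i j
  map_zero' := rfl
  map_add' _ _ := rfl

lemma CStarMatrix.sum_apply {m n R ι : Type*} [AddCommMonoid R] (s : Finset ι)
    (f : ι → CStarMatrix m n R) (i : m) (j : n) : (∑ r ∈ s, f r) i j = ∑ r ∈ s, f r i j :=
  map_sum (CStarMatrix.entryHom i j) f s

lemma exists_eq_star_mul_self {R : Type*} [CStarAlgebra R] [PartialOrder R] [StarOrderedRing R]
    {x : R} (hx : 0 ≤ x) : ∃ b, x = star b * b :=
  CStarAlgebra.nonneg_iff_eq_star_mul_self.mp hx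

/-- The linear functional on matrices associated with a map to matrices. -/
def choiFunctional {k : ℕ} (φ : A →ₗ[ℂ] CStarMatrix (Fin k) (Fin k) ℂ) :
    CStarMatrix (Fin k) (Fin k) A →ₗ[ℂ] ℂ where
  toFun M := ∑ i, ∑ j, φ (M i j) i j
  map_add' M N := by
    simp only [CStarMatrix.add_apply, map_add, Finset.sum_add_distrib]
  map_smul' r M := by
    simp only [CStarMatrix.smul_apply, map_smul, Finset.smul_sum, RingHom.id_apply]

lemma choiFunctional_singleEntry {k : ℕ} (φ : A →ₗ[ℂ] CStarMatrix (Fin k) (Fin k) ℂ)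
    (i j : Fin k) (a : A) : choiFunctional φ (singleEntry i j a) = φ a i j := by
  change ∑ p, ∑ q, φ (Matrix.single i j a p q) p q = _
  rw [Finset.sum_eq_single i, Finset.sum_eq_single j]
  · rw [Matrix.single_apply_same]
  · intro q _ hq
    rw [Matrix.single_apply_of_col_ne _ _ hq.symm, map_zero, CStarMatrix.zero_apply]
  · simp
  · intro p _ hp
    refine Finset.sum_eq_zero fun q _ => ?_
    rw [Matrix.single_apply_of_row_ne hp.symm, map_zero, CStarMatrix.zero_apply]
  · simp

/-- A matrix of matrices that is nonnegative has a nonnegative sum of entries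
`∑ i j, (M i j) i j`. -/
lemma sum_entries_nonneg {k : ℕ} {M : CStarMatrix (Fin k) (Fin k) (CStarMatrix (Fin k) (Fin k) ℂ)}
    (hM : 0 ≤ M) : 0 ≤ ∑ i, ∑ j, M i j i j := by
  obtain ⟨X, rfl⟩ := exists_eq_star_mul_self hM
  have h : ∀ i j, (star X * X) i j i j = ∑ r, ∑ s, star (X r i s i) * X r j s j := by
    intro i j
    rw [CStarMatrix.mul_apply, CStarMatrix.sum_apply]
    rfl
  -- The sum is the quadratic form of `M` at the vector `∑ i, e_i ⊗ e_i`; for `M = X* X` it is a sum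
  -- of squared moduli.
  have h2 : ∑ i, ∑ j, (star X * X) i j i j
      = ∑ r, ∑ s, star (∑ i, X r i s i) * ∑ j, X r j s j := by
    simp_rw [h, star_sum, Finset.sum_mul_sum]
    rw [Finset.sum_congr rfl fun i _ => Finset.sum_comm, Finset.sum_comm]
    refine Finset.sum_congr rfl fun r _ => ?_
    rw [Finset.sum_congr rfl fun i _ => Finset.sum_comm, Finset.sum_comm]
  rw [h2]
  exact Finset.sum_nonneg fun r _ => Finset.sum_nonneg fun s _ => star_mul_self_nonneg _

variable [PartialOrder A] [StarOrderedRing A]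

/-- Stinespring's theorem for unital completely positive maps to matrices. -/
lemma CompletelyPositiveMap.exists_orthonormal {k : ℕ} (hk : 0 < k)
    (φ : A →CP CStarMatrix (Fin k) (Fin k) ℂ) (h1 : φ 1 = 1) :
    ∃ (π : HilbertRep A) (v : Fin k → π.space), Orthonormal ℂ v ∧
      ∀ i j a, φ a i j = π.coeff (v i) (v j) a := by
  -- Complete positivity of `φ` at level `k` makes the functional `[a_ij] ↦ ∑ φ(a_ij)_ij` positive.
  -- Its GNS space, restricted to constant diagonal matrices, is the dilation, and `φ 1 = 1` gives
  -- orthonormality.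
  let f : CStarMatrix (Fin k) (Fin k) A →ₚ[ℂ] ℂ :=
    PositiveLinearMap.mk₀ (choiFunctional φ.toLinearMap) fun M hM =>
      sum_entries_nonneg (φ.map_cstarMatrix_nonneg M hM)
  have hf : ∀ i j a, f (singleEntry i j a) = φ a i j :=
    choiFunctional_singleEntry φ.toLinearMap
  let r : Fin k := ⟨0, hk⟩
  have hv : ∀ i j a, φ a i j = ((HilbertRep.gns f).comp (diagonalHom A k)).coeff
      (HilbertRep.gnsVec f (singleEntry r i 1)) (HilbertRep.gnsVec f (singleEntry r j 1)) a := by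
    intro i j a
    rw [HilbertRep.coeff_comp, HilbertRep.coeff_apply, HilbertRep.gns_rep_gnsVec,
      HilbertRep.inner_gnsVec, star_singleEntry_mul, hf]
  refine ⟨(HilbertRep.gns f).comp (diagonalHom A k),
    fun i => HilbertRep.gnsVec f (singleEntry r i 1), ?_, hv⟩
  classical
  refine orthonormal_iff_ite.mpr fun i j => ?_
  have e : φ 1 i j = if i = j then 1 else 0 := by rw [h1]; exact CStarMatrix.one_apply
  exact ((HilbertRep.coeff_one _ _ _).symm.trans (hv i j 1).symm).trans e

/-- The matrix of rank-one matrices defined by a family of vectors. -/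
def CStarMatrix.outer {n k : ℕ} (y : Fin n → Fin k → ℂ) :
    CStarMatrix (Fin n) (Fin n) (CStarMatrix (Fin k) (Fin k) ℂ) :=
  CStarMatrix.ofMatrix fun p q => CStarMatrix.ofMatrix fun i j => star (y p i) * y q j

/-- It equals `Y* Y` for a `Y` whose only nonzero row, indexed by the pair `(p₀, i₀)`, is the family
`y`. When `n` or `k` is `0` there is no such row, but the matrix has no entries either. -/
lemma CStarMatrix.outer_nonneg {n k : ℕ} (y : Fin n → Fin k → ℂ) : 0 ≤ CStarMatrix.outer y := by
  rcases Nat.eq_zero_or_pos n with rfl | hn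
  · exact le_of_eq (by ext p q i; exact p.elim0)
  rcases Nat.eq_zero_or_pos k with rfl | hk
  · exact le_of_eq (by ext p q i; exact i.elim0)
  let p₀ : Fin n := ⟨0, hn⟩
  let i₀ : Fin k := ⟨0, hk⟩
  let Y : CStarMatrix (Fin n) (Fin n) (CStarMatrix (Fin k) (Fin k) ℂ) :=
    CStarMatrix.ofMatrix fun p q => CStarMatrix.ofMatrix fun i j =>
      if p = p₀ ∧ i = i₀ then y q j else 0
  have hYa : ∀ p q i j, Y p q i j = if p = p₀ ∧ i = i₀ then y q j else 0 := fun _ _ _ _ => rfl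
  have hY : CStarMatrix.outer y = star Y * Y := by
    ext p q i j
    rw [CStarMatrix.mul_apply, CStarMatrix.sum_apply, Finset.sum_eq_single p₀]
    · rw [CStarMatrix.mul_apply, Finset.sum_eq_single i₀]
      · change star (y p i) * y q j = star (Y p₀ p i₀ i) * Y p₀ q i₀ j
        simp [hYa]
      · intro s _ hs
        change star (Y p₀ p s i) * Y p₀ q s j = 0
        simp [hYa, hs]
      · simp
    · intro r _ hr
      rw [CStarMatrix.mul_apply]
      refine Finset.sum_eq_zero fun s _ => ?_
      change star (Y r p s i) * Y r q s j = 0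
      simp [hYa, hr]
    · simp
  rw [hY]
  exact star_mul_self_nonneg Y

/-- Compressions of representations are completely positive. -/
def HilbertRep.compression {k : ℕ} (π : HilbertRep A) (v : Fin k → π.space) :
    A →CP CStarMatrix (Fin k) (Fin k) ℂ where
  toFun a := CStarMatrix.ofMatrix fun i j => π.coeff (v i) (v j) a
  map_add' a b := by
    ext i j
    exact map_add (π.coeff (v i) (v j)) a b
  map_smul' r a := by
    ext i j
    exact map_smul (π.coeff (v i) (v j)) r a
  map_cstarMatrix_nonneg' n M hM := by
    obtain ⟨X, rfl⟩ := exists_eq_star_mul_self hM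
    -- The entries of the compression of `X* X` are sums over `r` of the inner products `⟨π(X_rp)
    -- v_i, π(X_rq) v_j⟩`. These finitely many vectors span a finite-dimensional space; expanding in
    -- an orthonormal basis of it writes the compression as a sum of `outer` matrices.
    let x : Fin n × Fin n × Fin k → π.space := fun t => π.rep (X t.1 t.2.1) (v t.2.2)
    let S : Submodule ℂ π.space := Submodule.span ℂ (Set.range x)
    have : FiniteDimensional ℂ S := FiniteDimensional.span_of_finite ℂ (Set.finite_range x)
    let e := stdOrthonormalBasis ℂ S
    let x' : Fin n × Fin n × Fin k → S := fun t => ⟨x t, Submodule.subset_span ⟨t, rfl⟩⟩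
    have key : (∑ r, ∑ s, CStarMatrix.outer fun p i => inner ℂ (e s) (x' (r, p, i)))
        = (star X * X).map fun a => CStarMatrix.ofMatrix fun i j => π.coeff (v i) (v j) a := by
      ext p q i j
      change _ = π.coeff (v i) (v j) ((star X * X) p q)
      rw [CStarMatrix.mul_apply, map_sum, CStarMatrix.sum_apply, CStarMatrix.sum_apply]
      refine Finset.sum_congr rfl fun r _ => ?_
      rw [CStarMatrix.sum_apply, CStarMatrix.sum_apply]
      change ∑ s, star (inner ℂ (e s) (x' (r, p, i))) * inner ℂ (e s) (x' (r, q, j))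
        = π.coeff (v i) (v j) (star (X r p) * X r q)
      rw [HilbertRep.coeff_mul_left, HilbertRep.coeff_apply, star_star]
      change _ = inner ℂ (x' (r, p, i)) (x' (r, q, j))
      rw [← e.sum_inner_mul_inner]
      refine Finset.sum_congr rfl fun s _ => ?_
      rw [← inner_conj_symm (x' (r, p, i)) (e s)]
      rfl
    change 0 ≤ (star X * X).map fun a => CStarMatrix.ofMatrix fun i j => π.coeff (v i) (v j) a
    rw [← key]
    exact Finset.sum_nonneg fun r _ => Finset.sum_nonneg fun s _ =>
      CStarMatrix.outer_nonneg fun p i => inner ℂ (e s) (x' (r, p, i))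

lemma HilbertRep.compression_apply {k : ℕ} (π : HilbertRep A) (v : Fin k → π.space) (a : A)
    (i j : Fin k) : π.compression v a i j = π.coeff (v i) (v j) a := rfl

lemma normalizedTrace_sub {k : ℕ} (M N : CStarMatrix (Fin k) (Fin k) ℂ) :
    normalizedTrace (M - N) = normalizedTrace M - normalizedTrace N := by
  simp [normalizedTrace, mul_sub]

/-- Each map of the net is replaced by its Stinespring dilation, and the filter is the image of
`atTop`. -/
lemma IsAmenableTrace.isMatricialLimit {τ : A →ₚ[ℂ] ℂ} (h : IsAmenableTrace τ) :
    IsMatricialLimit τ := by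
  obtain ⟨ι, _, _, _, k, φ, hk, hφ, h1, h2⟩ := h.exists_net
  choose π v hv hπ using fun i => (φ i).exists_orthonormal (hk i) (hφ i)
  let m : ι → MatrixModel A := fun i =>
    haveI : NeZero (k i) := ⟨(hk i).ne'⟩
    { index := Fin (k i), rep := π i, vec := v i, orthonormal := hv i }
  have htr : ∀ i a, (m i).trace a = normalizedTrace (φ i a) := by
    intro i a
    rw [MatrixModel.trace_apply, normalizedTrace]
    simp_rw [hπ]
    congr 2
    exact congrArg _ (Fintype.card_fin _)
  have hmul : ∀ i c a, (m i).traceMul c a = normalizedTrace (φ i c * φ i a) := by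
    intro i c a
    rw [MatrixModel.traceMul_apply, normalizedTrace]
    simp_rw [CStarMatrix.mul_apply, hπ]
    congr 2
    exact congrArg _ (Fintype.card_fin _)
  refine ⟨map m atTop, inferInstance, fun a => ?_, fun c a => ?_⟩
  · rw [tendsto_map'_iff]
    exact (h1 a).congr fun i => (htr i a).symm
  · rw [tendsto_map'_iff]
    -- The multiplicativity condition is taken at `b = star c`, so that `star b = c`; subtracting it
    -- from the limit of `tr (φ (c a))` leaves `tr (φ c φ a)`.
    have h3 := (h1 (c * a)).sub (h2 a (star c))
    rw [sub_zero] at h3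
    refine h3.congr fun i => ?_
    rw [star_star, normalizedTrace_sub, sub_sub_cancel]
    exact (hmul i c a).symm

lemma MatrixModel.exists_ucp (m : MatrixModel A) : ∃ (k : ℕ)
    (φ : A →CP CStarMatrix (Fin k) (Fin k) ℂ), 0 < k ∧ φ 1 = 1 ∧
    (∀ a, normalizedTrace (φ a) = m.trace a) ∧
    ∀ c a, normalizedTrace (φ c * φ a) = m.traceMul c a := by
  classical
  let e : Fin (Fintype.card m.index) ≃ m.index := (Fintype.equivFin m.index).symm
  refine ⟨Fintype.card m.index, m.rep.compression fun i => m.vec (e i), Fintype.card_pos, ?_, ?_, ?_⟩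
  · ext i j
    rw [HilbertRep.compression_apply, HilbertRep.coeff_apply, map_one, CStarMatrix.one_apply]
    have := orthonormal_iff_ite.mp m.orthonormal (e i) (e j)
    simp only [EmbeddingLike.apply_eq_iff_eq] at this
    exact this
  · intro a
    rw [MatrixModel.trace_apply, normalizedTrace]
    simp_rw [HilbertRep.compression_apply]
    rw [← e.sum_comp]
    rfl
  · intro c a
    rw [MatrixModel.traceMul_apply, normalizedTrace]
    simp_rw [CStarMatrix.mul_apply, HilbertRep.compression_apply]
    rw [← e.sum_comp]
    simp_rw [← e.sum_comp (fun j => m.entry _ j c * m.entry j _ a)]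
    rfl

/-- Models form a type one universe above `A`, whereas the index set of the net must lie in the
universe of `A`. So one model with error below `1 / (n + 1)` on `F` is chosen for each finite set
`F` and each `n`, and the net is indexed by these pairs. -/
lemma IsMatricialLimit.isAmenableTrace {τ : A →ₚ[ℂ] ℂ} (ht : IsTracialState τ)
    (h : IsMatricialLimit τ) : IsAmenableTrace τ := by
  refine ⟨ht, ?_⟩
  obtain ⟨l, hl, h1, h2⟩ := h
  have hex : ∀ p : Finset A × ℕ, ∃ m : MatrixModel A,
      (∀ a ∈ p.1, dist (m.trace a) (τ a) < 1 / (p.2 + 1)) ∧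
      (∀ c ∈ p.1, ∀ a ∈ p.1, dist (m.trace (star c * a)) (τ (star c * a)) < 1 / (p.2 + 1)) ∧
      ∀ c ∈ p.1, ∀ a ∈ p.1, dist (m.traceMul (star c) a) (τ (star c * a)) < 1 / (p.2 + 1) := by
    rintro ⟨F, n⟩
    have hn : (0 : ℝ) < 1 / (n + 1) := Nat.one_div_pos_of_nat
    refine Eventually.exists (f := l) ?_
    refine ((Finset.eventually_all F).mpr fun a _ => ?_).and
      (((Finset.eventually_all F).mpr fun c _ => (Finset.eventually_all F).mpr fun a _ => ?_).and
        ((Finset.eventually_all F).mpr fun c _ => (Finset.eventually_all F).mpr fun a _ => ?_))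
    · exact Metric.tendsto_nhds.mp (h1 a) _ hn
    · exact Metric.tendsto_nhds.mp (h1 (star c * a)) _ hn
    · exact Metric.tendsto_nhds.mp (h2 (star c) a) _ hn
  choose m hm1 hm2 hm3 using hex
  choose k φ hk hφ htr hmul using fun p => (m p).exists_ucp
  have hlim : ∀ (F : Finset A) (f : Finset A × ℕ → ℂ) (z : ℂ),
      (∀ p : Finset A × ℕ, F ≤ p.1 → dist (f p) z < 1 / (p.2 + 1)) →
      Tendsto f atTop (𝓝 z) := by
    intro F f z hf
    rw [Metric.tendsto_nhds]
    intro ε hε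
    obtain ⟨n, hn⟩ := exists_nat_one_div_lt hε
    filter_upwards [eventually_ge_atTop ((F, n) : Finset A × ℕ)] with p hp
    refine (hf p hp.1).trans_le ((one_div_le_one_div_of_le (by positivity) ?_).trans hn.le)
    have := hp.2
    simp only [add_le_add_iff_right, Nat.cast_le]
    exact this
  classical
  refine ⟨Finset A × ℕ, inferInstance, inferInstance, inferInstance, k, φ, hk, hφ, fun a => ?_,
    fun a b => ?_⟩
  · simp_rw [htr]
    exact hlim {a} _ _ fun p hp => hm1 p a (hp (Finset.mem_singleton_self a))
  · simp_rw [normalizedTrace_sub, htr, hmul]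
    rw [← sub_self (τ (star b * a))]
    refine Tendsto.sub ?_ ?_
    · exact hlim {a, b} _ _ fun p hp => hm2 p b (hp (by simp)) a (hp (by simp))
    · exact hlim {a, b} _ _ fun p hp => hm3 p b (hp (by simp)) a (hp (by simp))

end Amenable

/-! ### Convolution operators on a compact quantum group -/

/-- A unital `*`-homomorphism as a bounded linear map. -/
def StarAlgHom.toCLM {A B : Type u} [CStarAlgebra A] [CStarAlgebra B] (f : A →⋆ₐ[ℂ] B) :
    A →L[ℂ] B :=
  f.toAlgHom.toLinearMap.mkContinuous 1 fun a => by
    rw [one_mul]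
    exact NonUnitalStarAlgHom.norm_apply_le f a

/-- Left multiplication as a bounded linear map. -/
def mulLeftCLM {A : Type u} [CStarAlgebra A] (a : A) : A →L[ℂ] A := ContinuousLinearMap.mul ℂ A a

/-- Right multiplication as a bounded linear map. -/
def mulRightCLM {A : Type u} [CStarAlgebra A] (a : A) : A →L[ℂ] A :=
  (ContinuousLinearMap.mul ℂ A).flip a

namespace MinTensor

variable {A B C : Type u} [CStarAlgebra A] [CStarAlgebra B] [CStarAlgebra C]

lemma norm_tmul_le (a : A) (b : B) : ‖tmul a b‖ ≤ ‖a‖ * ‖b‖ :=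
  (UniformSpace.Completion.norm_coe _).trans_le
    (minNorm_le fun π σ => π.norm_tensor_tmul_le σ a b)

/-- `b ↦ a ⊗ b` as a bounded linear map. -/
def tmulL (a : A) : B →L[ℂ] MinTensor A B := (tmulₗ a).mkContinuous ‖a‖ (norm_tmul_le a)

/-- `a ↦ a ⊗ b` as a bounded linear map. -/
def tmulR (b : B) : A →L[ℂ] MinTensor A B :=
  (tmulₗ.flip b).mkContinuous ‖b‖ fun a => (norm_tmul_le a b).trans_eq (mul_comm _ _)

end MinTensor

/-! ### Slice maps of positive functionals -/

section StateSlices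

open HilbertRep

variable {A B C : Type u} [CStarAlgebra A] [CStarAlgebra B] [CStarAlgebra C]
variable [PartialOrder A] [StarOrderedRing A] (h : A →ₚ[ℂ] ℂ)

/-- The slice map `id ⊗ h` of a positive functional `h`. -/
def stateSliceR : MinTensor B A →L[ℂ] B := (gns h).sliceR (gnsVec h 1) (gnsVec h 1)

/-- The slice map `h ⊗ id` of a positive functional `h`. -/
def stateSliceL : MinTensor A B →L[ℂ] B := (gns h).sliceL (gnsVec h 1) (gnsVec h 1)

lemma coeff_gnsVec (a b c : A) :
    (gns h).coeff (gnsVec h b) (gnsVec h c) a = h (star b * a * c) := by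
  rw [coeff_apply, gns_rep_gnsVec, inner_gnsVec, mul_assoc]

lemma coeff_gnsVec_one (a : A) : (gns h).coeff (gnsVec h 1) (gnsVec h 1) a = h a := by
  rw [coeff_gnsVec, star_one, one_mul, mul_one]

lemma stateSliceR_tmul (b : B) (a : A) : stateSliceR h (MinTensor.tmul b a) = h a • b := by
  rw [stateSliceR, sliceR_tmul, coeff_gnsVec_one]

lemma stateSliceL_tmul (a : A) (b : B) : stateSliceL h (MinTensor.tmul a b) = h a • b := by
  rw [stateSliceL, sliceL_tmul, coeff_gnsVec_one]

lemma sliceR_gnsVec (a c : A) (z : MinTensor B A) :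
    (gns h).sliceR (gnsVec h (star a)) (gnsVec h c) z
      = stateSliceR h (MinTensor.tmul 1 a * z * MinTensor.tmul 1 c) := by
  refine DFunLike.congr_fun (f := (gns h).sliceR (gnsVec h (star a)) (gnsVec h c))
    (g := (stateSliceR h).comp ((mulRightCLM (MinTensor.tmul 1 c)).comp
      (mulLeftCLM (MinTensor.tmul 1 a)))) ?_ z
  refine MinTensor.clm_ext fun p q => ?_
  change _ = stateSliceR h (MinTensor.tmul 1 a * MinTensor.tmul p q * MinTensor.tmul 1 c)
  rw [sliceR_tmul, coeff_gnsVec, MinTensor.tmul_mul_tmul, MinTensor.tmul_mul_tmul,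
    stateSliceR_tmul, one_mul, mul_one, star_star]

lemma sliceL_gnsVec (a c : A) (z : MinTensor A B) :
    (gns h).sliceL (gnsVec h (star a)) (gnsVec h c) z
      = stateSliceL h (MinTensor.tmul a 1 * z * MinTensor.tmul c 1) := by
  refine DFunLike.congr_fun (f := (gns h).sliceL (gnsVec h (star a)) (gnsVec h c))
    (g := (stateSliceL h).comp ((mulRightCLM (MinTensor.tmul c 1)).comp
      (mulLeftCLM (MinTensor.tmul a 1)))) ?_ z
  refine MinTensor.clm_ext fun p q => ?_
  change _ = stateSliceL h (MinTensor.tmul a 1 * MinTensor.tmul p q * MinTensor.tmul c 1)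
  rw [sliceL_tmul, coeff_gnsVec, MinTensor.tmul_mul_tmul, MinTensor.tmul_mul_tmul,
    stateSliceL_tmul, one_mul, mul_one, star_star]

lemma stateSliceL_mul_one_tmul (z : MinTensor A B) (r : B) :
    stateSliceL h (z * MinTensor.tmul 1 r) = stateSliceL h z * r := by
  refine DFunLike.congr_fun
    (f := (stateSliceL h).comp (mulRightCLM (MinTensor.tmul 1 r)))
    (g := (mulRightCLM r).comp (stateSliceL h)) ?_ z
  refine MinTensor.clm_ext fun p q => ?_
  change stateSliceL h (MinTensor.tmul p q * MinTensor.tmul 1 r)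
    = stateSliceL h (MinTensor.tmul p q) * r
  rw [MinTensor.tmul_mul_tmul, stateSliceL_tmul, stateSliceL_tmul, mul_one, smul_mul_assoc]

end StateSlices

namespace HilbertRep

lemma coeff_sliceL_eq {A B : Type u} [CStarAlgebra A] [CStarAlgebra B]
    (π : HilbertRep A) (σ : HilbertRep B) (x y : π.space) (v w : σ.space)
    (z : MinTensor A B) : σ.coeff v w (π.sliceL x y z) = π.coeff x y (σ.sliceR v w z) := by
  rw [coeff_sliceL, coeff_sliceR]

end HilbertRep

namespace CompactQuantumGroup

open HilbertRep

variable {A B : Type u} [CStarAlgebra A] [CStarAlgebra B] (G : CompactQuantumGroup A)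

/-- The operator `(ω ⊗ id) Δ` for a vector functional `ω`. -/
def convL (π : HilbertRep A) (x y : π.space) : A →L[ℂ] A := (π.sliceL x y).comp G.comul.toCLM

/-- The operator `(id ⊗ ω) Δ` for a vector functional `ω`. -/
def convR (π : HilbertRep A) (x y : π.space) : A →L[ℂ] A := (π.sliceR x y).comp G.comul.toCLM

lemma convL_apply (π : HilbertRep A) (x y : π.space) (a : A) :
    G.convL π x y a = π.sliceL x y (G.comul a) := rfl

lemma convR_apply (π : HilbertRep A) (x y : π.space) (a : A) :
    G.convR π x y a = π.sliceR x y (G.comul a) := rfl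

/-- Both sides are `(ω ⊗ ω') Δ(a)`. This exchanges a functional on one leg for a convolution
operator on the other. -/
lemma coeff_convL (π σ : HilbertRep A) (x y : π.space) (v w : σ.space) (a : A) :
    σ.coeff v w (G.convL π x y a) = π.coeff x y (G.convR σ v w a) :=
  coeff_sliceL_eq _ _ _ _ _ _ _

lemma comul_sliceR (σ : HilbertRep B) (v w : σ.space) (z : MinTensor A B) :
    G.comul (σ.sliceR v w z) = σ.sliceR v w (MinTensor.map G.comul (StarAlgHom.id ℂ B) z) := by
  refine DFunLike.congr_fun (f := G.comul.toCLM.comp (σ.sliceR v w))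
    (g := (σ.sliceR v w).comp (MinTensor.map G.comul (StarAlgHom.id ℂ B)).toCLM) ?_ z
  refine MinTensor.clm_ext fun a b => ?_
  change G.comul (σ.sliceR v w (MinTensor.tmul a b))
    = σ.sliceR v w (MinTensor.map G.comul (StarAlgHom.id ℂ B) (MinTensor.tmul a b))
  rw [MinTensor.map_tmul, sliceR_tmul, sliceR_tmul, map_smul]
  rfl

lemma comul_sliceL (π : HilbertRep B) (x y : π.space) (z : MinTensor B A) :
    G.comul (π.sliceL x y z) = π.sliceL x y (MinTensor.map (StarAlgHom.id ℂ B) G.comul z) := by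
  refine DFunLike.congr_fun (f := G.comul.toCLM.comp (π.sliceL x y))
    (g := (π.sliceL x y).comp (MinTensor.map (StarAlgHom.id ℂ B) G.comul).toCLM) ?_ z
  refine MinTensor.clm_ext fun a b => ?_
  change G.comul (π.sliceL x y (MinTensor.tmul a b))
    = π.sliceL x y (MinTensor.map (StarAlgHom.id ℂ B) G.comul (MinTensor.tmul a b))
  rw [MinTensor.map_tmul, sliceL_tmul, sliceL_tmul, map_smul]
  rfl

/-- Left and right convolution operators commute. -/
lemma convL_convR (π σ : HilbertRep A) (x y : π.space) (v w : σ.space) (a : A) :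
    G.convL π x y (G.convR σ v w a) = G.convR σ v w (G.convL π x y a) := by
  obtain ⟨e, he, hco⟩ := G.coassoc
  have hsymm : ∀ a b c : A, e.symm (MinTensor.tmul a (MinTensor.tmul b c))
      = MinTensor.tmul (MinTensor.tmul a b) c := fun a b c => by
    rw [← he, e.symm_apply_apply]
  let e' : MinTensor A (MinTensor A A) →⋆ₐ[ℂ] MinTensor (MinTensor A A) A :=
    (e.symm : MinTensor A (MinTensor A A) →⋆ₐ[ℂ] MinTensor (MinTensor A A) A)
  -- On a triple tensor product, slicing the two outer legs does not depend on the bracketing or on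
  -- the order; coassociativity is then the whole statement.
  have key : ∀ T, π.sliceL x y (σ.sliceR v w (e' T)) = σ.sliceR v w (π.sliceL x y T) := by
    intro T
    refine DFunLike.congr_fun (f := (π.sliceL x y).comp ((σ.sliceR v w).comp e'.toCLM))
      (g := (σ.sliceR v w).comp (π.sliceL x y)) ?_ T
    refine MinTensor.clm_ext fun a t => ?_
    refine DFunLike.congr_fun
      (f := ((π.sliceL x y).comp ((σ.sliceR v w).comp e'.toCLM)).comp (MinTensor.tmulL a))
      (g := ((σ.sliceR v w).comp (π.sliceL x y)).comp (MinTensor.tmulL a)) ?_ t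
    refine MinTensor.clm_ext fun b c => ?_
    change π.sliceL x y (σ.sliceR v w (e.symm (MinTensor.tmul a (MinTensor.tmul b c))))
      = σ.sliceR v w (π.sliceL x y (MinTensor.tmul a (MinTensor.tmul b c)))
    rw [hsymm, sliceR_tmul, sliceL_tmul, map_smul, map_smul, sliceL_tmul, sliceR_tmul, smul_comm]
  have h1 : MinTensor.map G.comul (StarAlgHom.id ℂ A) (G.comul a)
      = e' (MinTensor.map (StarAlgHom.id ℂ A) G.comul (G.comul a)) :=
    (e.symm_apply_apply _).symm.trans (congrArg e.symm (hco a))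
  rw [convL_apply, convR_apply, comul_sliceR, h1, key, convR_apply, convL_apply, comul_sliceL]

/-! ### Convolution by functionals and strong invariance of the Haar state -/

section Haar

variable {G} [PartialOrder A] [StarOrderedRing A] {h : A →ₚ[ℂ] ℂ}

/-- The operator `(μ ⊗ id) Δ` for a positive functional `μ`. -/
def conv (G : CompactQuantumGroup A) (μ : A →ₚ[ℂ] ℂ) : A →L[ℂ] A :=
  (stateSliceL μ).comp G.comul.toCLM

lemma conv_apply (μ : A →ₚ[ℂ] ℂ) (a : A) : G.conv μ a = stateSliceL μ (G.comul a) := rfl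

lemma conv_eq (μ : A →ₚ[ℂ] ℂ) : G.conv μ = G.convL (gns μ) (gnsVec μ 1) (gnsVec μ 1) := rfl

lemma coeff_conv (μ : A →ₚ[ℂ] ℂ) (σ : HilbertRep A) (v w : σ.space) (a : A) :
    σ.coeff v w (G.conv μ a) = μ (G.convR σ v w a) := by
  rw [conv_eq, coeff_convL, coeff_gnsVec_one]

lemma conv_convR (μ : A →ₚ[ℂ] ℂ) (σ : HilbertRep A) (v w : σ.space) (a : A) :
    G.conv μ (G.convR σ v w a) = G.convR σ v w (G.conv μ a) := by
  rw [conv_eq, convL_convR]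

/-- The slice map supplied by the definition agrees on elementary tensors with the one built from
the GNS representation, hence everywhere. -/
lemma IsHaarState.stateSliceL_comul (hh : G.IsHaarState h) (a : A) :
    stateSliceL h (G.comul a) = h a • (1 : A) := by
  obtain ⟨S, hS, hS'⟩ := hh.left_invariant
  rw [← hS']
  exact DFunLike.congr_fun (MinTensor.clm_ext fun a b => by rw [hS, stateSliceL_tmul]) _

lemma IsHaarState.stateSliceR_comul (hh : G.IsHaarState h) (a : A) :
    stateSliceR h (G.comul a) = h a • (1 : A) := by
  obtain ⟨S, hS, hS'⟩ := hh.right_invariant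
  rw [← hS']
  exact DFunLike.congr_fun (MinTensor.clm_ext fun a b => by rw [hS, stateSliceR_tmul]) _

/-- For `y = p ⊗ q` the left side is `h(q s) (h ⊗ id)(Δ(p)) r`, and left invariance applies. The
outer two of the three legs are integrated, here and in the two invariance lemmas that lead to
`strong_invariance`. -/
lemma IsHaarState.stateSlice_map_comul_mul (hh : G.IsHaarState h) (y : MinTensor A A) (r s : A) :
    stateSliceL h (stateSliceR h (MinTensor.map G.comul (StarAlgHom.id ℂ A) y *
        MinTensor.tmul (MinTensor.tmul 1 r) s)) = h (stateSliceL h y * s) • r := by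
  have H : (stateSliceL h).comp ((stateSliceR h).comp
        ((mulRightCLM (MinTensor.tmul (MinTensor.tmul 1 r) s)).comp
          (MinTensor.map G.comul (StarAlgHom.id ℂ A)).toCLM))
      = (((gns h).coeff (gnsVec h 1) (gnsVec h 1)).smulRight r).comp
        ((mulRightCLM s).comp (stateSliceL h)) := by
    refine MinTensor.clm_ext fun p q => ?_
    change stateSliceL h (stateSliceR h (MinTensor.map G.comul (StarAlgHom.id ℂ A)
        (MinTensor.tmul p q) * MinTensor.tmul (MinTensor.tmul 1 r) s))
      = (gns h).coeff (gnsVec h 1) (gnsVec h 1) (stateSliceL h (MinTensor.tmul p q) * s) • r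
    rw [MinTensor.map_tmul, MinTensor.tmul_mul_tmul, stateSliceR_tmul, map_smul,
      stateSliceL_mul_one_tmul, hh.stateSliceL_comul, stateSliceL_tmul, coeff_gnsVec_one,
      smul_mul_assoc, smul_mul_assoc, one_mul, map_smul, smul_assoc, smul_comm]
    rfl
  refine (DFunLike.congr_fun H y).trans ?_
  change (gns h).coeff (gnsVec h 1) (gnsVec h 1) (stateSliceL h y * s) • r = _
  rw [coeff_gnsVec_one]

section Assoc

variable {e : MinTensor A (MinTensor A A) →⋆ₐ[ℂ] MinTensor (MinTensor A A) A}

lemma IsHaarState.stateSlice_map_comul_mul_assoc (hh : G.IsHaarState h)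
    (he : ∀ a b c : A, e (MinTensor.tmul a (MinTensor.tmul b c))
      = MinTensor.tmul (MinTensor.tmul a b) c)
    (y t : MinTensor A A) :
    stateSliceL h (stateSliceR h (MinTensor.map G.comul (StarAlgHom.id ℂ A) y *
        e (MinTensor.tmul 1 t))) = stateSliceR h (MinTensor.tmul 1 (stateSliceL h y) * t) := by
  have H : (stateSliceL h).comp ((stateSliceR h).comp
        ((mulLeftCLM (MinTensor.map G.comul (StarAlgHom.id ℂ A) y)).comp
          (e.toCLM.comp (MinTensor.tmulL 1))))
      = (stateSliceR h).comp
        (mulLeftCLM (MinTensor.tmul 1 (stateSliceL h y))) := by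
    refine MinTensor.clm_ext fun r s => ?_
    change stateSliceL h (stateSliceR h (MinTensor.map G.comul (StarAlgHom.id ℂ A) y *
        e (MinTensor.tmul 1 (MinTensor.tmul r s))))
      = stateSliceR h (MinTensor.tmul 1 (stateSliceL h y) * MinTensor.tmul r s)
    rw [he, MinTensor.tmul_mul_tmul, stateSliceR_tmul, one_mul, hh.stateSlice_map_comul_mul]
  exact DFunLike.congr_fun H t

lemma stateSliceR_mul_assoc
    (he : ∀ a b c : A, e (MinTensor.tmul a (MinTensor.tmul b c))
      = MinTensor.tmul (MinTensor.tmul a b) c)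
    (z : MinTensor A A) (p : A) (t : MinTensor A A) :
    stateSliceR h (MinTensor.tmul z 1 * e (MinTensor.tmul p t))
      = z * MinTensor.tmul p (stateSliceR h t) := by
  have H : (stateSliceR h).comp ((mulLeftCLM (MinTensor.tmul z 1)).comp
        (e.toCLM.comp (MinTensor.tmulL p)))
      = (mulLeftCLM z).comp ((MinTensor.tmulL p).comp (stateSliceR h)) := by
    refine MinTensor.clm_ext fun r s => ?_
    change stateSliceR h (MinTensor.tmul z 1 * e (MinTensor.tmul p (MinTensor.tmul r s)))
      = z * MinTensor.tmul p (stateSliceR h (MinTensor.tmul r s))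
    rw [he, MinTensor.tmul_mul_tmul, stateSliceR_tmul, one_mul, stateSliceR_tmul,
      MinTensor.tmul_smul, mul_smul_comm]
  exact DFunLike.congr_fun H t

/-- Right invariance applied to the last two legs: integrating the third leg of `(id ⊗ Δ)(y)` leaves
`1` in the second. -/
lemma IsHaarState.stateSliceR_mul_assoc_map_comul (hh : G.IsHaarState h)
    (he : ∀ a b c : A, e (MinTensor.tmul a (MinTensor.tmul b c))
      = MinTensor.tmul (MinTensor.tmul a b) c)
    (z y : MinTensor A A) :
    stateSliceR h (MinTensor.tmul z 1 * e (MinTensor.map (StarAlgHom.id ℂ A) G.comul y))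
      = z * MinTensor.tmul (stateSliceR h y) 1 := by
  have H : (stateSliceR h).comp ((mulLeftCLM (MinTensor.tmul z 1)).comp
        (e.toCLM.comp (MinTensor.map (StarAlgHom.id ℂ A) G.comul).toCLM))
      = (mulLeftCLM z).comp ((MinTensor.tmulR 1).comp (stateSliceR h)) := by
    refine MinTensor.clm_ext fun p q => ?_
    change stateSliceR h (MinTensor.tmul z 1 *
        e (MinTensor.map (StarAlgHom.id ℂ A) G.comul (MinTensor.tmul p q)))
      = z * MinTensor.tmul (stateSliceR h (MinTensor.tmul p q)) 1
    rw [MinTensor.map_tmul, stateSliceR_mul_assoc he, hh.stateSliceR_comul, stateSliceR_tmul,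
      MinTensor.tmul_smul, MinTensor.smul_tmul']
    rfl
  exact DFunLike.congr_fun H y

end Assoc

/-- Strong invariance of the Haar state: for `a`, `b`, `c`, with
`y = (h ⊗ id)((b ⊗ 1) Δ(a))` and `x = (id ⊗ h)(Δ(a) (1 ⊗ c))`,
`(id ⊗ h)((1 ⊗ y) Δ(c)) = (h ⊗ id)(Δ(b) (x ⊗ 1))`. -/
lemma IsHaarState.strong_invariance (hh : G.IsHaarState h) (a b c : A) :
    stateSliceR h (MinTensor.tmul 1 (stateSliceL h (MinTensor.tmul b 1 * G.comul a)) * G.comul c)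
      = stateSliceL h (G.comul b *
          MinTensor.tmul (stateSliceR h (G.comul a * MinTensor.tmul 1 c)) 1) := by
  obtain ⟨e, he, hco⟩ := G.coassoc
  let e' : MinTensor A (MinTensor A A) →⋆ₐ[ℂ] MinTensor (MinTensor A A) A :=
    (e.symm : MinTensor A (MinTensor A A) →⋆ₐ[ℂ] MinTensor (MinTensor A A) A)
  have he' : ∀ a b c : A, e' (MinTensor.tmul a (MinTensor.tmul b c))
      = MinTensor.tmul (MinTensor.tmul a b) c := fun a b c => by
    rw [← he]
    exact e.symm_apply_apply _
  have hD : MinTensor.map G.comul (StarAlgHom.id ℂ A) (G.comul a)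
      = e' (MinTensor.map (StarAlgHom.id ℂ A) G.comul (G.comul a)) :=
    (e.symm_apply_apply _).symm.trans (congrArg e.symm (hco a))
  have hX : MinTensor.map G.comul (StarAlgHom.id ℂ A) (MinTensor.tmul b 1 * G.comul a)
      = MinTensor.tmul (G.comul b) 1 * MinTensor.map G.comul (StarAlgHom.id ℂ A) (G.comul a) := by
    rw [map_mul, MinTensor.map_tmul]
    rfl
  have hZ : e' (MinTensor.map (StarAlgHom.id ℂ A) G.comul (G.comul a * MinTensor.tmul 1 c))
      = MinTensor.map G.comul (StarAlgHom.id ℂ A) (G.comul a)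
        * e' (MinTensor.tmul 1 (G.comul c)) := by
    rw [map_mul, map_mul, hD, MinTensor.map_tmul]
    rfl
  -- Both sides evaluate `(h ⊗ id ⊗ h)` at `(Δ(b) ⊗ 1) Δ²(a) (1 ⊗ Δ(c))`, where `Δ²` is the iterated
  -- coproduct: grouping `Δ²(a)` with `b` uses left invariance, grouping it with `c` uses right
  -- invariance.
  rw [← hh.stateSlice_map_comul_mul_assoc he', hX, mul_assoc, ← hZ,
    hh.stateSliceR_mul_assoc_map_comul he']

end Haar

end CompactQuantumGroup

/-! ### The regular representation of a compact quantum group -/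

namespace CompactQuantumGroup

open HilbertRep

variable {A : Type u} [CStarAlgebra A] [PartialOrder A] [StarOrderedRing A]
variable {G : CompactQuantumGroup A} {h : A →ₚ[ℂ] ℂ}

lemma gnsVec_eq_rep (a : A) : gnsVec h a = (gns h).rep a (gnsVec h 1) := by
  rw [gns_rep_gnsVec, mul_one]

lemma inner_gnsVec_right (η : (gns h).space) (a : A) :
    inner ℂ η (gnsVec h a) = (gns h).coeff η (gnsVec h 1) a := by
  rw [coeff_apply, ← gnsVec_eq_rep]

lemma norm_gnsVec_one {μ : A →ₚ[ℂ] ℂ} (h1 : μ 1 = 1) : ‖gnsVec μ 1‖ = 1 := by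
  have := norm_gnsVec_sq μ 1
  rw [star_one, one_mul, h1] at this
  have h2 : ‖gnsVec μ 1‖ ^ 2 = 1 := by exact_mod_cast this
  nlinarith [norm_nonneg (gnsVec μ 1)]

lemma IsHaarState.convR_one (hh : G.IsHaarState h) (a : A) :
    G.convR (gns h) (gnsVec h 1) (gnsVec h 1) a = h a • (1 : A) := hh.stateSliceR_comul a

lemma IsHaarState.conv_self (hh : G.IsHaarState h) (a : A) : G.conv h a = h a • (1 : A) :=
  hh.stateSliceL_comul a

lemma IsHaarState.apply_conv (hh : G.IsHaarState h) (μ : A →ₚ[ℂ] ℂ) (a : A) :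
    h (G.conv μ a) = μ 1 * h a := by
  rw [← coeff_gnsVec_one h, coeff_conv, hh.convR_one, map_smul, smul_eq_mul, mul_comm]

/-- Convolution by a state is contractive for the `L²`-norm of the Haar state. -/
lemma IsHaarState.norm_gnsVec_conv_le (hh : G.IsHaarState h) {μ : A →ₚ[ℂ] ℂ} (h1 : μ 1 = 1)
    (c : A) : ‖gnsVec h (G.conv μ c)‖ ≤ ‖gnsVec h c‖ := by
  -- The vector `Δ(c)(Ω_μ ⊗ Ω_h)` has squared norm `(μ ⊗ h) Δ(c* c)`, which is `h(c* c)` by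
  -- invariance.
  have hn : ‖((gns μ).prod (gns h)).rep (G.comul c) (vtmul (gnsVec μ 1) (gnsVec h 1))‖
      = ‖gnsVec h c‖ := by
    rw [← sq_eq_sq₀ (norm_nonneg _) (norm_nonneg _)]
    have e1 : inner ℂ (((gns μ).prod (gns h)).rep (G.comul c) (vtmul (gnsVec μ 1) (gnsVec h 1)))
        (((gns μ).prod (gns h)).rep (G.comul c) (vtmul (gnsVec μ 1) (gnsVec h 1)))
        = h (star c * c) := by
      rw [← coeff_apply, ← star_star (G.comul c), ← coeff_mul_left, star_star, ← map_star,
        ← map_mul, ← coeff_sliceL, coeff_gnsVec_one]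
      exact (hh.apply_conv μ _).trans (by rw [h1, one_mul])
    rw [inner_self_eq_norm_sq_to_K, ← norm_gnsVec_sq] at e1
    refine Complex.ofReal_injective ?_
    rw [← e1, Complex.ofReal_pow]
    rfl
  -- The convolution is recovered by pairing that vector with `Ω_μ ⊗ (μ * c)`, so Cauchy–Schwarz
  -- gives the bound.
  have h2 : ‖gnsVec h (G.conv μ c)‖ ^ 2 ≤ ‖gnsVec h (G.conv μ c)‖ * ‖gnsVec h c‖ := by
    have e2 : inner ℂ (gnsVec h (G.conv μ c)) (gnsVec h (G.conv μ c))
        = inner ℂ (vtmul (gnsVec μ 1) (gnsVec h (G.conv μ c)) : ((gns μ).prod (gns h)).space)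
          (((gns μ).prod (gns h)).rep (G.comul c) (vtmul (gnsVec μ 1) (gnsVec h 1))) := by
      rw [inner_gnsVec_right, ← coeff_apply, ← coeff_sliceL]
      rfl
    have e3 := norm_inner_le_norm (𝕜 := ℂ)
      (vtmul (gnsVec μ 1) (gnsVec h (G.conv μ c)) : ((gns μ).prod (gns h)).space)
      (((gns μ).prod (gns h)).rep (G.comul c) (vtmul (gnsVec μ 1) (gnsVec h 1)))
    rw [← e2, hn, norm_vtmul, norm_gnsVec_one h1, one_mul, inner_self_eq_norm_sq_to_K] at e3
    simpa using e3
  rcases (norm_nonneg (gnsVec h (G.conv μ c))).eq_or_lt with h0 | h0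
  · rw [← h0]; exact norm_nonneg _
  · rw [sq] at h2
    exact le_of_mul_le_mul_left h2 h0

/-- Convolution by a state, as an operator on the GNS space of the Haar state. -/
def convOp (G : CompactQuantumGroup A) (h μ : A →ₚ[ℂ] ℂ) : (gns h).space →L[ℂ] (gns h).space :=
  ((gnsVec h).comp (G.conv μ)).toLinearMap.extendOfNorm (gnsVec h).toLinearMap

lemma IsHaarState.convOp_gnsVec (hh : G.IsHaarState h) {μ : A →ₚ[ℂ] ℂ} (h1 : μ 1 = 1) (c : A) :
    G.convOp h μ (gnsVec h c) = gnsVec h (G.conv μ c) :=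
  LinearMap.extendOfNorm_eq (e := (gnsVec h).toLinearMap) (denseRange_gnsVec h)
    ⟨1, fun x => by rw [one_mul]; exact hh.norm_gnsVec_conv_le h1 x⟩ c

lemma IsHaarState.norm_convOp_le (hh : G.IsHaarState h) {μ : A →ₚ[ℂ] ℂ} (h1 : μ 1 = 1)
    (ξ : (gns h).space) : ‖G.convOp h μ ξ‖ ≤ ‖ξ‖ := by
  have := LinearMap.norm_extendOfNorm_apply_le (e := (gnsVec h).toLinearMap)
    (f := ((gnsVec h).comp (G.conv μ)).toLinearMap) (denseRange_gnsVec h) 1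
    (fun x => by rw [one_mul]; exact hh.norm_gnsVec_conv_le h1 x) ξ
  rwa [one_mul] at this

/-- The operator `ξ ↦ (id ⊗ h)(K (1 ⊗ ξ))`, linear in the kernel `K`. -/
def kernelR (h : A →ₚ[ℂ] ℂ) : MinTensor A A →L[ℂ] (gns h).space →L[ℂ] A :=
  LinearMap.mkContinuous₂ (LinearMap.mk₂ ℂ (fun K ξ => (gns h).sliceR (gnsVec h 1) ξ K)
    (fun _ _ _ => map_add _ _ _) (fun _ _ _ => map_smul _ _ _)
    (fun _ _ _ => sliceR_add_right _ _ _ _ _) (fun _ _ _ => sliceR_smul_right _ _ _ _ _))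
    ‖gnsVec h 1‖ fun K ξ => (norm_sliceR_le _ _ _ _).trans_eq (by ring)

/-- The operator `ξ ↦ (h ⊗ id)(K (ξ ⊗ 1))`, linear in the kernel `K`. -/
def kernelL (h : A →ₚ[ℂ] ℂ) : MinTensor A A →L[ℂ] (gns h).space →L[ℂ] A :=
  LinearMap.mkContinuous₂ (LinearMap.mk₂ ℂ (fun K ξ => (gns h).sliceL (gnsVec h 1) ξ K)
    (fun _ _ _ => map_add _ _ _) (fun _ _ _ => map_smul _ _ _)
    (fun _ _ _ => sliceL_add_right _ _ _ _ _) (fun _ _ _ => sliceL_smul_right _ _ _ _ _))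
    ‖gnsVec h 1‖ fun K ξ => (norm_sliceL_le _ _ _ _).trans_eq (by ring)

lemma kernelR_apply (K : MinTensor A A) (ξ : (gns h).space) :
    kernelR h K ξ = (gns h).sliceR (gnsVec h 1) ξ K := rfl

lemma kernelL_apply (K : MinTensor A A) (ξ : (gns h).space) :
    kernelL h K ξ = (gns h).sliceL (gnsVec h 1) ξ K := rfl

lemma kernelR_gnsVec (K : MinTensor A A) (c : A) :
    kernelR h K (gnsVec h c) = stateSliceR h (K * MinTensor.tmul 1 c) := by
  rw [kernelR_apply]
  conv_lhs => rw [← star_one A]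
  rw [sliceR_gnsVec, MinTensor.tmul_one_one, one_mul]

lemma kernelL_gnsVec (K : MinTensor A A) (c : A) :
    kernelL h K (gnsVec h c) = stateSliceL h (K * MinTensor.tmul c 1) := by
  rw [kernelL_apply]
  conv_lhs => rw [← star_one A]
  rw [sliceL_gnsVec, MinTensor.tmul_one_one, one_mul]

/-- The operators with kernels `K` (integrating the right leg) and `K*` (integrating the left leg)
are adjoint to each other. Hence `smoothingOp` is `T* T` for the kernel operator `T` of `Δ(a)`. -/
lemma inner_kernelR (K : MinTensor A A) (η ξ : (gns h).space) :
    inner ℂ η (gnsVec h (kernelR h K ξ)) = inner ℂ (gnsVec h (kernelL h (star K) η)) ξ := by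
  rw [← inner_conj_symm (gnsVec h (kernelL h (star K) η)), inner_gnsVec_right, inner_gnsVec_right,
    kernelR_apply, kernelL_apply, coeff_sliceR, coeff_sliceL, coeff_star]
  exact (star_star _).symm

/-- Kernel operators are compact. -/
lemma isCompactOperator_kernelR (K : MinTensor A A) :
    IsCompactOperator ((gnsVec h).comp (kernelR h K)) := by
  have hclosed : IsClosed {K : MinTensor A A | IsCompactOperator ((gnsVec h).comp (kernelR h K))} := by
    have hc : Continuous fun K : MinTensor A A => (gnsVec h).comp (kernelR h K) :=
      ((ContinuousLinearMap.compL ℂ _ _ _ (gnsVec h)).continuous).comp (kernelR h).continuous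
    exact isClosed_setOfPred_isCompactOperator.preimage hc
  have hspan : ∀ K ∈ Submodule.span ℂ (Set.range fun p : A × A => MinTensor.tmul p.1 p.2),
      IsCompactOperator ((gnsVec h).comp (kernelR h K)) := by
    intro K hK
    induction hK using Submodule.span_induction with
    | mem K hK =>
      obtain ⟨⟨p, q⟩, rfl⟩ := hK
      -- An elementary tensor gives a rank-one operator.
      let φ : (gns h).space →L[ℂ] ℂ := innerSL ℂ (gnsVec h (star q))
      have e : ⇑((gnsVec h).comp (kernelR h (MinTensor.tmul p q)))
          = ⇑(ContinuousLinearMap.toSpanSingleton ℂ (gnsVec h p)) ∘ ⇑φ := by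
        funext ξ
        change gnsVec h (kernelR h (MinTensor.tmul p q) ξ)
          = inner ℂ (gnsVec h (star q)) ξ • gnsVec h p
        rw [kernelR_apply, sliceR_tmul, map_smul, ← mul_one q, coeff_mul_left, coeff_one,
          ← gnsVec_eq_rep, mul_one]
      change IsCompactOperator ⇑((gnsVec h).comp (kernelR h (MinTensor.tmul p q)))
      rw [e]
      have hφ : IsCompactOperator ⇑φ := isCompactOperator_of_locallyCompactSpace_dom φ
      exact hφ.clm_comp (ContinuousLinearMap.toSpanSingleton ℂ (gnsVec h p))
    | zero =>
      rw [map_zero, ContinuousLinearMap.comp_zero]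
      exact isCompactOperator_zero
    | add x y _ _ hx hy =>
      rw [map_add, ContinuousLinearMap.comp_add]
      exact hx.add hy
    | smul r x _ hx =>
      rw [map_smul, ContinuousLinearMap.comp_smul]
      exact hx.smul r
  have := (hclosed.closure_subset_iff (s := _)).mpr hspan
  exact this (MinTensor.dense_span_tmul K)

/-- The operator on `L²(G)` of right convolution by `(h ⊗ id)((a* ⊗ 1) Δ(a))`, with values
in `C(G)`. -/
def smoothing (G : CompactQuantumGroup A) (h : A →ₚ[ℂ] ℂ) (a : A) : (gns h).space →L[ℂ] A :=
  (kernelL h (G.comul (star a))).comp ((gnsVec h).comp (kernelR h (G.comul a)))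

/-- The operator `smoothing` on `L²(G)`. -/
def smoothingOp (G : CompactQuantumGroup A) (h : A →ₚ[ℂ] ℂ) (a : A) :
    (gns h).space →L[ℂ] (gns h).space := (gnsVec h).comp (G.smoothing h a)

lemma smoothingOp_apply (a : A) (ξ : (gns h).space) :
    G.smoothingOp h a ξ = gnsVec h (G.smoothing h a ξ) := rfl

lemma inner_smoothingOp (a : A) (η ξ : (gns h).space) :
    inner ℂ (G.smoothingOp h a η) ξ
      = inner ℂ (gnsVec h (kernelR h (G.comul a) η)) (gnsVec h (kernelR h (G.comul a) ξ)) := by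
  rw [inner_kernelR, ← map_star]
  rfl

lemma isSymmetric_smoothingOp (a : A) : (G.smoothingOp h a).IsSymmetric := by
  intro η ξ
  change inner ℂ (G.smoothingOp h a η) ξ = inner ℂ η (G.smoothingOp h a ξ)
  rw [inner_smoothingOp, ← inner_conj_symm η, inner_smoothingOp, inner_conj_symm]

lemma isCompactOperator_smoothingOp (a : A) : IsCompactOperator (G.smoothingOp h a) :=
  (isCompactOperator_kernelR (G.comul a)).clm_comp
    ((gnsVec h).comp (kernelL h (G.comul (star a))))

/-- The functional `h(k ·)` whose right convolution operator is `smoothing`. -/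
def smoothingVec (G : CompactQuantumGroup A) (h : A →ₚ[ℂ] ℂ) (a : A) : (gns h).space :=
  gnsVec h (star (stateSliceL h (MinTensor.tmul (star a) 1 * G.comul a)))

/-- Strong invariance with `b = a*`. It gives the positive compact operator `T* T` a second
description as a right convolution, which is why it commutes with left convolutions. -/
lemma IsHaarState.smoothing_gnsVec (hh : G.IsHaarState h) (a c : A) :
    G.smoothing h a (gnsVec h c) = G.convR (gns h) (G.smoothingVec h a) (gnsVec h 1) c := by
  rw [convR_apply, smoothingVec, sliceR_gnsVec, MinTensor.tmul_one_one, mul_one,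
    hh.strong_invariance, ← kernelR_gnsVec, ← kernelL_gnsVec]
  rfl

lemma IsHaarState.convOp_smoothingOp (hh : G.IsHaarState h) {μ : A →ₚ[ℂ] ℂ} (h1 : μ 1 = 1) (a : A)
    (ξ : (gns h).space) :
    G.convOp h μ (G.smoothingOp h a ξ) = G.smoothingOp h a (G.convOp h μ ξ) := by
  refine (denseRange_gnsVec h).induction_on (p := fun ξ => G.convOp h μ (G.smoothingOp h a ξ)
    = G.smoothingOp h a (G.convOp h μ ξ)) ξ ?_ fun c => ?_
  · exact isClosed_eq (by fun_prop) (by fun_prop)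
  · rw [smoothingOp_apply, hh.smoothing_gnsVec, hh.convOp_gnsVec h1, hh.convOp_gnsVec h1,
      smoothingOp_apply, hh.smoothing_gnsVec, conv_convR]

lemma IsHaarState.smoothingOp_one (hh : G.IsHaarState h) (a : A) :
    ∃ r : ℂ, G.smoothingOp h a (gnsVec h 1) = r • gnsVec h 1 := by
  refine ⟨(gns h).coeff (G.smoothingVec h a) (gnsVec h 1) 1, ?_⟩
  rw [smoothingOp_apply, hh.smoothing_gnsVec, convR_apply, _root_.map_one G.comul, ← MinTensor.tmul_one_one,
    sliceR_tmul, map_smul]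

/-- The smoothing operators have no common kernel. -/
lemma eq_zero_of_smoothingOp_eq_zero (h1 : h 1 = 1) {ξ : (gns h).space}
    (hξ : ∀ a, G.smoothingOp h a ξ = 0) : ξ = 0 := by
  -- From `T* T ξ = 0` follows `T ξ = 0`. Thus the functional `f`, which is `h` on the first leg and
  -- `⟨Ω, · ξ⟩` on the second, vanishes on `(A ⊗ 1) Δ(A)`, hence everywhere; on `1 ⊗ c*` it computes
  -- `⟨c, ξ⟩`.
  have hker : ∀ a, gnsVec h (kernelR h (G.comul a) ξ) = 0 := by
    intro a
    rw [← inner_self_eq_zero (𝕜 := ℂ), ← inner_smoothingOp, hξ, inner_zero_left]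
  let f : MinTensor A A →L[ℂ] ℂ :=
    ((gns h).prod (gns h)).coeff (vtmul (gnsVec h 1) (gnsVec h 1)) (vtmul (gnsVec h 1) ξ)
  have hf : f = 0 := by
    refine ContinuousLinearMap.ext_on G.dense_tmul_one_mul ?_
    rintro _ ⟨b, a, rfl⟩
    have e : f (MinTensor.tmul b 1 * G.comul a)
        = inner ℂ (gnsVec h (star b)) (gnsVec h (kernelR h (G.comul a) ξ)) := by
      change ((gns h).prod (gns h)).coeff _ _ _ = _
      rw [coeff_mul_left, MinTensor.star_tmul, prod_rep_tmul, star_one, map_one (gns h).rep,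
        one_apply_eq_self, ← gnsVec_eq_rep, ← coeff_sliceR, ← inner_gnsVec_right, kernelR_apply]
    rw [e, hker, inner_zero_right]
    rfl
  refine (denseRange_gnsVec h).eq_zero_of_inner_left ℂ fun c => ?_
  have e : f (MinTensor.tmul 1 (star c)) = inner ℂ (gnsVec h c) ξ := by
    change ((gns h).prod (gns h)).coeff _ _ _ = _
    rw [coeff_prod_tmul, coeff_gnsVec_one, h1, one_mul, ← mul_one (star c), coeff_mul_left,
      star_star, coeff_one, ← gnsVec_eq_rep]
  rw [← inner_conj_symm, ← e, hf, zero_apply, map_zero]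

end CompactQuantumGroup

/-! ### Finite-dimensional representations inside the regular representation -/

namespace CompactQuantumGroup

open HilbertRep

variable {A : Type u} [CStarAlgebra A] [PartialOrder A] [StarOrderedRing A]
variable {G : CompactQuantumGroup A} {h : A →ₚ[ℂ] ℂ} {n : ℕ}

/-- The matrix `v` with `Δ(w j) = ∑ k, v j k ⊗ w k` for an invariant orthonormal family `w`. -/
def coeffMatrix (G : CompactQuantumGroup A) (h : A →ₚ[ℂ] ℂ) (w : Fin n → A) :
    Matrix (Fin n) (Fin n) A :=
  Matrix.of fun j k => G.convR (gns h) (gnsVec h (w k)) (gnsVec h 1) (w j)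

/-- An orthonormal family in `L²(G)`, with members in `C(G)`, whose span is invariant under the
left convolution operators. -/
structure IsInvariantFamily (G : CompactQuantumGroup A) (h : A →ₚ[ℂ] ℂ) (w : Fin n → A) :
    Prop where
  orthonormal : ∀ i j, h (star (w i) * w j) = if i = j then 1 else 0
  convL_eq : ∀ (π : HilbertRep A) (x y : π.space) (j : Fin n),
    G.convL π x y (w j) = ∑ k, π.coeff x y (G.coeffMatrix h w j k) • w k

namespace IsInvariantFamily

variable {w : Fin n → A}

lemma comul_eq (hw : G.IsInvariantFamily h w) (j : Fin n) :
    G.comul (w j) = ∑ k, MinTensor.tmul (G.coeffMatrix h w j k) (w k) := by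
  refine eq_of_sliceL fun π x y => ?_
  rw [← convL_apply, hw.convL_eq, map_sum]
  exact Finset.sum_congr rfl fun k _ => (sliceL_tmul _ _ _ _ _).symm

/-- The entries are right convolutions of the `w i`, so left slices of their coproducts can be
computed by letting left convolution act on `w i` first. -/
lemma comul_coeffMatrix (hw : G.IsInvariantFamily h w) (i j : Fin n) :
    G.comul (G.coeffMatrix h w i j)
      = ∑ k, MinTensor.tmul (G.coeffMatrix h w i k) (G.coeffMatrix h w k j) := by
  refine eq_of_sliceL fun π x y => ?_
  have e : π.sliceL x y (G.comul (G.coeffMatrix h w i j))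
      = G.convL π x y (G.convR (gns h) (gnsVec h (w j)) (gnsVec h 1) (w i)) := rfl
  rw [e, convL_convR, hw.convL_eq, map_sum, map_sum]
  refine Finset.sum_congr rfl fun k _ => ?_
  rw [sliceL_tmul, map_smul]
  rfl

-- Apply `(id ⊗ h) Δ` to `w_i w_j*`. Traciality makes the `w_k*` orthonormal as well, so the left
-- leg collapses to `∑ v_ik v_jk*`, and invariance equates it with `h(w_i w_j*) 1`.
open Matrix in
lemma coeffMatrix_mul_conjTranspose (hw : G.IsInvariantFamily h w) (hh : G.IsHaarState h)
    (ht : IsTracialState h) : G.coeffMatrix h w * (G.coeffMatrix h w)ᴴ = 1 := by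
  ext i j
  have hort : ∀ k l, h (w k * star (w l)) = if l = k then 1 else 0 := fun k l => by
    rw [ht.map_mul_comm, hw.orthonormal]
  have e := hh.stateSliceR_comul (w i * star (w j))
  rw [map_mul, map_star, hw.comul_eq, hw.comul_eq, star_sum, Finset.sum_mul_sum, map_sum,
    hort] at e
  have e' : ∀ k, stateSliceR h (∑ l, MinTensor.tmul (G.coeffMatrix h w i k) (w k)
      * star (MinTensor.tmul (G.coeffMatrix h w j l) (w l)))
      = G.coeffMatrix h w i k * star (G.coeffMatrix h w j k) := fun k => by
    rw [map_sum, Finset.sum_eq_single k]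
    · rw [MinTensor.star_tmul, MinTensor.tmul_mul_tmul, stateSliceR_tmul, hort, if_pos rfl,
        one_smul]
    · intro l _ hl
      rw [MinTensor.star_tmul, MinTensor.tmul_mul_tmul, stateSliceR_tmul, hort, if_neg hl,
        zero_smul]
    · exact fun hk => absurd (Finset.mem_univ k) hk
  rw [Finset.sum_congr rfl fun k _ => e' k] at e
  rw [Matrix.mul_apply, Matrix.one_apply]
  refine e.trans ?_
  by_cases hij : i = j
  · rw [if_pos hij, if_pos hij.symm, one_smul]
  · rw [if_neg hij, if_neg (Ne.symm hij), zero_smul]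

end IsInvariantFamily

lemma apply_eq_zero_of_apply_star_mul_self {a : A} (ha : h (star a * a) = 0) : h a = 0 := by
  have e : gnsVec h a = 0 := by
    have := norm_gnsVec_sq h a
    rw [ha, Complex.ofReal_eq_zero] at this
    exact norm_eq_zero.mp (pow_eq_zero_iff two_ne_zero |>.mp this)
  rw [← coeff_gnsVec_one, coeff_apply, ← gnsVec_eq_rep, e, inner_zero_right]

open Matrix in
/-- For a tracial Haar state, a matrix corepresentation which is a coisometry is unitary. -/
lemma IsHaarState.conjTranspose_mul_self (hh : G.IsHaarState h) (ht : IsTracialState h)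
    {v : Matrix (Fin n) (Fin n) A}
    (hv : ∀ i j, G.comul (v i j) = ∑ k, MinTensor.tmul (v i k) (v k j)) (hv1 : v * vᴴ = 1) :
    vᴴ * v = 1 := by
  set q : Matrix (Fin n) (Fin n) A := 1 - vᴴ * v with hq
  have hqs : qᴴ = q := by
    rw [hq, conjTranspose_sub, conjTranspose_one, conjTranspose_mul, conjTranspose_conjTranspose]
  have hqq : qᴴ * q = q := by
    rw [hqs, hq, sub_mul, one_mul, mul_sub, mul_one, Matrix.mul_assoc,
      ← Matrix.mul_assoc v, hv1, Matrix.one_mul, sub_self, sub_zero]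
  have hdiag : ∀ i, q i i = ∑ k, star (q k i) * q k i := fun i => by
    conv_lhs => rw [← hqq]
    rw [Matrix.mul_apply]
    rfl
  -- The projection `q = 1 - v* v` has trace zero, since traciality gives `v* v` and `v v* = 1` the
  -- same total trace. As `h` need not be faithful, this yields only `h(q_ij) = 0`, not `q = 0`.
  have htr : ∑ i, h (q i i) = 0 := by
    have e1 : ∀ i, h (q i i) = 1 - ∑ k, h (v k i * star (v k i)) := fun i => by
      rw [hq, Matrix.sub_apply, Matrix.one_apply_eq, map_sub, hh.map_one, Matrix.mul_apply, map_sum]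
      exact congrArg _ (Finset.sum_congr rfl fun k _ => ht.map_mul_comm _ _)
    have e2 : ∀ k, ∑ i, h (v k i * star (v k i)) = 1 := fun k => by
      have := congrFun (congrFun hv1 k) k
      rw [Matrix.mul_apply, Matrix.one_apply_eq] at this
      rw [← map_sum, ← hh.map_one, ← this]
      rfl
    rw [Finset.sum_congr rfl fun i _ => e1 i, Finset.sum_sub_distrib, Finset.sum_comm,
      Finset.sum_congr rfl fun k _ => e2 k, sub_self]
  have hpos : ∀ k i, 0 ≤ h (star (q k i) * q k i) := fun k i => by
    rw [← map_zero h]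
    exact OrderHomClass.mono h (star_mul_self_nonneg _)
  have hzero : ∀ k i, h (star (q k i) * q k i) = 0 := by
    have e : ∑ i, ∑ k, h (star (q k i) * q k i) = 0 := by
      rw [← htr]
      exact Finset.sum_congr rfl fun i _ => by rw [hdiag i, map_sum]
    intro k i
    have e' := (Finset.sum_eq_zero_iff_of_nonneg
      fun i _ => Finset.sum_nonneg fun k _ => hpos k i).mp e i (Finset.mem_univ i)
    exact (Finset.sum_eq_zero_iff_of_nonneg fun k _ => hpos k i).mp e' k (Finset.mem_univ k)
  have hp : ∀ i j, h ((vᴴ * v) i j) = if i = j then 1 else 0 := fun i j => by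
    have e : vᴴ * v = 1 - q := by rw [hq, sub_sub_cancel]
    rw [e, Matrix.sub_apply, map_sub, apply_eq_zero_of_apply_star_mul_self (hzero i j), sub_zero,
      Matrix.one_apply, apply_ite h, hh.map_one, map_zero]
  ext i j
  -- Invariance replaces faithfulness: integrating the left leg of `Δ((v* v)_ij)`, where `h` of the
  -- entries is already known to be `δ`, returns `(v* v)_ij` itself, so it is the scalar `δ_ij`.
  have hD : G.comul ((vᴴ * v) i j)
      = ∑ a, ∑ b, MinTensor.tmul ((vᴴ * v) a b) (star (v a i) * v b j) := by
    have e1 : ∀ k, G.comul (star (v k i) * v k j) = ∑ a, ∑ b,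
        MinTensor.tmul (star (v k a) * v k b) (star (v a i) * v b j) := fun k => by
      rw [map_mul, map_star, hv, hv, star_sum, Finset.sum_mul_sum]
      exact Finset.sum_congr rfl fun a _ => Finset.sum_congr rfl fun b _ => by
        rw [MinTensor.star_tmul, MinTensor.tmul_mul_tmul]
    rw [Matrix.mul_apply, map_sum]
    refine (Finset.sum_congr rfl fun k _ => e1 k).trans ?_
    rw [Finset.sum_comm]
    refine Finset.sum_congr rfl fun a _ => ?_
    rw [Finset.sum_comm]
    refine Finset.sum_congr rfl fun b _ => ?_
    rw [Matrix.mul_apply, MinTensor.sum_tmul]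
    rfl
  have e := hh.stateSliceL_comul ((vᴴ * v) i j)
  rw [hD, map_sum, hp] at e
  have e' : ∀ a, stateSliceL h (∑ b, MinTensor.tmul ((vᴴ * v) a b) (star (v a i) * v b j))
      = star (v a i) * v a j := fun a => by
    rw [map_sum, Finset.sum_eq_single a]
    · rw [stateSliceL_tmul, hp, if_pos rfl, one_smul]
    · intro b _ hb
      rw [stateSliceL_tmul, hp, if_neg (Ne.symm hb), zero_smul]
    · exact fun ha => absurd (Finset.mem_univ a) ha
  rw [Finset.sum_congr rfl fun a _ => e' a] at e
  rw [Matrix.mul_apply, Matrix.one_apply]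
  refine e.trans ?_
  rw [ite_smul, one_smul, zero_smul]

lemma IsInvariantFamily.isRep {w : Fin n → A} (hw : G.IsInvariantFamily h w)
    (hh : G.IsHaarState h) (ht : IsTracialState h) : G.IsRep (G.coeffMatrix h w) where
  isUnit := ⟨⟨_, _, hw.coeffMatrix_mul_conjTranspose hh ht, hh.conjTranspose_mul_self ht
    hw.comul_coeffMatrix (hw.coeffMatrix_mul_conjTranspose hh ht)⟩, rfl⟩
  comul_apply := hw.comul_coeffMatrix

lemma isRep_one {C : Type u} [CStarAlgebra C] (G : CompactQuantumGroup C) :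
    G.IsRep (1 : Matrix (Fin 1) (Fin 1) C) where
  isUnit := isUnit_one
  comul_apply i j := by
    rw [Fin.sum_univ_one, Subsingleton.elim i 0, Subsingleton.elim j 0, Matrix.one_apply_eq,
      map_one, MinTensor.tmul_one_one]

/-- A row vector of scalars intertwines `u` with the trivial representation iff it is fixed. -/
lemma _root_.mem_intertwiners_one_iff {B : Type u} [CStarAlgebra B] {u : Matrix (Fin n) (Fin n) B}
    {c : Fin n → ℂ} : Matrix.of (fun _ => c) ∈ intertwiners u (1 : Matrix (Fin 1) (Fin 1) B) ↔
      ∀ k, ∑ j, c j • u j k = c k • (1 : B) := by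
  change (Matrix.of fun _ => c).map (algebraMap ℂ B) * u
    = 1 * (Matrix.of fun _ => c).map (algebraMap ℂ B) ↔ _
  rw [Matrix.one_mul, ← Matrix.ext_iff]
  simp only [Fin.forall_fin_one, Matrix.mul_apply, Matrix.map_apply, Matrix.of_apply,
    Algebra.algebraMap_eq_smul_one, smul_mul_assoc, one_mul]

/-- The generation hypothesis is only needed for morphisms from `v` to the trivial one-dimensional
representation. -/
lemma IsGeneratedBy.sum_smul_eq {A A₁ A₂ : Type u} [CStarAlgebra A] [CStarAlgebra A₁]
    [CStarAlgebra A₂] {G : CompactQuantumGroup A}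
    {π₁ : A →⋆ₐ[ℂ] A₁} {π₂ : A →⋆ₐ[ℂ] A₂} (hG : G.IsGeneratedBy π₁ π₂)
    {v : Matrix (Fin n) (Fin n) A} (hv : G.IsRep v) {c : Fin n → ℂ}
    (h₁ : ∀ k, ∑ j, c j • π₁ (v j k) = c k • (1 : A₁))
    (h₂ : ∀ k, ∑ j, c j • π₂ (v j k) = c k • (1 : A₂)) (k : Fin n) :
    ∑ j, c j • v j k = c k • (1 : A) := by
  refine mem_intertwiners_one_iff.mp ?_ k
  rw [hG n 1 v 1 hv G.isRep_one]
  refine ⟨?_, ?_⟩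
  · rw [Matrix.map_one _ (map_zero π₁) (map_one π₁)]
    exact mem_intertwiners_one_iff.mpr h₁
  · rw [Matrix.map_one _ (map_zero π₂) (map_one π₂)]
    exact mem_intertwiners_one_iff.mpr h₂

/-! ### Fixed vectors of a quantum subgroup -/

section Subgroup

variable {B : Type u} [CStarAlgebra B] [PartialOrder B] [StarOrderedRing B]

/-- The pullback of a positive functional along a `*`-homomorphism. -/
def _root_.PositiveLinearMap.pullback (k : B →ₚ[ℂ] ℂ) (f : A →⋆ₐ[ℂ] B) : A →ₚ[ℂ] ℂ :=
  PositiveLinearMap.mk₀ (k.toLinearMap ∘ₗ f.toAlgHom.toLinearMap) fun a ha => by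
    obtain ⟨b, rfl⟩ := exists_eq_star_mul_self ha
    change 0 ≤ k (f (star b * b))
    rw [map_mul, map_star, ← map_zero k]
    exact OrderHomClass.mono k (star_mul_self_nonneg _)

lemma _root_.PositiveLinearMap.pullback_apply (k : B →ₚ[ℂ] ℂ) (f : A →⋆ₐ[ℂ] B) (a : A) :
    k.pullback f a = k (f a) := rfl

variable {K : CompactQuantumGroup B} {k : B →ₚ[ℂ] ℂ}

/-- Being fixed on average implies being fixed. With `g_l = ∑ c_j f(v_jl)` one has `Δ(g_l) = ∑ g_m ⊗
f(v_ml)`; integrating the left leg with `k(g_m) = c_m` returns `g_l`, while invariance gives `c_l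
1`. -/
lemma IsHaarState.sum_smul_eq {C : Type u} [CStarAlgebra C] {G : CompactQuantumGroup C}
    {f : C →⋆ₐ[ℂ] B} (hk : K.IsHaarState k) (hf : G.IsQuantumSubgroup K f)
    {v : Matrix (Fin n) (Fin n) C} (hv : ∀ i j, G.comul (v i j) = ∑ k, MinTensor.tmul (v i k) (v k j)) {c : Fin n → ℂ}
    (hc : ∀ l, ∑ j, c j * k (f (v j l)) = c l) (l : Fin n) :
    ∑ j, c j • f (v j l) = c l • (1 : B) := by
  set g : Fin n → B := fun l => ∑ j, c j • f (v j l) with hg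
  have hkg : ∀ l, k (g l) = c l := fun l => by
    rw [← hc l, hg, map_sum]
    exact Finset.sum_congr rfl fun j _ => by rw [map_smul, smul_eq_mul]
  have hD : K.comul (g l) = ∑ m, MinTensor.tmul (g m) (f (v m l)) := by
    have e : ∀ j, K.comul (c j • f (v j l))
        = ∑ m, MinTensor.tmul (c j • f (v j m)) (f (v m l)) := fun j => by
      rw [map_smul, ← hf.map_comul, hv, map_sum, Finset.smul_sum]
      exact Finset.sum_congr rfl fun m _ => by rw [MinTensor.map_tmul, MinTensor.smul_tmul']
    rw [hg, map_sum]
    refine (Finset.sum_congr rfl fun j _ => e j).trans ?_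
    rw [Finset.sum_comm]
    exact Finset.sum_congr rfl fun m _ => (MinTensor.sum_tmul _ _ _).symm
  have e := hk.stateSliceL_comul (g l)
  rw [hD, map_sum, hkg] at e
  rw [← e]
  exact Finset.sum_congr rfl fun m _ => by rw [stateSliceL_tmul, hkg]

end Subgroup

end CompactQuantumGroup

/-! ### Alternating projections -/

section AlternatingProjections

variable {H : Type*} [NormedAddCommGroup H] [InnerProductSpace ℂ H] [CompleteSpace H]

/-- Expand `‖T* x - x‖² = ‖T* x‖² - 2 Re ⟨T* x, x⟩ + ‖x‖²`; the middle inner product is `‖x‖²` and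
`‖T* x‖ ≤ ‖x‖`. -/
lemma ContinuousLinearMap.adjoint_apply_eq_of_contraction {T : H →L[ℂ] H} (hT : ∀ x, ‖T x‖ ≤ ‖x‖)
    {x : H} (hx : T x = x) : T.adjoint x = x := by
  have hT' : ‖T.adjoint x‖ ≤ ‖x‖ := by
    refine ((T.adjoint).le_opNorm x).trans ?_
    rw [LinearIsometryEquiv.norm_map]
    exact (mul_le_mul_of_nonneg_right (T.opNorm_le_bound zero_le_one fun x => by
      rw [one_mul]; exact hT x) (norm_nonneg x)).trans_eq (one_mul _)
  have e : RCLike.re (inner ℂ (T.adjoint x) x) = ‖x‖ ^ 2 := by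
    rw [ContinuousLinearMap.adjoint_inner_left, hx, inner_self_eq_norm_sq]
  have h2 := norm_sub_sq (𝕜 := ℂ) (T.adjoint x) x
  rw [e] at h2
  rw [← sub_eq_zero, ← norm_eq_zero]
  have := norm_nonneg (T.adjoint x)
  nlinarith [norm_nonneg (T.adjoint x - x)]

/-- A contractive idempotent is an orthogonal projection. -/
lemma ContinuousLinearMap.isSymmetric_of_contraction {E : H →L[ℂ] H} (hE : ∀ x, ‖E x‖ ≤ ‖x‖)
    (hEE : ∀ x, E (E x) = E x) : E.IsSymmetric := by
  -- The adjoint fixes the range of `E`, so `E` equals the self-adjoint `E* E`.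
  have e : star E * E = E :=
    ContinuousLinearMap.ext fun x => ContinuousLinearMap.adjoint_apply_eq_of_contraction hE (hEE x)
  have : IsSelfAdjoint E := e ▸ IsSelfAdjoint.star_mul_self E
  exact this.isSymmetric

lemma norm_sub_sq_of_isSymmetric {H : Type*} [NormedAddCommGroup H] [InnerProductSpace ℂ H]
    {E : H →L[ℂ] H} (hE : E.IsSymmetric)
    (hEE : ∀ x, E (E x) = E x) (x : H) : ‖x - E x‖ ^ 2 = ‖x‖ ^ 2 - ‖E x‖ ^ 2 := by
  have e : inner ℂ x (E x) = inner ℂ (E x) (E x) :=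
    (congrArg (inner ℂ x) (hEE x)).symm.trans (hE x (E x)).symm
  have h2 := norm_sub_sq (𝕜 := ℂ) x (E x)
  rw [e, inner_self_eq_norm_sq] at h2
  linarith

/-- Von Neumann's alternating projections, when the ranges of the two projections meet in the line
spanned by a unit vector. -/
lemma tendsto_alternating {E F : H →L[ℂ] H} (hE : E.IsSymmetric) (hF : F.IsSymmetric)
    (hEE : ∀ x, E (E x) = E x) (hFF : ∀ x, F (F x) = F x) {Ω : H} (hΩ : ‖Ω‖ = 1)
    (hEΩ : E Ω = Ω) (hFΩ : F Ω = Ω)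
    (hfix : ∀ x, E x = x → F x = x → inner ℂ Ω x = 0 → x = 0) (x : H) :
    Tendsto (fun n : ℕ => ((E * F * E) ^ n) x) atTop (𝓝 (inner ℂ Ω x • Ω)) := by
  set T := E * F * E with hT
  have hTapp : ∀ x, T x = E (F (E x)) := fun x => rfl
  have contr : ∀ {P : H →L[ℂ] H}, P.IsSymmetric → (∀ x, P (P x) = P x) → ∀ x, ‖P x‖ ≤ ‖x‖ := by
    intro P hP hPP x
    have := norm_sub_sq_of_isSymmetric hP hPP x
    nlinarith [sq_nonneg ‖x - P x‖, norm_nonneg x, norm_nonneg (P x)]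
  have hle : ∀ x, ‖T x‖ ≤ ‖x‖ := fun x =>
    (contr hE hEE _).trans ((contr hF hFF _).trans (contr hE hEE x))
  have hpow : ∀ n x, ‖(T ^ n) x‖ ≤ ‖x‖ := by
    intro n
    induction n with
    | zero => exact fun x => le_rfl
    | succ n ih => exact fun x => (ih (T x)).trans (hle x)
  have hsucc : ∀ n x, (T ^ (n + 1)) x = T ((T ^ n) x) := fun n x => by
    rw [pow_succ']
    rfl
  -- Pythagoras for each of the three projections makes the squared increments telescope; the factor
  -- `3` is from `(a + b + c)² ≤ 3 (a² + b² + c²)`.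
  have hdecr : ∀ x, ‖x - T x‖ ^ 2 ≤ 3 * (‖x‖ ^ 2 - ‖T x‖ ^ 2) := by
    intro x
    have h1 := norm_sub_sq_of_isSymmetric hE hEE x
    have h2 := norm_sub_sq_of_isSymmetric hF hFF (E x)
    have h3 := norm_sub_sq_of_isSymmetric hE hEE (F (E x))
    rw [← hTapp] at h3
    have h4 : ‖x - T x‖ ≤ ‖x - E x‖ + ‖E x - F (E x)‖ + ‖F (E x) - T x‖ := by
      have : x - T x = (x - E x) + (E x - F (E x)) + (F (E x) - T x) := by abel
      rw [this]
      exact norm_add₃_le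
    have h5 : ‖x - T x‖ ^ 2 ≤ (‖x - E x‖ + ‖E x - F (E x)‖ + ‖F (E x) - T x‖) ^ 2 :=
      pow_le_pow_left₀ (norm_nonneg _) h4 2
    nlinarith [sq_nonneg (‖x - E x‖ - ‖E x - F (E x)‖), sq_nonneg (‖x - E x‖ - ‖F (E x) - T x‖),
      sq_nonneg (‖E x - F (E x)‖ - ‖F (E x) - T x‖)]
  -- The squared norms `‖Tⁿ x‖²` decrease to a limit, so their successive differences, which control
  -- the increments, tend to `0`.
  have hdiff : ∀ x, Tendsto (fun n => (T ^ n) (x - T x)) atTop (𝓝 0) := by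
    intro x
    have hanti : Antitone fun n => ‖(T ^ n) x‖ ^ 2 := antitone_nat_of_succ_le fun n => by
      rw [hsucc]
      exact pow_le_pow_left₀ (norm_nonneg _) (hle _) 2
    have hlim := tendsto_atTop_ciInf hanti ⟨0, by rintro _ ⟨n, rfl⟩; positivity⟩
    have hlim' := ((hlim.sub (hlim.comp (tendsto_add_atTop_nat 1))).const_mul 3)
    rw [sub_self, mul_zero] at hlim'
    have hsq : Tendsto (fun n => ‖(T ^ n) (x - T x)‖ ^ 2) atTop (𝓝 0) := by
      refine squeeze_zero (fun n => sq_nonneg _) (fun n => ?_) hlim'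
      have e : (T ^ n) (x - T x) = (T ^ n) x - T ((T ^ n) x) := by
        rw [map_sub, ← hsucc, pow_succ]
        rfl
      rw [e]
      refine (hdecr _).trans_eq ?_
      rw [← hsucc]
      rfl
    have := hsq.sqrt
    simp only [Real.sqrt_sq (norm_nonneg _), Real.sqrt_zero] at this
    exact tendsto_zero_iff_norm_tendsto_zero.mpr this
  have hTΩ : T Ω = Ω := by rw [hTapp, hEΩ, hFΩ, hEΩ]
  have hpowΩ : ∀ n, (T ^ n) Ω = Ω := by
    intro n
    induction n with
    | zero => rfl
    | succ n ih => rw [hsucc, ih, hTΩ]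
  -- The powers of `T` tend to `0` on the range of `1 - T`. Its orthogonal complement is the fixed
  -- space of `T`, which is shown to be the line of `Ω`; so the component of `x` orthogonal to `Ω`
  -- is in the closure of that range.
  have hmem : x - inner ℂ Ω x • Ω ∈ ((1 - T : H →L[ℂ] H).range)ᗮᗮ := by
    intro y hy
    have hy' : T y = y := by
      have e : inner ℂ (y - T y) (y - T y) = 0 := by
        have hs : inner ℂ (T y) (y - T y) = inner ℂ y (T (y - T y)) := by
          rw [hTapp, hTapp, hE.apply_clm, hF.apply_clm, hE.apply_clm]
        rw [inner_sub_left, hs, ← inner_sub_right]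
        exact (inner_eq_zero_symm.mp (hy ((1 - T) (y - T y)) ⟨_, rfl⟩))
      exact (sub_eq_zero.mp (inner_self_eq_zero.mp e)).symm
    have hEy : E y = y := by
      rw [← hy', hTapp, hEE]
    -- With `E y = y`, the equation `y = E (F y)` forces `‖F y‖ = ‖y‖`, and a projection preserves
    -- the norm only of vectors it fixes.
    have hFy : F y = y := by
      have e1 : ‖F y‖ = ‖y‖ := le_antisymm (contr hF hFF y) (by
        conv_lhs => rw [← hy', hTapp, hEy]
        exact contr hE hEE _)
      have := norm_sub_sq_of_isSymmetric hF hFF y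
      rw [e1, sub_self] at this
      exact (sub_eq_zero.mp (norm_eq_zero.mp (pow_eq_zero_iff two_ne_zero |>.mp this))).symm
    have hΩΩ : inner ℂ Ω Ω = (1 : ℂ) := by
      rw [inner_self_eq_norm_sq_to_K, hΩ]
      simp
    have hyΩ : y - inner ℂ Ω y • Ω = 0 := by
      refine hfix _ ?_ ?_ ?_
      · rw [map_sub, map_smul, hEy, hEΩ]
      · rw [map_sub, map_smul, hFy, hFΩ]
      · rw [inner_sub_right, inner_smul_right, hΩΩ, mul_one, sub_self]
    rw [sub_eq_zero.mp hyΩ, inner_smul_left, inner_sub_right, inner_smul_right, hΩΩ, mul_one,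
      sub_self, mul_zero]
  rw [Submodule.orthogonal_orthogonal_eq_closure] at hmem
  have h0 : Tendsto (fun n => (T ^ n) (x - inner ℂ Ω x • Ω)) atTop (𝓝 0) := by
    rw [Metric.tendsto_atTop]
    intro ε hε
    obtain ⟨_, ⟨z, rfl⟩, hz⟩ := Metric.mem_closure_iff.mp hmem (ε / 2) (half_pos hε)
    obtain ⟨N, hN⟩ := Metric.tendsto_atTop.mp (hdiff z) (ε / 2) (half_pos hε)
    refine ⟨N, fun n hn => ?_⟩
    have h1 := hN n hn
    rw [dist_zero_right] at h1 ⊢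
    rw [dist_eq_norm] at hz
    have e : (T ^ n) (x - inner ℂ Ω x • Ω)
        = (T ^ n) (x - inner ℂ Ω x • Ω - (1 - T : H →L[ℂ] H) z) + (T ^ n) (z - T z) := by
      rw [← map_add]
      congr 1
      change _ = x - inner ℂ Ω x • Ω - (z - T z) + (z - T z)
      abel
    rw [e]
    calc _ ≤ _ := norm_add_le _ _
      _ < ε / 2 + ε / 2 := add_lt_add_of_le_of_lt ((hpow n _).trans hz.le) h1
      _ = ε := add_halves ε
  have e : (fun n => (T ^ n) x)
      = fun n => (T ^ n) (x - inner ℂ Ω x • Ω) + inner ℂ Ω x • Ω := by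
    funext n
    rw [map_sub, map_smul, hpowΩ, sub_add_cancel]
  rw [e]
  simpa using h0.add_const (inner ℂ Ω x • Ω)

/-- A compact symmetric operator without nonzero eigenvalues on an invariant closed subspace
vanishes there. -/
lemma eqOn_zero_of_forall_eigenvector {X : H →L[ℂ] H} (hX : IsCompactOperator X)
    (hXs : X.IsSymmetric) {N : Submodule ℂ H} (hN : IsClosed (N : Set H))
    (hinv : ∀ x ∈ N, X x ∈ N)
    (heig : ∀ r : ℂ, r ≠ 0 → ∀ x ∈ N, X x = r • x → x = 0) {x : H} (hx : x ∈ N) : X x = 0 := by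
  have : CompleteSpace N := hN.completeSpace_coe
  let Y : N →L[ℂ] N := (X.comp N.subtypeL).codRestrict N fun y => hinv y y.2
  have hY : IsCompactOperator Y := (hX.comp_clm N.subtypeL).codRestrict (fun y => hinv y y.2) hN
  have hYs : Y.IsSymmetric := fun y z => hXs y z
  have h0 : Y = 0 := by
    refine (ContinuousLinearMap.eq_zero_of_forall_hasEigenvalue_eq_zero hY hYs).mp fun r hr => ?_
    by_contra hr0
    obtain ⟨y, hy, hy0⟩ := hr.exists_hasEigenvector
    have hy' := congrArg (Subtype.val) (Module.End.mem_eigenspace_iff.mp hy)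
    exact hy0 (Subtype.ext (heig r hr0 y y.2 hy'))
  exact congrArg Subtype.val (DFunLike.congr_fun h0 ⟨x, hx⟩)

end AlternatingProjections

/-! ### The Haar state as a limit of convolution products -/

namespace CompactQuantumGroup

open HilbertRep

variable {A : Type u} [CStarAlgebra A] [PartialOrder A] [StarOrderedRing A]
variable {G : CompactQuantumGroup A} {h : A →ₚ[ℂ] ℂ}

/-- The eigenspaces of the smoothing operators for nonzero eigenvalues are spanned by invariant
families. -/
lemma IsHaarState.exists_isInvariantFamily (hh : G.IsHaarState h) (a : A) {r : ℂ} (hr : r ≠ 0) :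
    ∃ (n : ℕ) (w : Fin n → A), G.IsInvariantFamily h w ∧
      ∀ ζ, G.smoothingOp h a ζ = r • ζ → ∃ c : Fin n → ℂ, ζ = ∑ j, c j • gnsVec h (w j) := by
  have hfin := ContinuousLinearMap.finite_dimensional_eigenspace
    (isCompactOperator_smoothingOp (G := G) (h := h) a) r hr
  set W := Module.End.eigenspace (G.smoothingOp h a).toLinearMap r with hW
  have hmem : ∀ ζ, ζ ∈ W ↔ G.smoothingOp h a ζ = r • ζ := fun ζ => Module.End.mem_eigenspace_iff
  let e := stdOrthonormalBasis ℂ W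
  -- For a nonzero eigenvalue an eigenvector is `r⁻¹` times its smoothing, and smoothing takes
  -- values in `A`: this picks actual elements of `C(G)` representing the eigenvectors.
  let w : Fin (Module.finrank ℂ W) → A := fun j => r⁻¹ • G.smoothing h a (e j : (gns h).space)
  have hw : ∀ j, gnsVec h (w j) = e j := fun j => by
    change gnsVec h (r⁻¹ • G.smoothing h a (e j : (gns h).space)) = _
    rw [map_smul, ← smoothingOp_apply, (hmem _).mp (e j).2, smul_smul, inv_mul_cancel₀ hr, one_smul]
  have hexp : ∀ ζ ∈ W, ζ = ∑ j, inner ℂ (gnsVec h (w j)) ζ • gnsVec h (w j) := fun ζ hζ => by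
    have := congrArg Subtype.val (e.sum_repr' ⟨ζ, hζ⟩)
    rw [Submodule.coe_sum] at this
    refine this.symm.trans (Finset.sum_congr rfl fun j _ => ?_)
    rw [hw]
    rfl
  refine ⟨_, w, ⟨fun i j => ?_, fun π x y j => ?_⟩, fun ζ hζ => ⟨_, hexp ζ ((hmem ζ).mpr hζ)⟩⟩
  · rw [← inner_gnsVec, hw, hw]
    exact orthonormal_iff_ite.mp e.orthonormal i j
  · set z := G.convL π x y (w j) with hz
    have hR : ∀ c, G.smoothing h a (gnsVec h c)
        = G.convR (gns h) (G.smoothingVec h a) (gnsVec h 1) c := hh.smoothing_gnsVec a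
    have hzr : G.smoothing h a (gnsVec h z) = r • z := by
      rw [hR, hz, ← convL_convR, ← hR, hw, ← map_smul]
      change _ = G.convL π x y (r • r⁻¹ • G.smoothing h a (e j : (gns h).space))
      rw [smul_smul, mul_inv_cancel₀ hr, one_smul]
    have hzW : gnsVec h z ∈ W := by
      rw [hmem, smoothingOp_apply, hzr, map_smul]
    have hcoef : ∀ k, inner ℂ (gnsVec h (w k)) (gnsVec h z)
        = π.coeff x y (G.coeffMatrix h w j k) := fun k => by
      rw [inner_gnsVec_right, hz, coeff_convL]
      rfl
    -- The expansion of `z` must hold in `A`, where equality of GNS vectors is not enough since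
    -- `gnsVec h` need not be injective. Smoothing transports it from `L²(G)` back to `A`.
    have hz1 : z = r⁻¹ • G.smoothing h a (gnsVec h z) := by
      rw [hzr, smul_smul, inv_mul_cancel₀ hr, one_smul]
    rw [hz1, hexp _ hzW, map_sum, Finset.smul_sum]
    refine Finset.sum_congr rfl fun k _ => ?_
    rw [map_smul, hcoef, smul_comm, hw]

lemma IsInvariantFamily.sum_smul_eq_sum_smul_iff {n : ℕ} {w : Fin n → A}
    (hw : G.IsInvariantFamily h w) {c d : Fin n → ℂ} :
    ∑ j, c j • gnsVec h (w j) = ∑ j, d j • gnsVec h (w j) ↔ c = d := by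
  refine ⟨fun e => ?_, fun e => by rw [e]⟩
  have ho : Orthonormal ℂ fun j => gnsVec h (w j) :=
    orthonormal_iff_ite.mpr fun i j => (inner_gnsVec h _ _).trans (hw.orthonormal i j)
  funext k
  have := congrArg (inner ℂ (gnsVec h (w k))) e
  rwa [ho.inner_right_fintype, ho.inner_right_fintype] at this

lemma IsInvariantFamily.convOp_sum {n : ℕ} {w : Fin n → A} (hw : G.IsInvariantFamily h w)
    (hh : G.IsHaarState h) {μ : A →ₚ[ℂ] ℂ} (h1 : μ 1 = 1) (c : Fin n → ℂ) :
    G.convOp h μ (∑ j, c j • gnsVec h (w j))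
      = ∑ k, (∑ j, c j * μ (G.coeffMatrix h w j k)) • gnsVec h (w k) := by
  have e : ∀ j, G.convOp h μ (c j • gnsVec h (w j))
      = ∑ k, (c j * μ (G.coeffMatrix h w j k)) • gnsVec h (w k) := fun j => by
    rw [map_smul, hh.convOp_gnsVec h1, conv_eq, hw.convL_eq, map_sum, Finset.smul_sum]
    exact Finset.sum_congr rfl fun k _ => by rw [map_smul, coeff_gnsVec_one, smul_smul]
  rw [map_sum, Finset.sum_congr rfl fun j _ => e j, Finset.sum_comm]
  exact Finset.sum_congr rfl fun k _ => Finset.sum_smul.symm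

/-! ### The projection on `L²(G)` attached to a quantum subgroup -/

section Subgroup

variable {B : Type u} [CStarAlgebra B] [PartialOrder B] [StarOrderedRing B]
variable {K : CompactQuantumGroup B} {f : A →⋆ₐ[ℂ] B} {k : B →ₚ[ℂ] ℂ}

lemma IsHaarState.pullback_one (hk : K.IsHaarState k) : k.pullback f 1 = 1 := by
  rw [PositiveLinearMap.pullback_apply, _root_.map_one f, hk.map_one]

/-- This is idempotence `μ * μ = μ` for `μ = k ∘ f`: applying `f` after `(μ ⊗ id) Δ_G` amounts to
`(k ⊗ id) Δ_K` after `f`, and left invariance of `k` makes the result scalar. -/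
lemma IsHaarState.pullback_conv (hk : K.IsHaarState k) (hf : G.IsQuantumSubgroup K f) (a : A) :
    k.pullback f (G.conv (k.pullback f) a) = k.pullback f a := by
  have e : f (stateSliceL (k.pullback f) (G.comul a))
      = stateSliceL k (MinTensor.map f f (G.comul a)) := by
    refine DFunLike.congr_fun (f := f.toCLM.comp (stateSliceL (k.pullback f)))
      (g := (stateSliceL k).comp (MinTensor.map f f).toCLM) ?_ (G.comul a)
    refine MinTensor.clm_ext fun p q => ?_
    change f (stateSliceL (k.pullback f) (MinTensor.tmul p q))
      = stateSliceL k (MinTensor.map f f (MinTensor.tmul p q))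
    rw [stateSliceL_tmul, MinTensor.map_tmul, stateSliceL_tmul, map_smul]
    rfl
  rw [PositiveLinearMap.pullback_apply, conv_apply, e, hf.map_comul, hk.stateSliceL_comul,
    map_smul, hk.map_one, smul_eq_mul, mul_one, PositiveLinearMap.pullback_apply]

lemma IsHaarState.conv_conv (hk : K.IsHaarState k) (hf : G.IsQuantumSubgroup K f) (a : A) :
    G.conv (k.pullback f) (G.conv (k.pullback f) a) = G.conv (k.pullback f) a :=
  eq_of_coeff fun σ v w => by
    rw [coeff_conv, ← conv_convR, hk.pullback_conv hf, coeff_conv]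

lemma IsHaarState.convOp_one (hh : G.IsHaarState h) {μ : A →ₚ[ℂ] ℂ} (h1 : μ 1 = 1) :
    G.convOp h μ (gnsVec h 1) = gnsVec h 1 := by
  rw [hh.convOp_gnsVec h1, conv_apply, _root_.map_one G.comul, ← MinTensor.tmul_one_one,
    stateSliceL_tmul, h1, one_smul]

lemma IsHaarState.convOp_convOp (hh : G.IsHaarState h) (hk : K.IsHaarState k)
    (hf : G.IsQuantumSubgroup K f) (ξ : (gns h).space) :
    G.convOp h (k.pullback f) (G.convOp h (k.pullback f) ξ) = G.convOp h (k.pullback f) ξ := by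
  refine (denseRange_gnsVec h).induction_on (p := fun ξ => G.convOp h (k.pullback f)
    (G.convOp h (k.pullback f) ξ) = G.convOp h (k.pullback f) ξ) ξ ?_ fun c => ?_
  · exact isClosed_eq (by fun_prop) (by fun_prop)
  · rw [hh.convOp_gnsVec hk.pullback_one, hh.convOp_gnsVec hk.pullback_one, hk.conv_conv hf]

lemma IsHaarState.isSymmetric_convOp (hh : G.IsHaarState h) (hk : K.IsHaarState k)
    (hf : G.IsQuantumSubgroup K f) : (G.convOp h (k.pullback f)).IsSymmetric :=
  ContinuousLinearMap.isSymmetric_of_contraction (hh.norm_convOp_le hk.pullback_one)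
    (hh.convOp_convOp hk hf)

end Subgroup

/-! ### Common fixed vectors of the two generating subgroups -/

section Generated

variable {A₁ A₂ : Type u} [CStarAlgebra A₁] [PartialOrder A₁] [StarOrderedRing A₁]
  [CStarAlgebra A₂] [PartialOrder A₂] [StarOrderedRing A₂]
variable {G₁ : CompactQuantumGroup A₁} {G₂ : CompactQuantumGroup A₂}
  {π₁ : A →⋆ₐ[ℂ] A₁} {π₂ : A →⋆ₐ[ℂ] A₂} {h₁ : A₁ →ₚ[ℂ] ℂ} {h₂ : A₂ →ₚ[ℂ] ℂ}

/-- An eigenvector of a smoothing operator that is invariant under both generating subgroups is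
invariant under `G`. -/
lemma IsGeneratedBy.exists_eq_smul_gnsVec_one (hG : G.IsGeneratedBy π₁ π₂)
    (hh : G.IsHaarState h) (ht : IsTracialState h) (hh₁ : G₁.IsHaarState h₁)
    (hh₂ : G₂.IsHaarState h₂) (hπ₁ : G.IsQuantumSubgroup G₁ π₁) (hπ₂ : G.IsQuantumSubgroup G₂ π₂)
    (a : A) {r : ℂ} (hr : r ≠ 0) {ζ : (gns h).space} (hζ : G.smoothingOp h a ζ = r • ζ)
    (hζ₁ : G.convOp h (h₁.pullback π₁) ζ = ζ) (hζ₂ : G.convOp h (h₂.pullback π₂) ζ = ζ) :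
    ∃ s : ℂ, ζ = s • gnsVec h 1 := by
  obtain ⟨n, w, hw, hspan⟩ := hh.exists_isInvariantFamily a hr
  obtain ⟨c, rfl⟩ := hspan ζ hζ
  rw [hw.convOp_sum hh hh₁.pullback_one, hw.sum_smul_eq_sum_smul_iff] at hζ₁
  rw [hw.convOp_sum hh hh₂.pullback_one, hw.sum_smul_eq_sum_smul_iff] at hζ₂
  have hfix := hG.sum_smul_eq (hw.isRep hh ht) (hh₁.sum_smul_eq hπ₁ hw.comul_coeffMatrix
    (congrFun hζ₁)) (hh₂.sum_smul_eq hπ₂ hw.comul_coeffMatrix (congrFun hζ₂))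
  have hc : (fun k => ∑ j, c j * h (G.coeffMatrix h w j k)) = c := funext fun k => by
    have := congrArg h (hfix k)
    rw [map_sum, map_smul, hh.map_one, smul_eq_mul, mul_one] at this
    rw [← this]
    exact Finset.sum_congr rfl fun j _ => by rw [map_smul, smul_eq_mul]
  -- Being fixed by `G`, the vector is also fixed by convolution with `h`, whose values are
  -- multiples of `gnsVec h 1`.
  have e := hw.convOp_sum hh hh.map_one c
  rw [hw.sum_smul_eq_sum_smul_iff.mpr hc] at e
  refine ⟨∑ j, c j * h (w j), ?_⟩
  rw [← e, map_sum, Finset.sum_smul]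
  exact Finset.sum_congr rfl fun j _ => by
    rw [map_smul, hh.convOp_gnsVec hh.map_one, hh.conv_self, map_smul, smul_smul]

/-- The common fixed vectors orthogonal to `gnsVec h 1` form a closed subspace `N` invariant under
all smoothing operators, because these are symmetric, commute with both projections and have `gnsVec
h 1` as an eigenvector. An eigenvector in `N` with nonzero eigenvalue would be a multiple of `gnsVec
h 1`, so these compact operators vanish on `N`, and they have no common kernel. -/
lemma IsGeneratedBy.eq_zero_of_fixed (hG : G.IsGeneratedBy π₁ π₂)
    (hh : G.IsHaarState h) (ht : IsTracialState h) (hh₁ : G₁.IsHaarState h₁)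
    (hh₂ : G₂.IsHaarState h₂) (hπ₁ : G.IsQuantumSubgroup G₁ π₁) (hπ₂ : G.IsQuantumSubgroup G₂ π₂)
    {ξ : (gns h).space} (hξ₁ : G.convOp h (h₁.pullback π₁) ξ = ξ)
    (hξ₂ : G.convOp h (h₂.pullback π₂) ξ = ξ) (hξ : inner ℂ (gnsVec h 1) ξ = 0) : ξ = 0 := by
  let N : Submodule ℂ (gns h).space :=
    (G.convOp h (h₁.pullback π₁) - 1).ker ⊓ (G.convOp h (h₂.pullback π₂) - 1).ker
      ⊓ (innerSL ℂ (gnsVec h 1)).ker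
  have hN : ∀ ζ, ζ ∈ N ↔ (G.convOp h (h₁.pullback π₁) ζ = ζ ∧ G.convOp h (h₂.pullback π₂) ζ = ζ)
      ∧ inner ℂ (gnsVec h 1) ζ = 0 := fun ζ => by
    change (_ - ζ = 0 ∧ _ - ζ = 0) ∧ _ = 0 ↔ _
    rw [sub_eq_zero, sub_eq_zero]
    rfl
  have hNc : IsClosed (N : Set (gns h).space) :=
    ((ContinuousLinearMap.isClosed_ker _).inter (ContinuousLinearMap.isClosed_ker _)).inter
      (ContinuousLinearMap.isClosed_ker _)
  refine eq_zero_of_smoothingOp_eq_zero (G := G) hh.map_one fun a =>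
    eqOn_zero_of_forall_eigenvector (isCompactOperator_smoothingOp a) (isSymmetric_smoothingOp a)
      hNc (fun ζ hζ => ?_) (fun r hr ζ hζ he => ?_) ((hN ξ).mpr ⟨⟨hξ₁, hξ₂⟩, hξ⟩)
  · obtain ⟨⟨e1, e2⟩, e3⟩ := (hN ζ).mp hζ
    refine (hN _).mpr ⟨⟨?_, ?_⟩, ?_⟩
    · rw [hh.convOp_smoothingOp hh₁.pullback_one, e1]
    · rw [hh.convOp_smoothingOp hh₂.pullback_one, e2]
    · obtain ⟨s, hs⟩ := hh.smoothingOp_one a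
      rw [← (isSymmetric_smoothingOp a).apply_clm, hs, inner_smul_left, e3, mul_zero]
  · obtain ⟨⟨e1, e2⟩, e3⟩ := (hN ζ).mp hζ
    obtain ⟨s, rfl⟩ := hG.exists_eq_smul_gnsVec_one hh ht hh₁ hh₂ hπ₁ hπ₂ a hr he e1 e2
    rw [inner_smul_right, inner_self_eq_norm_sq_to_K, norm_gnsVec_one hh.map_one] at e3
    have : s = 0 := by simpa using e3
    rw [this, zero_smul]

end Generated

lemma norm_conv_le {μ : A →ₚ[ℂ] ℂ} (h1 : μ 1 = 1) (a : A) : ‖G.conv μ a‖ ≤ ‖a‖ := by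
  refine (norm_sliceL_le _ _ _ _).trans ?_
  rw [norm_gnsVec_one h1, one_mul, one_mul]
  exact NonUnitalStarAlgHom.norm_apply_le G.comul a

/-- The composite is `(μ ⊗ ν) ∘ Δ`, a tensor product of matricial limits pulled back along the
`*`-homomorphism `Δ`. -/
lemma _root_.IsMatricialLimit.comp_conv {μ : A →ₚ[ℂ] ℂ} (hμ : IsMatricialLimit μ)
    {ν : A →L[ℂ] ℂ} (hν : IsMatricialLimit ν) : IsMatricialLimit (ν.comp (G.conv μ)) := by
  have := (hμ.tensor hν (ω := ν.comp (stateSliceL μ)) fun a b => by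
    change ν (stateSliceL μ (MinTensor.tmul a b)) = _
    rw [stateSliceL_tmul, map_smul, smul_eq_mul]).comp G.comul
  exact this

/-- Elements `(id ⊗ h)((1 ⊗ b) Δ(a))` span a dense subspace. -/
lemma IsHaarState.dense_span_convR (hh : G.IsHaarState h) :
    Dense (Submodule.span ℂ {x : A | ∃ b a : A,
      x = G.convR (gns h) (gnsVec h b) (gnsVec h 1) a} : Set A) := by
  -- The slice map `id ⊗ h` is onto since it sends `a ⊗ 1` to `a`, so it carries the dense span of
  -- `(1 ⊗ A) Δ(A)` to a dense subspace.
  have hsurj : Function.Surjective (stateSliceR (B := A) h) := fun a =>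
    ⟨MinTensor.tmul a 1, by rw [stateSliceR_tmul, hh.map_one, one_smul]⟩
  have hd := hsurj.denseRange.dense_image (stateSliceR h).continuous G.dense_one_tmul_mul
  refine hd.mono ?_
  rintro _ ⟨z, hz, rfl⟩
  have hz' := Submodule.mem_map_of_mem (f := (stateSliceR (B := A) h).toLinearMap) hz
  rw [Submodule.map_span] at hz'
  refine Submodule.span_mono ?_ hz'
  rintro _ ⟨_, ⟨b, a, rfl⟩, rfl⟩
  refine ⟨star b, a, ?_⟩
  rw [convR_apply, sliceR_gnsVec, MinTensor.tmul_one_one, mul_one]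
  rfl

/-! ### Convergence of the convolution products to the Haar state -/

section Generated

variable {A₁ A₂ : Type u} [CStarAlgebra A₁] [PartialOrder A₁] [StarOrderedRing A₁]
  [CStarAlgebra A₂] [PartialOrder A₂] [StarOrderedRing A₂]
variable {G₁ : CompactQuantumGroup A₁} {G₂ : CompactQuantumGroup A₂}
  {π₁ : A →⋆ₐ[ℂ] A₁} {π₂ : A →⋆ₐ[ℂ] A₂} {h₁ : A₁ →ₚ[ℂ] ℂ} {h₂ : A₂ →ₚ[ℂ] ℂ}

/-- The functional `μ₁ * (μ₁ * μ₂ * μ₁)ⁿ` for the convolution product. -/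
def convPow (G : CompactQuantumGroup A) (μ₁ μ₂ : A →ₚ[ℂ] ℂ) : ℕ → A →L[ℂ] ℂ
  -- The unit for convolution would be the counit, which need not be defined on `A`; hence the start
  -- at `μ₁`, and the extra outer projection in `convPow_convR`.
  | 0 => (gns μ₁).coeff (gnsVec μ₁ 1) (gnsVec μ₁ 1)
  | n + 1 => (((convPow G μ₁ μ₂ n).comp (G.conv μ₁)).comp (G.conv μ₂)).comp (G.conv μ₁)

lemma isMatricialLimit_convPow {μ₁ μ₂ : A →ₚ[ℂ] ℂ} (hμ₁ : IsMatricialLimit μ₁)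
    (hμ₂ : IsMatricialLimit μ₂) (n : ℕ) : IsMatricialLimit (G.convPow μ₁ μ₂ n) := by
  induction n with
  | zero =>
    have e : ⇑(G.convPow μ₁ μ₂ 0) = μ₁ := funext fun a => coeff_gnsVec_one μ₁ a
    rwa [e]
  | succ n ih => exact hμ₁.comp_conv (hμ₂.comp_conv (hμ₁.comp_conv ih))

lemma norm_convPow_le {μ₁ μ₂ : A →ₚ[ℂ] ℂ} (e₁ : μ₁ 1 = 1) (e₂ : μ₂ 1 = 1) (n : ℕ) :
    ‖G.convPow μ₁ μ₂ n‖ ≤ 1 := by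
  refine ContinuousLinearMap.opNorm_le_bound _ zero_le_one fun a => ?_
  rw [one_mul]
  induction n generalizing a with
  | zero =>
    refine ((ContinuousLinearMap.le_opNorm _ a).trans
      (mul_le_mul_of_nonneg_right (norm_coeff_le _ _ _) (norm_nonneg a))).trans_eq ?_
    rw [norm_gnsVec_one e₁, one_mul, one_mul]
  | succ n ih =>
    exact (ih _).trans ((norm_conv_le e₁ _).trans ((norm_conv_le e₂ _).trans (norm_conv_le e₁ a)))

/-- Each left convolution passes through the right convolution operator and acts on `a`; what
remains is a matrix coefficient on `L²(G)`. -/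
lemma IsHaarState.convPow_convR (hh : G.IsHaarState h) {μ₁ μ₂ : A →ₚ[ℂ] ℂ} (e₁ : μ₁ 1 = 1)
    (e₂ : μ₂ 1 = 1) (n : ℕ) (η : (gns h).space) (a : A) :
    G.convPow μ₁ μ₂ n (G.convR (gns h) η (gnsVec h 1) a)
      = inner ℂ η (G.convOp h μ₁
        (((G.convOp h μ₁ * G.convOp h μ₂ * G.convOp h μ₁) ^ n) (gnsVec h a))) := by
  induction n generalizing a with
  | zero =>
    change (gns μ₁).coeff (gnsVec μ₁ 1) (gnsVec μ₁ 1) (G.convR (gns h) η (gnsVec h 1) a)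
      = inner ℂ η (G.convOp h μ₁ (gnsVec h a))
    rw [coeff_gnsVec_one, ← coeff_conv, hh.convOp_gnsVec e₁, inner_gnsVec_right]
  | succ n ih =>
    change G.convPow μ₁ μ₂ n (G.conv μ₁ (G.conv μ₂ (G.conv μ₁
      (G.convR (gns h) η (gnsVec h 1) a)))) = _
    rw [conv_convR, conv_convR, conv_convR, ih, pow_succ]
    change _ = inner ℂ η (G.convOp h μ₁ (((G.convOp h μ₁ * G.convOp h μ₂ * G.convOp h μ₁) ^ n)
      (G.convOp h μ₁ (G.convOp h μ₂ (G.convOp h μ₁ (gnsVec h a))))))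
    rw [hh.convOp_gnsVec e₁, hh.convOp_gnsVec e₂, hh.convOp_gnsVec e₁]

/-- The functionals are contractive, so it suffices to test them on the elements of
`dense_span_convR`. There they are matrix coefficients of the alternating products, and the limit
`⟨b, Ω⟩ ⟨Ω, c⟩` is the value of `h`. -/
lemma IsGeneratedBy.tendsto_convPow (hG : G.IsGeneratedBy π₁ π₂)
    (hh : G.IsHaarState h) (ht : IsTracialState h) (hh₁ : G₁.IsHaarState h₁)
    (hh₂ : G₂.IsHaarState h₂) (hπ₁ : G.IsQuantumSubgroup G₁ π₁) (hπ₂ : G.IsQuantumSubgroup G₂ π₂)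
    (a : A) :
    Tendsto (fun n => G.convPow (h₁.pullback π₁) (h₂.pullback π₂) n a) atTop (𝓝 (h a)) := by
  have e₁ : h₁.pullback π₁ 1 = 1 := hh₁.pullback_one
  have e₂ : h₂.pullback π₂ 1 = 1 := hh₂.pullback_one
  rw [← coeff_gnsVec_one h a]
  refine tendsto_of_dense_span (f := G.convPow (h₁.pullback π₁) (h₂.pullback π₂))
    (fun n => norm_convPow_le e₁ e₂ n) hh.dense_span_convR ?_ a
  rintro _ ⟨b, c, rfl⟩
  have halt := tendsto_alternating (hh.isSymmetric_convOp hh₁ hπ₁) (hh.isSymmetric_convOp hh₂ hπ₂)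
    (hh.convOp_convOp hh₁ hπ₁) (hh.convOp_convOp hh₂ hπ₂) (norm_gnsVec_one hh.map_one)
    (hh.convOp_one e₁) (hh.convOp_one e₂)
    (fun x => hG.eq_zero_of_fixed hh ht hh₁ hh₂ hπ₁ hπ₂) (gnsVec h c)
  have hlim := (((innerSL ℂ (gnsVec h b)).comp (G.convOp h (h₁.pullback π₁))).continuous.tendsto
    _).comp halt
  have elim : (gns h).coeff (gnsVec h 1) (gnsVec h 1)
      (G.convR (gns h) (gnsVec h b) (gnsVec h 1) c)
      = ((innerSL ℂ (gnsVec h b)).comp (G.convOp h (h₁.pullback π₁)))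
        (inner ℂ (gnsVec h 1) (gnsVec h c) • gnsVec h 1) := by
    change _ = inner ℂ (gnsVec h b) (G.convOp h (h₁.pullback π₁) _)
    rw [map_smul, hh.convOp_one e₁, inner_smul_right, coeff_gnsVec_one, ← coeff_conv, hh.conv_self,
      map_smul, coeff_one, inner_gnsVec_right (gnsVec h 1), coeff_gnsVec_one, smul_eq_mul]
  rw [elim]
  exact hlim.congr fun n => (hh.convPow_convR e₁ e₂ n _ c).symm

end Generated

end CompactQuantumGroup

end

theorem theorem3p3 {A A₁ A₂ : Type u}
    [CStarAlgebra A] [PartialOrder A] [StarOrderedRing A]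
    [CStarAlgebra A₁] [PartialOrder A₁] [StarOrderedRing A₁]
    [CStarAlgebra A₂] [PartialOrder A₂] [StarOrderedRing A₂]
    (G : CompactQuantumGroup A) (G₁ : CompactQuantumGroup A₁) (G₂ : CompactQuantumGroup A₂)
    (π₁ : A →⋆ₐ[ℂ] A₁) (π₂ : A →⋆ₐ[ℂ] A₂)
    (hπ₁ : G.IsQuantumSubgroup G₁ π₁) (hπ₂ : G.IsQuantumSubgroup G₂ π₂)
    (h : A →ₚ[ℂ] ℂ) (h₁ : A₁ →ₚ[ℂ] ℂ) (h₂ : A₂ →ₚ[ℂ] ℂ)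
    (hh : G.IsHaarState h) (hh₁ : G₁.IsHaarState h₁) (hh₂ : G₂.IsHaarState h₂)
    (htr : IsTracialState h) (htr₁ : IsTracialState h₁) (htr₂ : IsTracialState h₂)
    (ham₁ : IsAmenableTrace h₁) (ham₂ : IsAmenableTrace h₂)
    (hgen : G.IsGeneratedBy π₁ π₂) :
    IsAmenableTrace h :=
  IsMatricialLimit.isAmenableTrace htr <| IsMatricialLimit.of_tendsto
    (CompactQuantumGroup.isMatricialLimit_convPow (G := G) (ham₁.isMatricialLimit.comp π₁)
      (ham₂.isMatricialLimit.comp π₂))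
    (hgen.tendsto_convPow hh htr hh₁ hh₂ hπ₁ hπ₂)
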